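/- Let $Y=(0,1]^3$, let $D\subset Y$ be measurable (for example a finite union of separated inclusions with $C^{1,\gamma}$ boundary; no regularity of $D$ is needed), and $H=Y\setminus D$. Let $L^2_\#$ be the space of $\mathbb Z^3$-periodic fields in $L^2(Y,\mathbb C^3)$, and let $J$ be the space of periodic $\mathbf u\in H^1_{loc}(\mathbb R^3,\mathbb C^3)$ with $\nabla\cdot\mathbf u=0$ and $\int_Y\mathbf u\,dx=0$, a Hilbert space under $\langle\mathbf u,\mathbf v\rangle=\int_Y\nabla\times\mathbf u\cdot\nabla\times\overline{\mathbf v}\,dx$. Define $(-\Delta)^{-1}:L^2_\#\to J$ by $\langle(-\Delta)^{-1}\mathbf f,\mathbf v\rangle=\int_Y\mathbf f\cdot\overline{\mathbf v}\,dx$ for all $\mathbf v\in J$. For $k\in\mathbb C$ define $T_k$ and $T$ on $J$ by $$\langle T_k\mathbf u,\mathbf w\rangle=k\int_H\nabla\times\mathbf u\cdot\nabla\times\overline{\mathbf w}\,dx+\int_D\nabla\times\mathbf u\cdot\nabla\times\overline{\mathbf w}\,dx,\qquad \langle T\mathbf u,\mathbf w\rangle=\tfrac12\int_H\nabla\times\mathbf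 u\cdot\nabla\times\overline{\mathbf w}\,dx-\tfrac12\int_D\nabla\times\mathbf u\cdot\nabla\times\overline{\mathbf w}\,dx$$ for all $\mathbf w\in J$. Let $W_1,W_2\subset J$ be the subspaces of fields with $\nabla\times\mathbf u=0$ in $D$, respectively in $H$, let $W_3=(W_1\oplus W_2)^\perp$ in $J$, and let $P_2$ be the orthogonal projection of $J$ onto $W_2$. Let $\mu^-=\inf\sigma(T|_{W_3})$ and assume $-\frac12<\mu^-<0$; put $z^*=(\mu^-+\frac12)/(\mu^--\frac12)$. Let $$A(z)=T_{1/z}^{-1}(-\Delta)^{-1}\quad(z\ne0),\qquad A(0)=P_2(-\Delta)^{-1},$$ considered as operators on $L^2_\#$, and $R(\zeta,z)=(A(z)-\zeta)^{-1}$. Let $\beta_0>0$ belong to $\sigma(A(0))$ and let $\Gamma$ be a closed contour (for example piecewise $C^1$) that does not meet $\sigma(A(0))$, has winding number $1$ about $\beta_0$ and winding number $0$ about all other points of $\sigma(A(0))$. Call the points off $\Gamma$ with winding number $1$ inside, and those with winding number $0$ outside $\Gamma$. Let $$d=\inf_{\zeta\in\Gamma}\operatorname{dist}(\zeta,\sigma(A(0))),\qquad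 r^*=\frac{4\pi^2 d\,|z^*|}{\frac{1}{1/2-\mu^-}+4\pi^2 d},\qquad P(z)=-\frac1{2\pi i}\oint_\Gamma R(\zeta,z)\,d\zeta .$$ Then the following hold. 1. If $|z|<r^*$, then $\Gamma$ lies in the resolvent sets of $A(0)$ and $A(z)$, and $\sigma(A(z))$ is the union of the part $\Sigma'(z)$ inside $\Gamma$ and the part $\Sigma''(z)$ outside $\Gamma$. The operator $P(z)$ is a projection commuting with $A(z)$; the restriction of $A(z)$ to the invariant subspace $\mathcal M'(z)=P(z)L^2_\#$ has spectrum $\Sigma'(z)$, and the restriction of $A(z)$ to $\ker P(z)$ has spectrum $\Sigma''(z)$. 2. $P(z)$ is holomorphic in $|z|<r^*$. 3. $\mathcal M'(0)$ is finite dimensional, and $\mathcal M'(z)$ is isomorphic to $\mathcal M'(0)$ for $|z|<r^*$. 4. Let $m=\dim\mathcal M'(0)$, let $\hat\beta(z)=\frac1m\operatorname{tr}(A(z)P(z))$ be the weighted mean of the eigenvalue group, let $A(z)=A(0)+\sum_{n\ge1}z^nA_n$ be the Taylor expansion of $A$ at $0$, and for $n\ge1$ let $$\beta_n=\frac1{2\pi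 i\,m}\operatorname{tr}\sum_{p\ge1}\ \sum_{\substack{k_1+\cdots+k_p=n\\ k_j\ge1}}\frac{(-1)^p}{p}\oint_\Gamma A_{k_1}R(\zeta,0)A_{k_2}R(\zeta,0)\cdots A_{k_p}R(\zeta,0)\,d\zeta .$$ Then the power series $\beta_0+\sum_{n\ge1}z^n\beta_n$ converges to $\hat\beta(z)$, uniformly on $|z|\le\rho$ for every $\rho<r^*$. -/

import Mathlib

noncomputable section

namespace Photonic

open MeasureTheory Filter Topology
open scoped ContDiff ComplexConjugate

/-! ### Periodic fields on the unit cell -/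

/-- The period cell `Y = (0,1]³` with opposite faces identified: functions on `Cell` are
`ℤ³`-periodic functions on `ℝ³`. -/
abbrev Cell : Type := UnitAddTorus (Fin 3)

/-- Lebesgue measure on the cell (total mass one). -/
abbrev cellMeasure : Measure Cell := Measure.pi fun _ => AddCircle.haarAddCircle

/-- Periodic scalar functions in `L²(Y, ℂ)`. -/
abbrev L2Scalar : Type := Lp ℂ 2 cellMeasure

/-- Periodic vector fields in `L²(Y, ℂ³)`, with inner product `∑ i, ∫_Y uᵢ v̄ᵢ`. -/
abbrev L2Field : Type := PiLp 2 fun _ : Fin 3 => L2Scalar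

/-- Smooth periodic test functions. -/
def IsTest (φ : Cell → ℂ) : Prop :=
  ContDiff ℝ ∞ fun x : Fin 3 → ℝ => φ fun i => (x i : UnitAddCircle)

/-- The classical partial derivative `∂ⱼ φ` of a function on the cell. -/
def partialDeriv (j : Fin 3) (φ : Cell → ℂ) (y : Cell) : ℂ :=
  deriv (fun t : ℝ => φ (y + Pi.single j (t : UnitAddCircle))) 0

/-- `g` is the weak derivative `∂ⱼ f`. -/
def HasWeakDeriv (j : Fin 3) (f g : L2Scalar) : Prop :=
  ∀ φ : Cell → ℂ, IsTest φ →
    ∫ y, f y * partialDeriv j φ y ∂cellMeasure = -∫ y, g y * φ y ∂cellMeasure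

open Classical in
/-- The weak derivative `∂ⱼ f` in `L²` (zero if there is none). -/
def weakDeriv (j : Fin 3) (f : L2Scalar) : L2Scalar :=
  if h : ∃ g, HasWeakDeriv j f g then h.choose else 0

/-- `f` is a periodic function in `H¹`. -/
def IsH1 (f : L2Scalar) : Prop := ∀ j, ∃ g, HasWeakDeriv j f g

/-- The weak divergence of a periodic `H¹` field. -/
def weakDiv (u : L2Field) : L2Scalar := ∑ i, weakDeriv i (u i)

/-- The weak curl of a periodic `H¹` field. -/
def weakCurl (u : L2Field) : L2Field :=
  WithLp.toLp 2 ![weakDeriv 1 (u 2) - weakDeriv 2 (u 1),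
    weakDeriv 2 (u 0) - weakDeriv 0 (u 2),
    weakDeriv 0 (u 1) - weakDeriv 1 (u 0)]

/-! ### Auxiliary facts on weak derivatives -/

section Aux

/-- Fourier coefficients. -/
def coeff (f : L2Scalar) (n : Fin 3 → ℤ) : ℂ := UnitAddTorus.mFourierBasis.repr f n

theorem coeff_add (f g : L2Scalar) (n) : coeff (f + g) n = coeff f n + coeff g n := by
  have := map_add UnitAddTorus.mFourierBasis.repr f g
  exact congrArg (fun q : lp (fun _ : (Fin 3 → ℤ) => ℂ) 2 => q n) this

theorem coeff_sub (f g : L2Scalar) (n) : coeff (f - g) n = coeff f n - coeff g n := by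
  have := map_sub UnitAddTorus.mFourierBasis.repr f g
  exact congrArg (fun q : lp (fun _ : (Fin 3 → ℤ) => ℂ) 2 => q n) this

theorem coeff_ext {f g : L2Scalar} (h : ∀ n, coeff f n = coeff g n) : f = g := by
  apply UnitAddTorus.mFourierBasis.repr.injective
  ext n
  exact h n

theorem coeff_eq (f : L2Scalar) (n : Fin 3 → ℤ) :
    coeff f n = ∫ y, f y * UnitAddTorus.mFourier (-n) y ∂cellMeasure := by
  refine (UnitAddTorus.mFourierBasis_repr f n).trans ?_
  refine integral_congr_ae (ae_of_all _ fun y => ?_)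
  simp [mul_comm]

theorem hasSum_coeff (f : L2Scalar) : HasSum (fun n => ‖coeff f n‖ ^ 2) (‖f‖ ^ 2) := by
  have h := lp.hasSum_norm (E := fun _ : (Fin 3 → ℤ) => ℂ) (p := 2) (by simp)
    (UnitAddTorus.mFourierBasis.repr f)
  have h2 : ‖UnitAddTorus.mFourierBasis.repr f‖ = ‖f‖ :=
    UnitAddTorus.mFourierBasis.repr.norm_map f
  rw [h2] at h
  simpa [coeff] using h

theorem isOpenQuotientMap_cell :
    IsOpenQuotientMap fun (x : Fin 3 → ℝ) (i : Fin 3) => (x i : UnitAddCircle) := by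
  exact IsOpenQuotientMap.piMap (f := fun (_ : Fin 3) (t : ℝ) => (t : UnitAddCircle))
    fun _ => QuotientAddGroup.isOpenQuotientMap_mk

theorem partialDeriv_lift {φ : Cell → ℂ} (hφ : IsTest φ) (j : Fin 3) (x : Fin 3 → ℝ) :
    partialDeriv j φ (fun i => (x i : UnitAddCircle)) =
      fderiv ℝ (fun x : Fin 3 → ℝ => φ fun i => (x i : UnitAddCircle)) x (Pi.single j 1) := by
  set Φ : (Fin 3 → ℝ) → ℂ := fun x => φ fun i => (x i : UnitAddCircle) with hΦ
  have h1 : HasFDerivAt Φ (fderiv ℝ Φ x) (x + (0 : ℝ) • Pi.single j (1 : ℝ)) := by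
    simpa using (hφ.differentiable (by simp) x).hasFDerivAt
  have h2 : HasDerivAt (fun t : ℝ => x + t • Pi.single j (1 : ℝ)) (Pi.single j (1 : ℝ)) 0 := by
    simpa using ((hasDerivAt_id (0 : ℝ)).smul_const (Pi.single j (1 : ℝ))).const_add x
  have h3 := h1.comp_hasDerivAt (0 : ℝ) h2
  rw [← h3.deriv]
  unfold partialDeriv
  congr 1
  funext t
  simp only [hΦ, Function.comp]
  congr 1
  funext i
  by_cases hij : i = j
  · subst hij; simp
  · simp [hij]

theorem IsTest.continuous {φ : Cell → ℂ} (hφ : IsTest φ) : Continuous φ :=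
  isOpenQuotientMap_cell.isQuotientMap.continuous_iff.2 (ContDiff.continuous hφ)

theorem IsTest.continuous_partialDeriv {φ : Cell → ℂ} (hφ : IsTest φ) (j : Fin 3) :
    Continuous (partialDeriv j φ) := by
  refine isOpenQuotientMap_cell.isQuotientMap.continuous_iff.2 ?_
  have : (partialDeriv j φ ∘ fun (x : Fin 3 → ℝ) (i : Fin 3) => (x i : UnitAddCircle)) =
      fun x => fderiv ℝ (fun x : Fin 3 → ℝ => φ fun i => (x i : UnitAddCircle)) x
        (Pi.single j 1) := funext fun x => partialDeriv_lift hφ j x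
  rw [this]
  exact (ContDiff.continuous_fderiv hφ (by simp)).clm_apply continuous_const

theorem isTest_mFourier (n : Fin 3 → ℤ) : IsTest (UnitAddTorus.mFourier n) := by
  unfold IsTest
  simp only [UnitAddTorus.mFourier, ContinuousMap.coe_mk, fourier_coe_apply]
  have h : ∀ i : Fin 3, ContDiff ℝ ∞ fun x : Fin 3 → ℝ => ((x i : ℝ) : ℂ) := fun i =>
    Complex.ofRealCLM.contDiff.comp (contDiff_apply ℝ ℝ i)
  exact contDiff_prod fun i _ => ((contDiff_const.mul (h i)).div_const _).cexp

theorem partialDeriv_mFourier (n : Fin 3 → ℤ) (j : Fin 3) (y : Cell) :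
    partialDeriv j (UnitAddTorus.mFourier n) y =
      2 * Real.pi * Complex.I * n j * UnitAddTorus.mFourier n y := by
  have h : (fun t : ℝ => UnitAddTorus.mFourier n (y + Pi.single j (t : UnitAddCircle))) =
      fun t : ℝ => UnitAddTorus.mFourier n y * Complex.exp (2 * Real.pi * Complex.I * n j * t) := by
    funext t
    simp only [UnitAddTorus.mFourier, ContinuousMap.coe_mk, Pi.add_apply]
    have : ∀ i, fourier (n i) (y i + (Pi.single j (t : UnitAddCircle) : Cell) i) =
        fourier (n i) (y i) * fourier (n i) ((Pi.single j (t : UnitAddCircle) : Cell) i) := by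
      intro i; simp [fourier_apply, smul_add, AddCircle.toCircle_add]
    rw [Finset.prod_congr rfl fun i _ => this i, Finset.prod_mul_distrib]
    congr 1
    rw [Finset.prod_eq_single j]
    · simp
    · intro i _ hi; simp [hi]
    · simp
  unfold partialDeriv
  rw [h]
  have h2 : HasDerivAt (fun t : ℝ => UnitAddTorus.mFourier n y *
      Complex.exp (2 * Real.pi * Complex.I * n j * t))
      (UnitAddTorus.mFourier n y * (Complex.exp (2 * Real.pi * Complex.I * n j * (0 : ℝ)) *
        (2 * Real.pi * Complex.I * n j * 1))) 0 := by
    have := (Complex.ofRealCLM.hasDerivAt (x := (0 : ℝ))).const_mul (2 * Real.pi * Complex.I * n j)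
    simpa using (this.cexp).const_mul (UnitAddTorus.mFourier n y)
  rw [h2.deriv]
  simp; ring

theorem HasWeakDeriv.coeff {j : Fin 3} {f g : L2Scalar} (h : HasWeakDeriv j f g)
    (n : Fin 3 → ℤ) : coeff g n = 2 * Real.pi * Complex.I * n j * coeff f n := by
  have := h _ (isTest_mFourier (-n))
  rw [coeff_eq, coeff_eq, ← neg_eq_iff_eq_neg.2 this, ← integral_const_mul, ← integral_neg]
  congr 1
  funext y
  rw [partialDeriv_mFourier]
  simp; ring

theorem HasWeakDeriv.unique {j : Fin 3} {f g g' : L2Scalar} (h : HasWeakDeriv j f g)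
    (h' : HasWeakDeriv j f g') : g = g' :=
  coeff_ext fun n => by rw [h.coeff, h'.coeff]

theorem HasWeakDeriv.weakDeriv_eq {j : Fin 3} {f g : L2Scalar} (h : HasWeakDeriv j f g) :
    weakDeriv j f = g := by
  have h' : ∃ g, HasWeakDeriv j f g := ⟨g, h⟩
  rw [weakDeriv, dif_pos h']
  exact h'.choose_spec.unique h

theorem IsH1.hasWeakDeriv {f : L2Scalar} (h : IsH1 f) (j : Fin 3) :
    HasWeakDeriv j f (weakDeriv j f) := by
  obtain ⟨g, hg⟩ := h j
  rwa [hg.weakDeriv_eq]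

theorem memLp_of_continuous {φ : Cell → ℂ} (hφ : Continuous φ) : MemLp φ 2 cellMeasure :=
  ContinuousMap.memLp (E := ℂ) (p := 2) cellMeasure ℂ ⟨φ, hφ⟩

theorem integrable_mul {φ : Cell → ℂ} (hφ : Continuous φ) (f : L2Scalar) :
    Integrable (fun y => f y * φ y) cellMeasure :=
  MemLp.integrable_mul (Lp.memLp f) (memLp_of_continuous hφ)

theorem integral_mul_eq_inner {φ : Cell → ℂ} (hφ : Continuous φ) (f : L2Scalar) :
    ∫ y, f y * φ y ∂cellMeasure =
      inner ℂ ((memLp_of_continuous (Complex.continuous_conj.comp hφ)).toLp _ : L2Scalar) f := by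
  rw [L2.inner_def]
  refine integral_congr_ae ?_
  filter_upwards [(memLp_of_continuous (Complex.continuous_conj.comp hφ)).coeFn_toLp] with y hy
  rw [hy]
  simp [RCLike.inner_apply]

theorem HasWeakDeriv.add {j : Fin 3} {f g f' g' : L2Scalar} (h : HasWeakDeriv j f g)
    (h' : HasWeakDeriv j f' g') : HasWeakDeriv j (f + f') (g + g') := by
  intro φ hφ
  rw [integral_mul_eq_inner (hφ.continuous_partialDeriv j), integral_mul_eq_inner hφ.continuous,
    inner_add_right, inner_add_right]
  have a := h φ hφ
  have b := h' φ hφ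
  rw [integral_mul_eq_inner (hφ.continuous_partialDeriv j),
    integral_mul_eq_inner hφ.continuous] at a b
  rw [a, b]; ring

theorem HasWeakDeriv.smul {j : Fin 3} {f g : L2Scalar} (c : ℂ) (h : HasWeakDeriv j f g) :
    HasWeakDeriv j (c • f) (c • g) := by
  intro φ hφ
  rw [integral_mul_eq_inner (hφ.continuous_partialDeriv j), integral_mul_eq_inner hφ.continuous,
    inner_smul_right, inner_smul_right]
  have a := h φ hφ
  rw [integral_mul_eq_inner (hφ.continuous_partialDeriv j),
    integral_mul_eq_inner hφ.continuous] at a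
  rw [a]; ring

theorem HasWeakDeriv.lim {j : Fin 3} {f g : ℕ → L2Scalar} {F G : L2Scalar}
    (h : ∀ k, HasWeakDeriv j (f k) (g k)) (hf : Tendsto f atTop (𝓝 F))
    (hg : Tendsto g atTop (𝓝 G)) : HasWeakDeriv j F G := by
  intro φ hφ
  rw [integral_mul_eq_inner (hφ.continuous_partialDeriv j), integral_mul_eq_inner hφ.continuous]
  refine tendsto_nhds_unique ((tendsto_const_nhds (x := _)).inner hf) ?_
  refine ((tendsto_const_nhds.inner hg).neg).congr fun k => ?_
  have a := h k φ hφ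
  rw [integral_mul_eq_inner (hφ.continuous_partialDeriv j),
    integral_mul_eq_inner hφ.continuous] at a
  exact a.symm

theorem hasWeakDeriv_zero (j : Fin 3) : HasWeakDeriv j 0 0 := by
  intro φ hφ
  rw [integral_mul_eq_inner (hφ.continuous_partialDeriv j), integral_mul_eq_inner hφ.continuous]
  simp

theorem isH1_zero : IsH1 0 := fun j => ⟨0, hasWeakDeriv_zero j⟩

theorem IsH1.add {f g : L2Scalar} (hf : IsH1 f) (hg : IsH1 g) : IsH1 (f + g) :=
  fun j => ⟨_, (hf.hasWeakDeriv j).add (hg.hasWeakDeriv j)⟩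

theorem IsH1.smul {f : L2Scalar} (c : ℂ) (hf : IsH1 f) : IsH1 (c • f) :=
  fun j => ⟨_, (hf.hasWeakDeriv j).smul c⟩

theorem weakDeriv_add {f g : L2Scalar} (hf : IsH1 f) (hg : IsH1 g) (j : Fin 3) :
    weakDeriv j (f + g) = weakDeriv j f + weakDeriv j g :=
  ((hf.hasWeakDeriv j).add (hg.hasWeakDeriv j)).weakDeriv_eq

theorem weakDeriv_smul {f : L2Scalar} (c : ℂ) (hf : IsH1 f) (j : Fin 3) :
    weakDeriv j (c • f) = c • weakDeriv j f :=
  ((hf.hasWeakDeriv j).smul c).weakDeriv_eq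

theorem weakDiv_add {u v : L2Field} (hu : ∀ i, IsH1 (u i)) (hv : ∀ i, IsH1 (v i)) :
    weakDiv (u + v) = weakDiv u + weakDiv v := by
  simp only [weakDiv, PiLp.add_apply, weakDeriv_add (hu _) (hv _), Finset.sum_add_distrib]

theorem weakDiv_smul (c : ℂ) {u : L2Field} (hu : ∀ i, IsH1 (u i)) :
    weakDiv (c • u) = c • weakDiv u := by
  simp only [weakDiv, PiLp.smul_apply, weakDeriv_smul c (hu _), Finset.smul_sum]

theorem weakCurl_add {u v : L2Field} (hu : ∀ i, IsH1 (u i)) (hv : ∀ i, IsH1 (v i)) :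
    weakCurl (u + v) = weakCurl u + weakCurl v := by
  ext1 i
  simp only [weakCurl, PiLp.add_apply, weakDeriv_add (hu _) (hv _)]
  fin_cases i <;> simp <;> abel

theorem weakCurl_smul (c : ℂ) {u : L2Field} (hu : ∀ i, IsH1 (u i)) :
    weakCurl (c • u) = c • weakCurl u := by
  ext1 i
  simp only [weakCurl, PiLp.smul_apply, weakDeriv_smul c (hu _)]
  fin_cases i <;> simp [smul_sub]

theorem integral_eq_coeff_zero (f : L2Scalar) : ∫ y, f y ∂cellMeasure = coeff f 0 := by
  rw [coeff_eq]; simp [UnitAddTorus.mFourier_zero]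

theorem coeff_smul (c : ℂ) (f : L2Scalar) (n) : coeff (c • f) n = c * coeff f n := by
  rw [coeff, map_smul]; rfl

theorem coeff_zero (n) : coeff 0 n = 0 := by
  rw [coeff, map_zero]; rfl

end Aux

/-! ### The energy space -/

/-- Periodic, divergence free, mean zero fields in `H¹`, as a subspace of `L²(Y, ℂ³)`. -/
def solenoidal : Submodule ℂ L2Field where
  carrier := {u | (∀ i, IsH1 (u i)) ∧ weakDiv u = 0 ∧ ∀ i, ∫ y, u i y ∂cellMeasure = 0}
  zero_mem' := by
    refine ⟨fun i => isH1_zero, ?_, fun i => ?_⟩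
    · simp only [weakDiv, PiLp.zero_apply, (hasWeakDeriv_zero _).weakDeriv_eq,
        Finset.sum_const_zero]
    · rw [integral_eq_coeff_zero]; exact coeff_zero 0
  add_mem' := by
    rintro u v ⟨hu, du, mu⟩ ⟨hv, dv, mv⟩
    refine ⟨fun i => (hu i).add (hv i), ?_, fun i => ?_⟩
    · rw [weakDiv_add hu hv, du, dv, add_zero]
    · have a := mu i
      have b := mv i
      rw [integral_eq_coeff_zero] at a b ⊢
      rw [PiLp.add_apply, coeff_add, a, b, add_zero]
  smul_mem' := by
    rintro c u ⟨hu, du, mu⟩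
    refine ⟨fun i => (hu i).smul c, ?_, fun i => ?_⟩
    · rw [weakDiv_smul c hu, du, smul_zero]
    · have a := mu i
      rw [integral_eq_coeff_zero] at a ⊢
      rw [PiLp.smul_apply, coeff_smul, a, mul_zero]

section Aux

theorem cross_identity (m : Fin 3 → ℝ) (a : Fin 3 → ℂ) (h : ∑ i, (m i : ℂ) * a i = 0) :
    ‖m 1 * a 2 - m 2 * a 1‖ ^ 2 + ‖m 2 * a 0 - m 0 * a 2‖ ^ 2 + ‖m 0 * a 1 - m 1 * a 0‖ ^ 2 =
      (m 0 ^ 2 + m 1 ^ 2 + m 2 ^ 2) * (‖a 0‖ ^ 2 + ‖a 1‖ ^ 2 + ‖a 2‖ ^ 2) := by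
  rw [Fin.sum_univ_three] at h
  have hr := congrArg Complex.re h
  have hi := congrArg Complex.im h
  simp only [← Complex.normSq_eq_norm_sq, Complex.normSq_apply]
  simp at hr hi ⊢
  linear_combination (-(m 0 * (a 0).re + m 1 * (a 1).re + m 2 * (a 2).re)) * hr -
    (m 0 * (a 0).im + m 1 * (a 1).im + m 2 * (a 2).im) * hi

theorem coeff_curl {u : L2Field} (hu : u ∈ solenoidal) (n : Fin 3 → ℤ) :
    ∑ k, ‖coeff (weakCurl u k) n‖ ^ 2 =
      (2 * Real.pi) ^ 2 * ((n 0 : ℝ) ^ 2 + (n 1 : ℝ) ^ 2 + (n 2 : ℝ) ^ 2) *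
        (‖coeff (u 0) n‖ ^ 2 + ‖coeff (u 1) n‖ ^ 2 + ‖coeff (u 2) n‖ ^ 2) := by
  obtain ⟨h1, hd, -⟩ := hu
  have hc : ∀ i j, coeff (weakDeriv j (u i)) n = 2 * Real.pi * Complex.I * n j * coeff (u i) n :=
    fun i j => ((h1 i).hasWeakDeriv j).coeff n
  have hdiv : ∑ i, (((n i : ℤ) : ℝ) : ℂ) * coeff (u i) n = 0 := by
    have := congrArg (fun f => coeff f n) hd
    simp only [weakDiv, Fin.sum_univ_three, coeff_add, hc, coeff_zero] at this
    have hpi : (2 * Real.pi * Complex.I : ℂ) ≠ 0 := by simp [Real.pi_ne_zero]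
    apply mul_left_cancel₀ hpi
    rw [mul_zero, ← this, Fin.sum_univ_three]
    push_cast
    ring
  rw [mul_assoc, ← cross_identity (fun i => (n i : ℝ)) (fun i => coeff (u i) n) hdiv,
    Fin.sum_univ_three]
  have key : ∀ p q r s : ℂ, ‖2 * Real.pi * Complex.I * p * r - 2 * Real.pi * Complex.I * q * s‖ ^ 2
      = (2 * Real.pi) ^ 2 * ‖p * r - q * s‖ ^ 2 := by
    intro p q r s
    have : 2 * Real.pi * Complex.I * p * r - 2 * Real.pi * Complex.I * q * s =
      2 * Real.pi * Complex.I * (p * r - q * s) := by ring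
    rw [this, norm_mul, mul_pow]
    simp [abs_of_pos Real.pi_pos]
  simp only [weakCurl, Matrix.cons_val_zero, Matrix.cons_val_one, Matrix.cons_val, coeff_sub, hc,
    key]
  push_cast
  ring

theorem norm_le_of_coeff {u : L2Field} {f : L2Scalar}
    (h : ∀ n, ‖coeff f n‖ ^ 2 ≤ ∑ k, ‖coeff (weakCurl u k) n‖ ^ 2) : ‖f‖ ≤ ‖weakCurl u‖ := by
  refine le_of_sq_le_sq ?_ (norm_nonneg _)
  rw [PiLp.norm_sq_eq_of_L2]
  exact hasSum_le h (hasSum_coeff f) (hasSum_sum fun k _ => hasSum_coeff (weakCurl u k))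

theorem norm_weakDeriv_le {u : L2Field} (hu : u ∈ solenoidal) (i j : Fin 3) :
    ‖weakDeriv j (u i)‖ ≤ ‖weakCurl u‖ := by
  refine norm_le_of_coeff fun n => ?_
  rw [coeff_curl hu, ((hu.1 i).hasWeakDeriv j).coeff n]
  have e : ‖2 * Real.pi * Complex.I * n j * coeff (u i) n‖ ^ 2 =
      (2 * Real.pi) ^ 2 * (n j : ℝ) ^ 2 * ‖coeff (u i) n‖ ^ 2 := by
    simp only [norm_mul, mul_pow]
    simp [abs_of_pos Real.pi_pos]
  rw [e]
  have e1 : (n j : ℝ) ^ 2 ≤ (n 0 : ℝ) ^ 2 + (n 1 : ℝ) ^ 2 + (n 2 : ℝ) ^ 2 := by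
    fin_cases j <;> simp <;> nlinarith [sq_nonneg (n 0 : ℝ), sq_nonneg (n 1 : ℝ), sq_nonneg (n 2 : ℝ)]
  have e2 : ‖coeff (u i) n‖ ^ 2 ≤
      ‖coeff (u 0) n‖ ^ 2 + ‖coeff (u 1) n‖ ^ 2 + ‖coeff (u 2) n‖ ^ 2 := by
    fin_cases i <;> simp <;> nlinarith [sq_nonneg ‖coeff (u 0) n‖, sq_nonneg ‖coeff (u 1) n‖,
      sq_nonneg ‖coeff (u 2) n‖]
  gcongr

theorem norm_component_le {u : L2Field} (hu : u ∈ solenoidal) (i : Fin 3) :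
    ‖u i‖ ≤ ‖weakCurl u‖ := by
  refine norm_le_of_coeff fun n => ?_
  rw [coeff_curl hu]
  have e2 : ‖coeff (u i) n‖ ^ 2 ≤
      ‖coeff (u 0) n‖ ^ 2 + ‖coeff (u 1) n‖ ^ 2 + ‖coeff (u 2) n‖ ^ 2 := by
    fin_cases i <;> simp <;> nlinarith [sq_nonneg ‖coeff (u 0) n‖, sq_nonneg ‖coeff (u 1) n‖,
      sq_nonneg ‖coeff (u 2) n‖]
  by_cases hn : n = 0
  · have : coeff (u i) n = 0 := by rw [hn, ← integral_eq_coeff_zero]; exact hu.2.2 i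
    rw [this]; simp; positivity
  · obtain ⟨j, hj⟩ := Function.ne_iff.1 hn
    have e1 : (1 : ℝ) ≤ (n j : ℝ) ^ 2 := by
      have h0 : (1 : ℤ) ≤ (n j) ^ 2 := by
        have := sq_pos_of_ne_zero (a := n j) hj
        omega
      exact_mod_cast h0
    have e3 : (n j : ℝ) ^ 2 ≤ (n 0 : ℝ) ^ 2 + (n 1 : ℝ) ^ 2 + (n 2 : ℝ) ^ 2 := by
      fin_cases j <;> simp <;>
        nlinarith [sq_nonneg (n 0 : ℝ), sq_nonneg (n 1 : ℝ), sq_nonneg (n 2 : ℝ)]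
    have e4 : (1 : ℝ) ≤ (2 * Real.pi) ^ 2 * ((n 0 : ℝ) ^ 2 + (n 1 : ℝ) ^ 2 + (n 2 : ℝ) ^ 2) := by
      have : (1 : ℝ) ≤ (2 * Real.pi) ^ 2 := by nlinarith [Real.pi_gt_three]
      nlinarith
    refine e2.trans (le_mul_of_one_le_left (by positivity) e4)

end Aux

/-- The space `J` of periodic, divergence free, mean zero `H¹` fields, which carries the inner
product `⟨u, v⟩ = ∫_Y curl u · curl v̄`. -/
def J : Type := solenoidal

instance : AddCommGroup J := inferInstanceAs (AddCommGroup solenoidal)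

instance : Module ℂ J := inferInstanceAs (Module ℂ solenoidal)

/-- The inclusion of `J` in `L²(Y, ℂ³)`. -/
def toFieldLin : J →ₗ[ℂ] L2Field := solenoidal.subtype

theorem toFieldLin_mem (u : J) : toFieldLin u ∈ solenoidal := Subtype.property (p := (· ∈ solenoidal)) u

theorem toFieldLin_injective : Function.Injective toFieldLin :=
  Subtype.val_injective (p := (· ∈ solenoidal))

/-- The curl as a linear map on `J`. -/
def curlLin : J →ₗ[ℂ] L2Field where
  toFun u := weakCurl (toFieldLin u)
  map_add' u v := by
    rw [map_add, weakCurl_add (toFieldLin_mem u).1 (toFieldLin_mem v).1]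
  map_smul' c u := by
    rw [map_smul, weakCurl_smul c (toFieldLin_mem u).1, RingHom.id_apply]

theorem curlLin_eq_zero {u : J} (h : curlLin u = 0) : u = 0 := by
  apply toFieldLin_injective
  rw [map_zero]
  ext1 i
  have := norm_component_le (toFieldLin_mem u) i
  have h0 : weakCurl (toFieldLin u) = 0 := h
  rw [h0, norm_zero] at this
  exact norm_le_zero_iff.1 this

/-- The inner product `∫_Y curl u · curl v̄` on `J` (conjugate linear in the first slot, following
the library's convention). -/
abbrev energyCore : InnerProductSpace.Core ℂ J where
  inner u v := inner ℂ (curlLin u) (curlLin v)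
  conj_inner_symm u v := inner_conj_symm _ _
  re_inner_nonneg u := inner_self_nonneg
  add_left u v w := by rw [map_add, inner_add_left]
  smul_left u v c := by rw [map_smul, inner_smul_left]
  definite u h := curlLin_eq_zero (inner_self_eq_zero.1 h)

instance : NormedAddCommGroup J := energyCore.toNormedAddCommGroup

instance : InnerProductSpace ℂ J := InnerProductSpace.ofCore energyCore.toCore

theorem inner_J (u v : J) : inner ℂ u v = inner ℂ (curlLin u) (curlLin v) := rfl

theorem norm_J (u : J) : ‖u‖ = ‖curlLin u‖ := by
  rw [@norm_eq_sqrt_re_inner ℂ, @norm_eq_sqrt_re_inner ℂ L2Field, inner_J]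

instance : CompleteSpace J := by
  refine Metric.complete_of_cauchySeq_tendsto fun s hs => ?_
  have cau : ∀ (F : J →ₗ[ℂ] L2Scalar), (∀ u, ‖F u‖ ≤ ‖u‖) →
      ∃ g, Tendsto (fun k => F (s k)) atTop (𝓝 g) := by
    intro F hF
    refine cauchySeq_tendsto_of_complete ?_
    exact (LipschitzWith.of_dist_le_mul (K := 1) fun u v => by
      rw [dist_eq_norm, dist_eq_norm, ← map_sub]; simpa using hF (u - v)).uniformContinuous.comp_cauchySeq hs
  let Fd : Fin 3 → Fin 3 → J →ₗ[ℂ] L2Scalar := fun i j =>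
    { toFun := fun u => weakDeriv j (toFieldLin u i)
      map_add' := fun u v => by
        rw [map_add, PiLp.add_apply, weakDeriv_add ((toFieldLin_mem u).1 i) ((toFieldLin_mem v).1 i)]
      map_smul' := fun c u => by
        rw [map_smul, PiLp.smul_apply, weakDeriv_smul c ((toFieldLin_mem u).1 i), RingHom.id_apply] }
  let F0 : Fin 3 → J →ₗ[ℂ] L2Scalar := fun i =>
    { toFun := fun u => toFieldLin u i
      map_add' := fun u v => by rw [map_add, PiLp.add_apply]
      map_smul' := fun c u => by rw [map_smul, PiLp.smul_apply, RingHom.id_apply] }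
  have h0 := fun i => cau (F0 i) fun u => by
    rw [norm_J]; exact norm_component_le (toFieldLin_mem u) i
  have hd := fun i j => cau (Fd i j) fun u => by
    rw [norm_J]; exact norm_weakDeriv_le (toFieldLin_mem u) i j
  choose f hf using h0
  choose g hg using hd
  have hw : ∀ i j, HasWeakDeriv j (f i) (g i j) := fun i j =>
    HasWeakDeriv.lim (fun k => ((toFieldLin_mem (s k)).1 i).hasWeakDeriv j) (hf i) (hg i j)
  have hmem : (WithLp.toLp 2 f : L2Field) ∈ solenoidal := by
    refine ⟨fun i j => ⟨_, hw i j⟩, ?_, fun i => ?_⟩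
    · have e : weakDiv (WithLp.toLp 2 f : L2Field) = ∑ i, g i i :=
        Finset.sum_congr rfl fun i _ => (hw i i).weakDeriv_eq
      rw [e]
      refine tendsto_nhds_unique (tendsto_finsetSum _ fun i _ => hg i i) ?_
      refine (tendsto_const_nhds (x := (0 : L2Scalar))).congr fun k => ?_
      exact ((toFieldLin_mem (s k)).2.1).symm
    · have c1 : Continuous fun q : L2Scalar => coeff q 0 := by
        have : (fun q : L2Scalar => coeff q 0) =
            fun q => inner ℂ (UnitAddTorus.mFourierBasis 0) q := by
          funext q; exact UnitAddTorus.mFourierBasis.repr_apply_apply q 0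
        rw [this]
        exact continuous_const.inner continuous_id
      rw [integral_eq_coeff_zero]
      refine tendsto_nhds_unique ((c1.tendsto (f i)).comp (hf i)) ?_
      refine (tendsto_const_nhds (x := (0 : ℂ))).congr fun k => ?_
      have := (toFieldLin_mem (s k)).2.2 i
      rw [integral_eq_coeff_zero] at this
      exact this.symm
  obtain ⟨U, hU⟩ : ∃ U : J, toFieldLin U = WithLp.toLp 2 f := ⟨(⟨_, hmem⟩ : solenoidal), rfl⟩
  refine ⟨U, ?_⟩
  rw [tendsto_iff_norm_sub_tendsto_zero]
  have hcurl : Tendsto (fun k => curlLin (s k)) atTop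
      (𝓝 (weakCurl (WithLp.toLp 2 f : L2Field))) := by
    have e : weakCurl (WithLp.toLp 2 f : L2Field) =
        WithLp.toLp 2 ![g 2 1 - g 1 2, g 0 2 - g 2 0, g 1 0 - g 0 1] := by
      simp only [weakCurl, (hw _ _).weakDeriv_eq]
    rw [e]
    refine ((PiLp.continuous_toLp 2 _).tendsto _).comp (tendsto_pi_nhds.2 fun i => ?_)
    fin_cases i
    · exact (hg 2 1).sub (hg 1 2)
    · exact (hg 0 2).sub (hg 2 0)
    · exact (hg 1 0).sub (hg 0 1)
  rw [tendsto_iff_norm_sub_tendsto_zero] at hcurl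
  refine hcurl.congr fun k => ?_
  rw [norm_J, map_sub, ← hU]
  rfl

/-! ### The operators of the crystal -/

/-- The curl `J → L²(Y, ℂ³)`. -/
def curl : J →L[ℂ] L2Field :=
  LinearIsometry.toContinuousLinearMap ⟨curlLin, fun u => (norm_J u).symm⟩

/-- The inclusion `J → L²(Y, ℂ³)`. -/
def incl : J →L[ℂ] L2Field :=
  toFieldLin.mkContinuous 2 fun u => by
    refine le_of_sq_le_sq ?_ (by positivity)
    rw [PiLp.norm_sq_eq_of_L2, Fin.sum_univ_three, norm_J]
    have h := fun i => pow_le_pow_left₀ (norm_nonneg _) (norm_component_le (toFieldLin_mem u) i) 2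
    have e : ‖curlLin u‖ = ‖weakCurl (toFieldLin u)‖ := rfl
    rw [e]
    nlinarith [h 0, h 1, h 2]

/-- The solution operator `(-Δ)⁻¹ : L²(Y, ℂ³) → J` of the vector Laplace problem on `J`; it is
the operator with `⟨(-Δ)⁻¹ f, v⟩ = ∫_Y f · v̄` for all `v ∈ J`, see `inner_invLaplacian`. -/
def invLaplacian : L2Field →L[ℂ] J := ContinuousLinearMap.adjoint incl

theorem inner_invLaplacian (f : L2Field) (v : J) :
    inner ℂ v (invLaplacian f) = inner ℂ (incl v) f :=
  ContinuousLinearMap.adjoint_inner_right incl v f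

/-- Multiplication of a scalar function by the characteristic function of `S`. -/
def cutScalar {S : Set Cell} (hS : MeasurableSet S) : L2Scalar →L[ℂ] L2Scalar :=
  LinearMap.mkContinuous
    { toFun := fun f => ((Lp.memLp f).indicator hS).toLp _
      map_add' := fun f g => by
        rw [← MemLp.toLp_add]
        refine MemLp.toLp_congr _ _ ?_
        filter_upwards [Lp.coeFn_add f g] with y hy
        by_cases h : y ∈ S
        · simpa only [Pi.add_apply, Set.indicator_of_mem h] using hy
        · simp only [Pi.add_apply, Set.indicator_of_notMem h, add_zero]
      map_smul' := fun c f => by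
        rw [RingHom.id_apply, ← MemLp.toLp_const_smul]
        refine MemLp.toLp_congr _ _ ?_
        filter_upwards [Lp.coeFn_smul c f] with y hy
        by_cases h : y ∈ S
        · simpa only [Pi.smul_apply, Set.indicator_of_mem h] using hy
        · simp only [Pi.smul_apply, Set.indicator_of_notMem h, smul_zero] } 1 fun f => by
    rw [one_mul]
    refine Lp.norm_le_norm_of_ae_le ?_
    filter_upwards [((Lp.memLp f).indicator hS).coeFn_toLp] with y hy
    refine (congrArg norm hy).trans_le ?_
    exact norm_indicator_le_norm_self _ _

theorem cutScalar_ae {S : Set Cell} (hS : MeasurableSet S) (f : L2Scalar) :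
    cutScalar hS f =ᵐ[cellMeasure] S.indicator f :=
  ((Lp.memLp f).indicator hS).coeFn_toLp

theorem norm_cutScalar_le {S : Set Cell} (hS : MeasurableSet S) (f : L2Scalar) :
    ‖cutScalar hS f‖ ≤ ‖f‖ := by
  refine Lp.norm_le_norm_of_ae_le ?_
  filter_upwards [cutScalar_ae hS f] with y hy
  exact (congrArg norm hy).trans_le (norm_indicator_le_norm_self _ _)

/-- Multiplication of a vector field by the characteristic function of `S`. -/
def cut {S : Set Cell} (hS : MeasurableSet S) : L2Field →L[ℂ] L2Field :=
  LinearMap.mkContinuous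
    { toFun := fun u => WithLp.toLp 2 fun i => cutScalar hS (u i)
      map_add' := fun u v => by ext1 i; simp
      map_smul' := fun c u => by ext1 i; simp } 1 fun u => by
    rw [one_mul]
    refine le_of_sq_le_sq ?_ (norm_nonneg _)
    rw [PiLp.norm_sq_eq_of_L2, PiLp.norm_sq_eq_of_L2]
    exact Finset.sum_le_sum fun i _ =>
      pow_le_pow_left₀ (norm_nonneg _) (norm_cutScalar_le hS (u i)) 2

theorem inner_cut {S : Set Cell} (hS : MeasurableSet S) (u w : L2Field) :
    inner ℂ w (cut hS u) = ∫ y in S, ∑ i, u i y * conj (w i y) ∂cellMeasure := by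
  rw [PiLp.inner_apply, ← integral_indicator hS]
  have hint : ∀ i, Integrable (fun y => inner ℂ (w i y) (cut hS u i y)) cellMeasure :=
    fun i => L2.integrable_inner _ _
  simp only [L2.inner_def]
  rw [← integral_finsetSum _ fun i _ => hint i]
  have hae : ∀ᵐ y ∂cellMeasure, ∀ i, cut hS u i y = S.indicator (u i) y :=
    ae_all_iff.2 fun i => cutScalar_ae hS (u i)
  refine integral_congr_ae ?_
  filter_upwards [hae] with y hy
  by_cases h : y ∈ S <;> simp [hy, h, RCLike.inner_apply]

section Crystal

variable {D : Set Cell} (hD : MeasurableSet D)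

/-- The part of the curl energy carried by the inclusion: `⟨energyD u, w⟩ = ∫_D curl u · curl w̄`. -/
def energyD : J →L[ℂ] J := ContinuousLinearMap.adjoint curl ∘L cut hD ∘L curl

/-- The part of the curl energy carried by the host `H = Y \ D`:
`⟨energyH u, w⟩ = ∫_H curl u · curl w̄`. -/
def energyH : J →L[ℂ] J := ContinuousLinearMap.adjoint curl ∘L cut hD.compl ∘L curl

/-- The operator `T_k` on `J` associated with the form `B_k`, see `inner_contrastOp`. -/
def contrastOp (k : ℂ) : J →L[ℂ] J := k • energyH hD + energyD hD

theorem inner_contrastOp (k : ℂ) (u w : J) :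
    inner ℂ w (contrastOp hD k u) =
      k * ∫ y in Dᶜ, ∑ i, curl u i y * conj (curl w i y) ∂cellMeasure +
        ∫ y in D, ∑ i, curl u i y * conj (curl w i y) ∂cellMeasure := by
  rw [← inner_cut hD, ← inner_cut hD.compl]
  simp only [contrastOp, energyH, energyD, add_apply,
    smul_apply, ContinuousLinearMap.comp_apply, inner_add_right,
    inner_smul_right, ContinuousLinearMap.adjoint_inner_right]

/-- The resonance operator `T`:
`⟨T u, w⟩ = ½ ∫_H curl u · curl w̄ - ½ ∫_D curl u · curl w̄`. Thus `T u = μ u` if and only if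
`∫_D curl u · curl w̄ = (½ - μ) ∫_Y curl u · curl w̄` for all `w ∈ J`. -/
def resonanceOp : J →L[ℂ] J := (1 / 2 : ℂ) • (energyH hD - energyD hD)

/-- `W₁`: the fields in `J` with `curl u = 0` in `D`. -/
def W1 : Submodule ℂ J := (cut hD ∘L curl).ker

/-- `W₂`: the fields in `J` with `curl u = 0` in `H`. -/
def W2 : Submodule ℂ J := (cut hD.compl ∘L curl).ker

/-- `W₃`: the orthogonal complement of `W₁ ⊕ W₂` in `J`. -/
def W3 : Submodule ℂ J := (W1 hD ⊔ W2 hD)ᗮ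

instance : CompleteSpace (W2 hD) :=
  inferInstanceAs (CompleteSpace (cut hD.compl ∘L curl).ker)

end Crystal

/-- The spectrum of the part of a bounded operator `A` in a closed invariant subspace `M`. -/
def spectrumOn {E : Type*} [NormedAddCommGroup E] [NormedSpace ℂ E] (A : E →L[ℂ] E)
    (M : Submodule ℂ E) : Set ℂ :=
  {ζ | ¬ Set.BijOn (fun u => A u - ζ • u) M M}

section Crystal

variable {D : Set Cell} (hD : MeasurableSet D)

/-- The lower end `μ⁻` of the resonance spectrum `σ(T; W₃)`. -/
def muMinus : ℝ := sInf {μ : ℝ | (μ : ℂ) ∈ spectrumOn (resonanceOp hD) (W3 hD)}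

/-- The pole bound `z* = (μ⁻ + ½) / (μ⁻ - ½)`. -/
def zStar : ℝ := (muMinus hD + 1 / 2) / (muMinus hD - 1 / 2)

/-- The operator family `A(z)` on `L²(Y, ℂ³)`: `A(1/k) = T_k⁻¹ (-Δ)⁻¹`, and
`A(0) = P₂ (-Δ)⁻¹` with `P₂` the orthogonal projection of `J` onto `W₂`. -/
def solutionOp (z : ℂ) : L2Field →L[ℂ] L2Field :=
  incl ∘L (if z = 0 then (W2 hD).starProjection else Ring.inverse (contrastOp hD z⁻¹)) ∘L
    invLaplacian

end Crystal

/-! ### Contours -/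

/-- A closed contour in `ℂ`, parametrized by `[0,1]`: continuous, differentiable off a countable
set, with integrable derivative. This contains all piecewise `C¹` closed curves. -/
structure IsClosedContour (γ : ℝ → ℂ) : Prop where
  continuousOn : ContinuousOn γ (Set.Icc 0 1)
  closed : γ 0 = γ 1
  differentiableAt : ∃ s : Set ℝ, s.Countable ∧ ∀ t ∈ Set.Ioo 0 1 \ s, DifferentiableAt ℝ γ t
  integrable : IntervalIntegrable (deriv γ) volume 0 1

/-- The point set of a contour. -/
def contourSet (γ : ℝ → ℂ) : Set ℂ := γ '' Set.Icc 0 1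

/-- The contour integral `∮_γ f(ζ) dζ`. -/
def contourIntegral {E : Type*} [NormedAddCommGroup E] [NormedSpace ℂ E] (γ : ℝ → ℂ)
    (f : ℂ → E) : E :=
  ∫ t in (0 : ℝ)..1, deriv γ t • f (γ t)

/-- The winding number of `γ` about `w`. -/
def windingNumber (γ : ℝ → ℂ) (w : ℂ) : ℂ :=
  (2 * Real.pi * Complex.I)⁻¹ * contourIntegral γ fun ζ => (ζ - w)⁻¹

/-- The points enclosed once, in the positive sense, by `γ`; the interior if `γ` is a positively
oriented simple closed curve. -/
def inside (γ : ℝ → ℂ) : Set ℂ := {w | w ∉ contourSet γ ∧ windingNumber γ w = 1}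

/-- The points that are not enclosed by `γ`. -/
def outside (γ : ℝ → ℂ) : Set ℂ := {w | w ∉ contourSet γ ∧ windingNumber γ w = 0}

/-- The distance of the contour `γ` from the set `S`. -/
def distTo (γ : ℝ → ℂ) (S : Set ℂ) : ℝ := sInf ((fun ζ => Metric.infDist ζ S) '' contourSet γ)

/-! ### Spectral projections and eigenvalue groups -/

section Family

variable {E : Type*} [NormedAddCommGroup E] [NormedSpace ℂ E]

/-- `P` is the spectral projection of `A` for the part `S` of its spectrum: `P` is a projection
that commutes with `A`, the part of `A` in the invariant subspace `range P` has spectrum `S`, and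
the part of `A` in the invariant subspace `ker P` has the rest of the spectrum. -/
structure IsSpectralProjection (A P : E →L[ℂ] E) (S : Set ℂ) : Prop where
  idem : P * P = P
  comm : A * P = P * A
  spectrum_range : spectrumOn A P.range = S
  spectrum_ker : spectrumOn A P.ker = spectrum ℂ A \ S

/-- The resolvent `R(ζ, z) = (A(z) - ζ)⁻¹`. -/
def resolventAt (A : ℂ → E →L[ℂ] E) (ζ z : ℂ) : E →L[ℂ] E :=
  Ring.inverse (A z - ζ • (1 : E →L[ℂ] E))

/-- `P(z) = -(2πi)⁻¹ ∮_γ R(ζ, z) dζ`. -/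
def contourProj (A : ℂ → E →L[ℂ] E) (γ : ℝ → ℂ) (z : ℂ) : E →L[ℂ] E :=
  -((2 * Real.pi * Complex.I)⁻¹ • contourIntegral γ fun ζ => resolventAt A ζ z)

/-- The trace of an operator of finite rank (the trace of its restriction to its range). -/
def finiteRankTrace (F : E →L[ℂ] E) : ℂ :=
  LinearMap.trace ℂ F.range
    ((F : E →ₗ[ℂ] E).restrict (p := F.range) (q := F.range) fun x _ => ⟨x, rfl⟩)

/-- The dimension `m` of the range of `P(0)`. -/
def groupMult (A : ℂ → E →L[ℂ] E) (γ : ℝ → ℂ) : ℕ := Module.finrank ℂ (contourProj A γ 0).range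

/-- The weighted mean `β̂(z) = m⁻¹ tr (A(z) P(z))` of the eigenvalue group of `A(z)` inside `γ`. -/
def weightedMean (A : ℂ → E →L[ℂ] E) (γ : ℝ → ℂ) (z : ℂ) : ℂ :=
  (groupMult A γ : ℂ)⁻¹ * finiteRankTrace (A z * contourProj A γ z)

/-- The coefficient `Aₙ` of the expansion `A(z) = A(0) + ∑ zⁿ Aₙ`. -/
def powerCoeff (A : ℂ → E →L[ℂ] E) (n : ℕ) : E →L[ℂ] E :=
  (n.factorial : ℂ)⁻¹ • iteratedDeriv n A 0

/-- The coefficient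
`βₙ = (2πi m)⁻¹ tr ∑_{k₁ + ⋯ + k_p = n} ((-1)^p / p) ∮_γ A_{k₁} R(ζ,0) ⋯ A_{k_p} R(ζ,0) dζ`
of the eigenvalue group, for `n ≥ 1`. -/
def groupCoeff (A : ℂ → E →L[ℂ] E) (γ : ℝ → ℂ) (n : ℕ) : ℂ :=
  (2 * Real.pi * Complex.I * groupMult A γ)⁻¹ *
    finiteRankTrace (∑ c : Composition n, ((-1 : ℂ) ^ c.length / c.length) •
      contourIntegral γ fun ζ =>
        (c.blocks.map fun k => powerCoeff A k * resolventAt A ζ 0).prod)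

end Family

/-- The radius `r* = 4π² d |z*| / (1 / (½ - μ⁻) + 4π² d)`, with `d` the distance of the contour
`γ` from the spectrum of `A(0)`. -/
def rStar {D : Set Cell} (hD : MeasurableSet D) (γ : ℝ → ℂ) : ℝ :=
  4 * Real.pi ^ 2 * distTo γ (spectrum ℂ (solutionOp hD 0)) * |zStar hD| /
    (1 / (1 / 2 - muMinus hD) + 4 * Real.pi ^ 2 * distTo γ (spectrum ℂ (solutionOp hD 0)))

end Photonic

end

noncomputable section

namespace Photonic

open MeasureTheory Filter Topology
open scoped ContDiff ComplexConjugate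

/-! ### Contour integrals -/

section Contour

variable {E F : Type*} [NormedAddCommGroup E] [NormedSpace ℂ E] [NormedAddCommGroup F]
  [NormedSpace ℂ F] {γ : ℝ → ℂ}

/-! On `J` the curl is an isometry, so `energyH` = 1 - Q with Q = `energyD` = curl* 1_D curl
self-adjoint and nonnegative, and T = 1/2 - Q. Everything depends on Q alone. It is 0 on W₁, 1 on W₂
and at most q = 1/2 - μ⁻ < 1 on W₃. With P = P₂ and S = Q - P one has PS = SP = 0, ‖S‖ ≤ q and
T_{1/z} = P + z⁻¹(1 - P)(1 - (1 - z)S). The inverse P + z(1 - P)(1 - (1 - z)S)⁻¹ extends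
holomorphically to z = 0 with value P (`inverse_pencil`, `solutionOp_eq`). Since 2π‖u‖ ≤ ‖curl u‖ on
`J`, this yields ‖A(z) - A(0)‖ ≤ |z| / (4π²(1 - q(1 + |z|))), and r* is the radius below which the
right side stays under d.

A(0) is self-adjoint, so each point of σ(A(z)) is closer than d to some point of σ(A(0)), and both
have the same winding number (`spectrum_subset_of_norm_sub_lt`). Hence Γ keeps splitting the
spectrum. As Γ is a general closed curve, Cauchy's theorem is proved in homology form by Dixon's
argument, and idempotence of the Riesz projection comes from Liouville's theorem for the Cauchy
transform of the resolvent, not from a second nested contour. The projections are holomorphic in z,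
and projections at distance less than 1 have equal rank, so the rank is constant on the disk. It is
finite at z = 0 because on the spectral subspace the energy is bounded by the L² norm, which leaves
room for finitely many Fourier modes only. By self-adjointness A(0)P(0) = β₀P(0).

For the series, (A(z) - β₀)P(z) = -(2πi)⁻¹ ∮ (ζ - β₀) R(ζ, z) dζ is expanded by iterating the second
resolvent identity. Its trace is holomorphic (`differentiableOn_trace`), so the expansion is its
Taylor series and converges up to r*. The stated βₙ have a weight 1/p and lack the factor (ζ - β₀)R.
The two forms agree by integration by parts and cyclicity of the trace: the p rotations of a product
give equal sums over all compositions and cancel 1/p (`IsolatesEigenvalue.trace_sum_composition`).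
Cyclicity under the integral holds because R has a finite rank principal part at β₀ and is
holomorphic elsewhere inside Γ; the class `FiniteMero` records this. -/

theorem isCompact_contourSet (hγ : IsClosedContour γ) : IsCompact (contourSet γ) :=
  isCompact_Icc.image_of_continuousOn hγ.continuousOn

theorem mem_contourSet {t : ℝ} (ht : t ∈ Set.Icc (0 : ℝ) 1) : γ t ∈ contourSet γ :=
  Set.mem_image_of_mem γ ht

theorem contourSet_nonempty (γ : ℝ → ℂ) : (contourSet γ).Nonempty :=
  ⟨_, mem_contourSet (by simp : (0 : ℝ) ∈ Set.Icc (0 : ℝ) 1)⟩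

theorem continuousOn_comp_contour {X : Type*} [TopologicalSpace X] (hγ : IsClosedContour γ)
    {f : ℂ → X}
    (hf : ContinuousOn f (contourSet γ)) : ContinuousOn (fun t => f (γ t)) (Set.Icc 0 1) :=
  hf.comp hγ.continuousOn fun _ ht => mem_contourSet ht

theorem contour_intervalIntegrable (hγ : IsClosedContour γ) {f : ℂ → E}
    (hf : ContinuousOn f (contourSet γ)) :
    IntervalIntegrable (fun t => deriv γ t • f (γ t)) volume 0 1 := by
  refine hγ.integrable.smul_continuousOn ?_
  rw [Set.uIcc_of_le zero_le_one]
  exact continuousOn_comp_contour hγ hf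

theorem contourIntegral_congr {f g : ℂ → E} (h : Set.EqOn f g (contourSet γ)) :
    contourIntegral γ f = contourIntegral γ g := by
  refine intervalIntegral.integral_congr fun t ht => ?_
  rw [Set.uIcc_of_le zero_le_one] at ht
  simp only [h (mem_contourSet ht)]

theorem contourIntegral_add (hγ : IsClosedContour γ) {f g : ℂ → E}
    (hf : ContinuousOn f (contourSet γ)) (hg : ContinuousOn g (contourSet γ)) :
    contourIntegral γ (fun ζ => f ζ + g ζ) = contourIntegral γ f + contourIntegral γ g := by
  simp only [contourIntegral, smul_add]
  exact intervalIntegral.integral_add (contour_intervalIntegrable hγ hf)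
    (contour_intervalIntegrable hγ hg)

theorem contourIntegral_sub (hγ : IsClosedContour γ) {f g : ℂ → E}
    (hf : ContinuousOn f (contourSet γ)) (hg : ContinuousOn g (contourSet γ)) :
    contourIntegral γ (fun ζ => f ζ - g ζ) = contourIntegral γ f - contourIntegral γ g := by
  simp only [contourIntegral, smul_sub]
  exact intervalIntegral.integral_sub (contour_intervalIntegrable hγ hf)
    (contour_intervalIntegrable hγ hg)

theorem contourIntegral_finsetSum (hγ : IsClosedContour γ) {ι : Type*} (s : Finset ι)
    {f : ι → ℂ → E} (hf : ∀ i ∈ s, ContinuousOn (f i) (contourSet γ)) :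
    contourIntegral γ (fun ζ => ∑ i ∈ s, f i ζ) = ∑ i ∈ s, contourIntegral γ (f i) := by
  simp only [contourIntegral, Finset.smul_sum]
  exact intervalIntegral.integral_finsetSum fun i hi => contour_intervalIntegrable hγ (hf i hi)

theorem contourIntegral_clm [CompleteSpace E] [CompleteSpace F] (hγ : IsClosedContour γ)
    (L : E →L[ℂ] F) {f : ℂ → E} (hf : ContinuousOn f (contourSet γ)) :
    contourIntegral γ (fun ζ => L (f ζ)) = L (contourIntegral γ f) := by
  rw [contourIntegral, contourIntegral,
    ← L.intervalIntegral_comp_comm (contour_intervalIntegrable hγ hf)]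
  simp only [map_smul]

theorem contourIntegral_smul (c : ℂ) (f : ℂ → E) :
    contourIntegral γ (fun ζ => c • f ζ) = c • contourIntegral γ f := by
  simp only [contourIntegral, smul_comm _ c]
  exact intervalIntegral.integral_smul c _

theorem contourIntegral_smul_const [CompleteSpace E] (hγ : IsClosedContour γ) {f : ℂ → ℂ}
    (hf : ContinuousOn f (contourSet γ)) (x : E) :
    contourIntegral γ (fun ζ => f ζ • x) = contourIntegral γ f • x :=
  contourIntegral_clm hγ (ContinuousLinearMap.toSpanSingleton ℂ x) hf

theorem norm_contourIntegral_le (hγ : IsClosedContour γ) {f : ℂ → E} {C : ℝ}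
    (hf : ∀ ζ ∈ contourSet γ, ‖f ζ‖ ≤ C) :
    ‖contourIntegral γ f‖ ≤ (∫ t in (0 : ℝ)..1, ‖deriv γ t‖) * C := by
  rw [← intervalIntegral.integral_mul_const]
  refine intervalIntegral.norm_integral_le_of_norm_le zero_le_one (ae_of_all _ fun t ht => ?_)
    (hγ.integrable.norm.mul_const C)
  rw [norm_smul]
  exact mul_le_mul_of_nonneg_left (hf _ (mem_contourSet ⟨ht.1.le, ht.2⟩)) (norm_nonneg _)

/-- Off a countable set f ∘ γ is a primitive of the integrand, and its values at the two ends agree.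
-/
theorem contourIntegral_deriv_eq_zero [CompleteSpace E] (hγ : IsClosedContour γ) {f f' : ℂ → E}
    (hd : ∀ ζ ∈ contourSet γ, HasDerivAt f (f' ζ) ζ) (hc : ContinuousOn f' (contourSet γ)) :
    contourIntegral γ f' = 0 := by
  obtain ⟨s, hs, hs'⟩ := hγ.differentiableAt
  have h := MeasureTheory.integral_eq_of_hasDerivAt_off_countable (fun t => f (γ t))
    (fun t => deriv γ t • f' (γ t)) (a := 0) (b := 1) hs ?_ ?_ (contour_intervalIntegrable hγ hc)
  · rw [contourIntegral, h, hγ.closed, sub_self]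
  · rw [Set.uIcc_of_le zero_le_one]
    exact continuousOn_comp_contour hγ fun ζ hζ => (hd ζ hζ).continuousAt.continuousWithinAt
  · intro t ht
    rw [min_eq_left zero_le_one, max_eq_right zero_le_one] at ht
    exact (hd _ (mem_contourSet (Set.Ioo_subset_Icc_self ht.1))).scomp t (hs' t ht).hasDerivAt

theorem contourIntegral_const [CompleteSpace E] (hγ : IsClosedContour γ) (x : E) :
    contourIntegral γ (fun _ => x) = 0 :=
  contourIntegral_deriv_eq_zero hγ (f := fun ζ => ζ • x)
    (fun ζ _ => by simpa using (hasDerivAt_id ζ).smul_const x) continuousOn_const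

/-- Differentiation under the integral sign. Cauchy's estimate on circles of radius r/2 bounds the
derivative in z uniformly along the compact contour. -/
theorem differentiableOn_contourIntegral [CompleteSpace E] (hγ : IsClosedContour γ) {V : Set ℂ}
    (hV : IsOpen V) {f : ℂ → ℂ → E}
    (hc : ContinuousOn (fun p : ℂ × ℂ => f p.1 p.2) (contourSet γ ×ˢ V))
    (hd : ∀ ζ ∈ contourSet γ, DifferentiableOn ℂ (f ζ) V) :
    DifferentiableOn ℂ (fun z => contourIntegral γ fun ζ => f ζ z) V := by
  have hc1 : ∀ z ∈ V, ContinuousOn (fun ζ => f ζ z) (contourSet γ) := fun z hz =>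
    hc.comp (continuousOn_id.prodMk continuousOn_const) fun ζ hζ => ⟨hζ, hz⟩
  intro z hz
  refine DifferentiableAt.differentiableWithinAt ?_
  obtain ⟨r, hr, hrV⟩ := Metric.nhds_basis_closedBall.mem_iff.1 (hV.mem_nhds hz)
  obtain ⟨C, hC⟩ := ((isCompact_contourSet hγ).prod
    (isCompact_closedBall z r)).exists_bound_of_continuousOn (hc.mono (Set.prod_mono_right hrV))
  have hsub : ∀ w ∈ Metric.ball z (r / 2), Metric.closedBall w (r / 2) ⊆ Metric.closedBall z r := by
    intro w hw
    refine Metric.closedBall_subset_closedBall' ?_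
    linarith [Metric.mem_ball.1 hw]
  have hbd : ∀ ζ ∈ contourSet γ, ∀ w ∈ Metric.ball z (r / 2), ‖deriv (f ζ) w‖ ≤ C / (r / 2) := by
    intro ζ hζ w hw
    refine Complex.norm_deriv_le_of_forall_mem_sphere_norm_le (half_pos hr) ?_ fun v hv => ?_
    · refine DifferentiableOn.diffContOnCl ?_
      refine (hd ζ hζ).mono ?_
      exact Metric.closure_ball_subset_closedBall.trans ((hsub w hw).trans hrV)
    · exact hC (ζ, v) ⟨hζ, hsub w hw (Metric.sphere_subset_closedBall hv)⟩
  have hmeas : ∀ w ∈ V, AEStronglyMeasurable (fun t => deriv γ t • f (γ t) w)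
      (volume.restrict (Set.uIoc 0 1)) := fun w hw =>
    (contour_intervalIntegrable hγ (hc1 w hw)).def'.aestronglyMeasurable
  have hdv : ∀ ζ ∈ contourSet γ, ∀ w ∈ V, HasDerivAt (f ζ) (deriv (f ζ) w) w := fun ζ hζ w hw =>
    ((hd ζ hζ).differentiableAt (hV.mem_nhds hw)).hasDerivAt
  have hu : ∀ t ∈ Set.uIoc (0 : ℝ) 1, γ t ∈ contourSet γ := fun t ht => by
    rw [Set.uIoc_of_le zero_le_one] at ht
    exact mem_contourSet ⟨ht.1.le, ht.2⟩
  have hbV : Metric.ball z (r / 2) ⊆ V := fun w hw =>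
    hrV (hsub w hw (Metric.mem_closedBall_self (half_pos hr).le))
  refine (intervalIntegral.hasDerivAt_integral_of_dominated_loc_of_deriv_le
    (F := fun w t => deriv γ t • f (γ t) w) (F' := fun w t => deriv γ t • deriv (f (γ t)) w)
    (bound := fun t => ‖deriv γ t‖ * (C / (r / 2)))
    (Metric.ball_mem_nhds z (half_pos hr)) ?_ (contour_intervalIntegrable hγ (hc1 z hz)) ?_ ?_
    (hγ.integrable.norm.mul_const _) ?_).2.differentiableAt
  · filter_upwards [hV.mem_nhds hz] with w hw using hmeas w hw
  -- The z-derivative is measurable in t as a pointwise limit of difference quotients at z + 1/(n +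
  -- 1); the shift by `N` keeps these points in `V`.
  · have hseq : Tendsto (fun n : ℕ => z + ((n : ℂ) + 1)⁻¹) atTop (𝓝[≠] z) := by
      refine tendsto_nhdsWithin_iff.2 ⟨?_, Eventually.of_forall fun n => ?_⟩
      · have h0 : Tendsto (fun n : ℕ => ((n : ℂ) + 1)⁻¹) atTop (𝓝 0) := by
          simpa using tendsto_one_div_add_atTop_nhds_zero_nat (𝕜 := ℂ)
        simpa using h0.const_add z
      · have : ((n : ℂ) + 1) ≠ 0 := Nat.cast_add_one_ne_zero n
        simpa using this
    have hV' : ∀ᶠ n : ℕ in atTop, z + ((n : ℂ) + 1)⁻¹ ∈ V :=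
      (hseq.mono_right nhdsWithin_le_nhds).eventually (hV.mem_nhds hz)
    obtain ⟨N, hN⟩ := eventually_atTop.1 hV'
    have hshift := (tendsto_add_atTop_iff_nat N).2 hseq
    refine aestronglyMeasurable_of_tendsto_ae atTop (f := fun (n : ℕ) t =>
      deriv γ t • slope (f (γ t)) z (z + (((n + N : ℕ) : ℂ) + 1)⁻¹)) (fun n => ?_) ?_
    · simp only [slope, vsub_eq_sub, smul_sub, smul_comm (deriv γ _)]
      exact ((hmeas _ (hN _ (Nat.le_add_left N n))).const_smul _).sub ((hmeas z hz).const_smul _)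
    · rw [ae_restrict_iff' measurableSet_uIoc]
      refine ae_of_all _ fun t ht => ?_
      exact (((hdv _ (hu t ht) z hz).tendsto_slope).comp hshift).const_smul _
  · refine ae_of_all _ fun t ht w hw => ?_
    rw [norm_smul]
    exact mul_le_mul_of_nonneg_left (hbd _ (hu t ht) w hw) (norm_nonneg _)
  · exact ae_of_all _ fun t ht w hw => (hdv _ (hu t ht) w (hbV hw)).const_smul _

/-! ### Winding numbers -/

theorem continuousOn_inv_sub {S : Set ℂ} {w : ℂ} (hw : w ∉ S) :
    ContinuousOn (fun ζ : ℂ => (ζ - w)⁻¹) S :=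
  (continuousOn_id.sub continuousOn_const).inv₀ fun _ hζ =>
    sub_ne_zero.2 fun h => hw ((show _ = w from h) ▸ hζ)

theorem contourIntegral_inv_sub (γ : ℝ → ℂ) (w : ℂ) :
    contourIntegral γ (fun ζ => (ζ - w)⁻¹) = 2 * Real.pi * Complex.I * windingNumber γ w := by
  rw [windingNumber, mul_inv_cancel_left₀ Complex.two_pi_I_ne_zero]

/-- The quotient (ζ - w)/(ζ - w₀) stays in the unit disk about 1, so its principal logarithm is a
single-valued primitive of the difference of the two kernels. -/
theorem windingNumber_eq_of_norm_lt (hγ : IsClosedContour γ) {w w₀ : ℂ}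
    (h : ∀ ζ ∈ contourSet γ, ‖w - w₀‖ < ‖ζ - w₀‖) : windingNumber γ w = windingNumber γ w₀ := by
  have h0 : ∀ ζ ∈ contourSet γ, ζ - w₀ ≠ 0 := fun ζ hζ =>
    norm_pos_iff.1 ((norm_nonneg _).trans_lt (h ζ hζ))
  have h1 : ∀ ζ ∈ contourSet γ, ζ - w ≠ 0 := fun ζ hζ e => by
    have := h ζ hζ
    rw [sub_eq_zero.1 e] at this
    exact lt_irrefl _ this
  have hc : ContinuousOn (fun ζ : ℂ => (ζ - w)⁻¹) (contourSet γ) :=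
    continuousOn_inv_sub fun hw => h1 w hw (sub_self w)
  have hc0 : ContinuousOn (fun ζ : ℂ => (ζ - w₀)⁻¹) (contourSet γ) :=
    continuousOn_inv_sub fun hw => h0 w₀ hw (sub_self w₀)
  unfold windingNumber
  rw [← sub_eq_zero, ← mul_sub, ← contourIntegral_sub hγ hc hc0,
    contourIntegral_deriv_eq_zero hγ (f := fun ζ => Complex.log ((ζ - w) / (ζ - w₀)))
      (f' := fun ζ => (ζ - w)⁻¹ - (ζ - w₀)⁻¹)
    (fun ζ hζ => ?_) (hc.sub hc0), mul_zero]
  have hs : (ζ - w) / (ζ - w₀) ∈ Complex.slitPlane := by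
    have e : (ζ - w) / (ζ - w₀) = 1 + (w₀ - w) / (ζ - w₀) := by
      rw [eq_comm, one_add_div (h0 ζ hζ)]
      ring
    rw [e]
    refine Complex.mem_slitPlane_of_norm_lt_one ?_
    rw [norm_div, norm_sub_rev, div_lt_one (norm_pos_iff.2 (h0 ζ hζ))]
    exact h ζ hζ
  refine ((((hasDerivAt_id ζ).sub_const w).div ((hasDerivAt_id ζ).sub_const w₀)
    (h0 ζ hζ)).clog hs).congr_deriv ?_
  have a := h0 ζ hζ
  have b := h1 ζ hζ
  simp only [id, one_mul, mul_one, Pi.div_apply]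
  field_simp

/-- Here log(1 - ζ/w) is a single-valued primitive of the kernel. -/
theorem windingNumber_eq_zero_of_norm_lt (hγ : IsClosedContour γ) {w : ℂ}
    (h : ∀ ζ ∈ contourSet γ, ‖ζ‖ < ‖w‖) : windingNumber γ w = 0 := by
  have hw : w ≠ 0 := by
    obtain ⟨ζ, hζ⟩ := contourSet_nonempty γ
    exact norm_pos_iff.1 ((norm_nonneg _).trans_lt (h ζ hζ))
  have h1 : ∀ ζ ∈ contourSet γ, ζ - w ≠ 0 := fun ζ hζ e => by
    have := h ζ hζ
    rw [sub_eq_zero.1 e] at this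
    exact lt_irrefl _ this
  unfold windingNumber
  rw [contourIntegral_deriv_eq_zero hγ (f := fun ζ => Complex.log (1 + -ζ / w))
    (fun ζ hζ => ?_) (continuousOn_inv_sub fun hw => h1 w hw (sub_self w)), mul_zero]
  have hs : 1 + -ζ / w ∈ Complex.slitPlane := by
    refine Complex.mem_slitPlane_of_norm_lt_one ?_
    rw [norm_div, norm_neg, div_lt_one (norm_pos_iff.2 hw)]
    exact h ζ hζ
  refine (((((hasDerivAt_id ζ).neg).div_const w).const_add 1).clog hs).congr_deriv ?_
  have b := h1 ζ hζ
  have e : 1 + -ζ / w = -((ζ - w) / w) := by field_simp; ring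
  change -1 / w / (1 + -ζ / w) = (ζ - w)⁻¹
  rw [e]
  field_simp

theorem exists_ball_windingNumber_eq (hγ : IsClosedContour γ) {w₀ : ℂ} (h : w₀ ∉ contourSet γ) :
    ∃ r > 0, ∀ w ∈ Metric.ball w₀ r,
      w ∉ contourSet γ ∧ windingNumber γ w = windingNumber γ w₀ := by
  obtain ⟨r, hr, hr'⟩ := Metric.isOpen_iff.1 (isCompact_contourSet hγ).isClosed.isOpen_compl w₀ h
  refine ⟨r, hr, fun w hw => ⟨hr' hw, windingNumber_eq_of_norm_lt hγ fun ζ hζ => ?_⟩⟩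
  rw [← dist_eq_norm, ← dist_eq_norm]
  refine (Metric.mem_ball.1 hw).trans_le ?_
  by_contra hlt
  exact hr' (Metric.mem_ball.2 (not_le.1 hlt)) hζ

theorem isOpen_inside (hγ : IsClosedContour γ) : IsOpen (inside γ) := by
  refine Metric.isOpen_iff.2 fun w hw => ?_
  obtain ⟨r, hr, h⟩ := exists_ball_windingNumber_eq hγ hw.1
  exact ⟨r, hr, fun v hv => ⟨(h v hv).1, (h v hv).2.trans hw.2⟩⟩

theorem isOpen_outside (hγ : IsClosedContour γ) : IsOpen (outside γ) := by
  refine Metric.isOpen_iff.2 fun w hw => ?_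
  obtain ⟨r, hr, h⟩ := exists_ball_windingNumber_eq hγ hw.1
  exact ⟨r, hr, fun v hv => ⟨(h v hv).1, (h v hv).2.trans hw.2⟩⟩

theorem disjoint_inside_outside (γ : ℝ → ℂ) : Disjoint (inside γ) (outside γ) :=
  Set.disjoint_left.2 fun _ h h' => one_ne_zero (h.2.symm.trans h'.2)

theorem eventually_mem_outside (hγ : IsClosedContour γ) :
    ∀ᶠ w in cocompact ℂ, w ∈ outside γ := by
  obtain ⟨R, hR⟩ := (isCompact_contourSet hγ).isBounded.exists_norm_le
  filter_upwards [tendsto_norm_cocompact_atTop.eventually_gt_atTop R] with w hw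
  exact ⟨fun h => (hR w h).not_gt hw,
    windingNumber_eq_zero_of_norm_lt hγ fun ζ hζ => (hR ζ hζ).trans_lt hw⟩

/-! ### Cauchy's theorem, homology version -/

/-- Only the diagonal needs an argument: strict differentiability controls the difference quotients
at nearby pairs, and continuity of the derivative covers nearby diagonal points. -/
theorem continuousOn_dslope_prod [CompleteSpace E] {U : Set ℂ} (hU : IsOpen U) {f : ℂ → E}
    (hf : DifferentiableOn ℂ f U) :
    ContinuousOn (fun p : ℂ × ℂ => dslope f p.1 p.2) (U ×ˢ U) := by
  rintro ⟨a, b⟩ ⟨ha, hb⟩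
  refine ContinuousAt.continuousWithinAt ?_
  have hfc : ∀ x ∈ U, ContinuousAt f x := fun x hx =>
    (hf.differentiableAt (hU.mem_nhds hx)).continuousAt
  rcases eq_or_ne b a with rfl | hab
  · have hs : HasStrictDerivAt f (deriv f b) b :=
      (hf.analyticAt (hU.mem_nhds hb)).hasStrictDerivAt
    have hd : ContinuousAt (deriv f) b :=
      ((hf.analyticAt (hU.mem_nhds hb)).deriv).continuousAt
    rw [ContinuousAt, dslope_same, Metric.tendsto_nhds]
    intro ε hε
    have h1 := (hasStrictDerivAt_iff_hasStrictFDerivAt.1 hs).isLittleO.def (half_pos hε)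
    have h2 : ∀ᶠ p : ℂ × ℂ in 𝓝 (b, b), dist (deriv f p.1) (deriv f b) < ε :=
      (hd.comp (x := (b, b)) continuousAt_fst).eventually (Metric.ball_mem_nhds _ hε)
    filter_upwards [h1, h2] with p hp hp2
    rcases eq_or_ne p.2 p.1 with he | hne
    · rw [he, dslope_same]; exact hp2
    · rw [dslope_of_ne _ hne, slope_def_module, dist_eq_norm]
      have hne' : p.1 - p.2 ≠ 0 := sub_ne_zero.2 hne.symm
      have e : (p.2 - p.1)⁻¹ • (f p.2 - f p.1) - deriv f b =
          (p.1 - p.2)⁻¹ • (f p.1 - f p.2 - (p.1 - p.2) • deriv f b) := by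
        rw [smul_sub (p.1 - p.2)⁻¹, smul_smul, inv_mul_cancel₀ hne', one_smul, ← neg_sub p.1 p.2,
          ← neg_sub (f p.1), inv_neg, neg_smul_neg]
      rw [e, norm_smul, norm_inv, inv_mul_lt_iff₀ (norm_pos_iff.2 hne')]
      have hp' : ‖f p.1 - f p.2 - (p.1 - p.2) • deriv f b‖ ≤ ε / 2 * ‖p.1 - p.2‖ := by
        simpa using hp
      refine hp'.trans_lt ?_
      rw [mul_comm]
      exact mul_lt_mul_of_pos_left (half_lt_self hε) (norm_pos_iff.2 hne')
  · have hev : ∀ᶠ p : ℂ × ℂ in 𝓝 (a, b), p.2 ≠ p.1 :=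
      (isOpen_ne_fun continuous_snd continuous_fst).mem_nhds hab
    have hs : ContinuousAt (fun p : ℂ × ℂ => (p.2 - p.1)⁻¹ • (f p.2 - f p.1)) (a, b) := by
      refine ContinuousAt.smul (ContinuousAt.inv₀ (by fun_prop) (sub_ne_zero.2 hab)) ?_
      exact ((hfc b hb).comp (x := (a, b)) continuousAt_snd).sub
        ((hfc a ha).comp (x := (a, b)) continuousAt_fst)
    refine hs.congr ?_
    filter_upwards [hev] with p hp
    rw [dslope_of_ne _ hp, slope_def_module]

theorem norm_contourIntegral_inv_smul_tendsto (hγ : IsClosedContour γ) {f : ℂ → E}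
    (hf : ContinuousOn f (contourSet γ)) :
    Tendsto (fun w => contourIntegral γ fun ζ => (ζ - w)⁻¹ • f ζ) (cocompact ℂ) (𝓝 0) := by
  obtain ⟨R, hR⟩ := (isCompact_contourSet hγ).isBounded.exists_norm_le
  obtain ⟨C, hC⟩ := (isCompact_contourSet hγ).exists_bound_of_continuousOn hf
  set K := ∫ t in (0 : ℝ)..1, ‖deriv γ t‖
  have ht : Tendsto (fun w : ℂ => K * ((‖w‖ - R)⁻¹ * C)) (cocompact ℂ) (𝓝 0) := by
    have h1 : Tendsto (fun w : ℂ => ‖w‖ - R) (cocompact ℂ) atTop :=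
      tendsto_atTop_add_const_right _ _ tendsto_norm_cocompact_atTop
    simpa using ((tendsto_inv_atTop_zero.comp h1).mul_const C).const_mul K
  refine squeeze_zero_norm' ?_ ht
  filter_upwards [tendsto_norm_cocompact_atTop.eventually_gt_atTop R] with w hw
  refine norm_contourIntegral_le hγ fun ζ hζ => ?_
  have h2 : ‖w‖ - R ≤ ‖ζ - w‖ := by
    have := norm_sub_norm_le w ζ
    rw [norm_sub_rev] at this
    linarith [hR ζ hζ]
  rw [norm_smul, norm_inv]
  have h3 : 0 < ‖w‖ - R := sub_pos.2 hw
  gcongr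
  exact hC ζ hζ

theorem contourIntegral_dslope [CompleteSpace E] (hγ : IsClosedContour γ) {f : ℂ → E}
    (hf : ContinuousOn f (contourSet γ)) {w : ℂ} (hw : w ∉ contourSet γ) :
    (contourIntegral γ fun ζ => dslope f ζ w) =
      (contourIntegral γ fun ζ => (ζ - w)⁻¹ • f ζ) -
        (2 * Real.pi * Complex.I * windingNumber γ w) • f w := by
  have c1 := continuousOn_inv_sub hw
  have e : Set.EqOn (fun ζ => dslope f ζ w) (fun ζ => (ζ - w)⁻¹ • f ζ - (ζ - w)⁻¹ • f w)
      (contourSet γ) := fun ζ hζ => by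
    have hne : ζ ≠ w := fun h => hw (h ▸ hζ)
    simp only
    rw [dslope_of_ne _ hne.symm, slope_comm, slope_def_module, smul_sub]
  rw [contourIntegral_congr e, contourIntegral_sub (f := fun ζ => (ζ - w)⁻¹ • f ζ)
    (g := fun ζ => (ζ - w)⁻¹ • f w) hγ (c1.smul hf) (c1.smul continuousOn_const),
    contourIntegral_smul_const hγ c1, contourIntegral_inv_sub]

theorem differentiableOn_contourIntegral_inv_smul [CompleteSpace E] (hγ : IsClosedContour γ)
    {f : ℂ → E} (hf : ContinuousOn f (contourSet γ)) :
    DifferentiableOn ℂ (fun w => contourIntegral γ fun ζ => (ζ - w)⁻¹ • f ζ)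
      (contourSet γ)ᶜ := by
  refine differentiableOn_contourIntegral hγ (isCompact_contourSet hγ).isClosed.isOpen_compl
    (f := fun ζ w => (ζ - w)⁻¹ • f ζ) ?_ fun ζ hζ => ?_
  · refine ContinuousOn.smul (ContinuousOn.inv₀ (by fun_prop) ?_)
      (hf.comp continuousOn_fst fun p hp => hp.1)
    rintro ⟨a, b⟩ ⟨ha, hb⟩
    exact sub_ne_zero.2 fun h => hb (by rw [← show a = b from h]; exact ha)
  · refine DifferentiableOn.smul_const (DifferentiableOn.inv (by fun_prop) fun w hw => ?_) _
    exact sub_ne_zero.2 fun h => hw (h ▸ hζ)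

/-- Cauchy's integral formula for a contour that does not wind about the points off `U`. -/
theorem contourIntegral_inv_sub_smul [CompleteSpace E] (hγ : IsClosedContour γ)
    {U : Set ℂ} (hU : IsOpen U) (hγU : contourSet γ ⊆ U) (hw : Uᶜ ⊆ outside γ) {f : ℂ → E}
    (hf : DifferentiableOn ℂ f U) {w₀ : ℂ} (hw₀ : w₀ ∈ U) (hw₀' : w₀ ∉ contourSet γ) :
    contourIntegral γ (fun ζ => (ζ - w₀)⁻¹ • f ζ) =
      (2 * Real.pi * Complex.I * windingNumber γ w₀) • f w₀ := by
  classical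
  have hfc : ContinuousOn f (contourSet γ) := hf.continuousOn.mono hγU
  have h1 : DifferentiableOn ℂ (fun w => contourIntegral γ fun ζ => dslope f ζ w) U :=
    differentiableOn_contourIntegral hγ hU (f := fun ζ w => dslope f ζ w)
      ((continuousOn_dslope_prod hU hf).mono (Set.prod_mono_left hγU))
      fun ζ hζ => (Complex.differentiableOn_dslope (hU.mem_nhds (hγU hζ))).2 hf
  have h2 := differentiableOn_contourIntegral_inv_smul hγ hfc
  -- Dixon's function. On the part of `U` that lies outside the contour the two formulas agree, as
  -- the winding term vanishes there. So `h` is entire, tends to 0 at infinity, and is 0 by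
  -- Liouville's theorem.
  set h : ℂ → E := fun w => if w ∈ U then contourIntegral γ fun ζ => dslope f ζ w
    else contourIntegral γ fun ζ => (ζ - w)⁻¹ • f ζ with hh
  have hin : ∀ w ∈ U, h w = contourIntegral γ fun ζ => dslope f ζ w := fun w hw => if_pos hw
  have hout : ∀ w ∈ outside γ, h w = contourIntegral γ fun ζ => (ζ - w)⁻¹ • f ζ := by
    intro w hw'
    by_cases hwU : w ∈ U
    · rw [hin w hwU, contourIntegral_dslope hγ hfc hw'.1, hw'.2, mul_zero, zero_smul, sub_zero]
    · exact if_neg hwU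
  have hdiff : Differentiable ℂ h := by
    intro w
    by_cases hwU : w ∈ U
    · refine (h1.differentiableAt (hU.mem_nhds hwU)).congr_of_eventuallyEq ?_
      filter_upwards [hU.mem_nhds hwU] with v hv using hin v hv
    · refine (h2.differentiableAt ((isCompact_contourSet hγ).isClosed.isOpen_compl.mem_nhds
        (hw hwU).1)).congr_of_eventuallyEq ?_
      filter_upwards [(isOpen_outside hγ).mem_nhds (hw hwU)] with v hv using hout v hv
  have hlim : Tendsto h (cocompact ℂ) (𝓝 0) :=
    (norm_contourIntegral_inv_smul_tendsto hγ hfc).congr'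
      ((eventually_mem_outside hγ).mono fun w hw' => (hout w hw').symm)
  have h0 := hdiff.apply_eq_of_tendsto_cocompact w₀ hlim
  rw [hin w₀ hw₀, contourIntegral_dslope hγ hfc hw₀'] at h0
  exact sub_eq_zero.1 h0

/-- Cauchy's theorem for a contour that does not wind about the points off `U`. -/
theorem contourIntegral_eq_zero_of_windingNumber [CompleteSpace E] (hγ : IsClosedContour γ)
    {U : Set ℂ} (hU : IsOpen U) (hγU : contourSet γ ⊆ U) (hw : Uᶜ ⊆ outside γ) {f : ℂ → E}
    (hf : DifferentiableOn ℂ f U) : contourIntegral γ f = 0 := by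
  -- A nonempty open subset of the plane is not compact, so `U` is more than the contour.
  obtain ⟨w₀, hw₀, hw₀'⟩ : ∃ w₀ ∈ U, w₀ ∉ contourSet γ := by
    by_contra! hUγ
    have hUe : U = contourSet γ := Set.Subset.antisymm hUγ hγU
    have hc : IsCompact U := hUe ▸ isCompact_contourSet hγ
    rcases isClopen_iff.1 ⟨hc.isClosed, hU⟩ with h | h
    · exact (contourSet_nonempty γ).ne_empty (hUe.symm.trans h)
    · exact noncompact_univ ℂ (h ▸ hc)
  -- The integral formula for (ζ - w₀) f(ζ): the factor cancels the kernel and makes the right side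
  -- vanish.
  have h := contourIntegral_inv_sub_smul hγ hU hγU hw (f := fun ζ => (ζ - w₀) • f ζ)
    ((by fun_prop : DifferentiableOn ℂ (fun ζ : ℂ => ζ - w₀) U).smul hf) hw₀ hw₀'
  simp only [sub_self, zero_smul, smul_zero] at h
  rw [← h]
  refine contourIntegral_congr fun ζ hζ => ?_
  have hne : ζ - w₀ ≠ 0 := sub_ne_zero.2 fun e => hw₀' (e ▸ hζ)
  simp only [smul_smul, inv_mul_cancel₀ hne, one_smul]

end Contour

/-! ### Resolvents and Riesz projections -/

section Resolvent

variable {𝔸 : Type*} [NormedRing 𝔸] [NormedAlgebra ℂ 𝔸]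

/-- The resolvent `(a - ζ)⁻¹`. -/
def res (a : 𝔸) (ζ : ℂ) : 𝔸 := Ring.inverse (a - ζ • (1 : 𝔸))

theorem isUnit_sub_smul_one {a : 𝔸} {ζ : ℂ} (h : ζ ∈ resolventSet ℂ a) :
    IsUnit (a - ζ • (1 : 𝔸)) := by
  rw [← neg_sub, ← Algebra.algebraMap_eq_smul_one]
  exact IsUnit.neg h

theorem mem_resolventSet_of_isUnit {a : 𝔸} {ζ : ℂ} (h : IsUnit (a - ζ • (1 : 𝔸))) :
    ζ ∈ resolventSet ℂ a := by
  rw [← neg_sub, ← Algebra.algebraMap_eq_smul_one] at h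
  exact (IsUnit.neg_iff _).1 h

theorem sub_mul_res {a : 𝔸} {ζ : ℂ} (h : ζ ∈ resolventSet ℂ a) :
    (a - ζ • (1 : 𝔸)) * res a ζ = 1 := Ring.mul_inverse_cancel _ (isUnit_sub_smul_one h)

theorem res_mul_sub {a : 𝔸} {ζ : ℂ} (h : ζ ∈ resolventSet ℂ a) :
    res a ζ * (a - ζ • (1 : 𝔸)) = 1 := Ring.inverse_mul_cancel _ (isUnit_sub_smul_one h)

theorem mul_res {a : 𝔸} {ζ : ℂ} (h : ζ ∈ resolventSet ℂ a) :
    a * res a ζ = 1 + ζ • res a ζ := by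
  have := sub_mul_res h
  rw [sub_mul, smul_mul_assoc, one_mul] at this
  rw [← this, sub_add_cancel]

theorem res_eq_neg_resolvent {a : 𝔸} {ζ : ℂ} (h : ζ ∈ resolventSet ℂ a) :
    res a ζ = -resolvent a ζ := by
  have h1 : (a - ζ • (1 : 𝔸)) * -resolvent a ζ = 1 := by
    rw [mul_neg, ← neg_mul, neg_sub, ← Algebra.algebraMap_eq_smul_one]
    exact Ring.mul_inverse_cancel _ h
  rw [← one_mul (-resolvent a ζ), ← res_mul_sub h, mul_assoc, h1, mul_one]

theorem commute_res {a b : 𝔸} (hab : Commute b a) (ζ : ℂ) : Commute b (res a ζ) := by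
  by_cases h : ζ ∈ resolventSet ℂ a
  · have hc : Commute b (a - ζ • (1 : 𝔸)) := hab.sub_right ((Commute.one_right b).smul_right ζ)
    calc b * res a ζ = res a ζ * ((a - ζ • (1 : 𝔸)) * b) * res a ζ := by
          rw [← mul_assoc, res_mul_sub h, one_mul]
      _ = res a ζ * b := by rw [← hc.eq, mul_assoc, mul_assoc, sub_mul_res h, mul_one]
  -- Off the resolvent set `res a ζ` has the default value 0.
  · have : ¬ IsUnit (a - ζ • (1 : 𝔸)) := fun hu => h (mem_resolventSet_of_isUnit hu)
    rw [res, Ring.inverse_non_unit _ this]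
    exact Commute.zero_right b

/-- The Riesz projection `-(2πi)⁻¹ ∮ (a - ζ)⁻¹ dζ`. -/
def riesz (a : 𝔸) (γ : ℝ → ℂ) : 𝔸 :=
  -((2 * Real.pi * Complex.I : ℂ)⁻¹ • contourIntegral γ fun ζ => res a ζ)

/-- The Cauchy transform `-(2πi)⁻¹ ∮ (ζ - w)⁻¹ (a - ζ)⁻¹ dζ` of the resolvent. -/
def rieszTransform (a : 𝔸) (γ : ℝ → ℂ) (w : ℂ) : 𝔸 :=
  -((2 * Real.pi * Complex.I : ℂ)⁻¹ • contourIntegral γ fun ζ => (ζ - w)⁻¹ • res a ζ)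

variable [CompleteSpace 𝔸] {a : 𝔸} {γ : ℝ → ℂ}

theorem hasDerivAt_res {ζ : ℂ} (h : ζ ∈ resolventSet ℂ a) :
    HasDerivAt (res a) (res a ζ * res a ζ) ζ := by
  have h1 := (spectrum.hasDerivAt_resolvent_const_left h).neg
  rw [neg_neg, sq] at h1
  have e : res a ζ * res a ζ = resolvent a ζ * resolvent a ζ := by
    rw [res_eq_neg_resolvent h, neg_mul_neg]
  rw [e]
  refine h1.congr_of_eventuallyEq ?_
  filter_upwards [(spectrum.isOpen_resolventSet a).mem_nhds h] with z hz
  exact res_eq_neg_resolvent hz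

theorem differentiableOn_res (a : 𝔸) : DifferentiableOn ℂ (res a) (resolventSet ℂ a) :=
  fun _ h => (hasDerivAt_res h).differentiableAt.differentiableWithinAt

theorem continuousOn_res (hγa : contourSet γ ⊆ resolventSet ℂ a) :
    ContinuousOn (res a) (contourSet γ) := (differentiableOn_res a).continuousOn.mono hγa

theorem tendsto_res (a : 𝔸) : Tendsto (res a) (cocompact ℂ) (𝓝 0) := by
  have h := (spectrum.resolvent_tendsto_cobounded (𝕜 := ℂ) a).neg
  rw [neg_zero, Metric.cobounded_eq_cocompact] at h
  refine h.congr' ?_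
  filter_upwards [(spectrum.isCompact a).compl_mem_cocompact] with z hz
  exact (res_eq_neg_resolvent (Set.notMem_compl_iff.1 hz)).symm

theorem contourIntegral_mul_left (hγ : IsClosedContour γ) (b : 𝔸) {f : ℂ → 𝔸}
    (hf : ContinuousOn f (contourSet γ)) :
    contourIntegral γ (fun ζ => b * f ζ) = b * contourIntegral γ f :=
  contourIntegral_clm hγ (ContinuousLinearMap.mul ℂ 𝔸 b) hf

theorem contourIntegral_mul_right (hγ : IsClosedContour γ) (b : 𝔸) {f : ℂ → 𝔸}
    (hf : ContinuousOn f (contourSet γ)) :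
    contourIntegral γ (fun ζ => f ζ * b) = contourIntegral γ f * b :=
  contourIntegral_clm hγ ((ContinuousLinearMap.mul ℂ 𝔸).flip b) hf

theorem commute_contourIntegral (hγ : IsClosedContour γ) {b : 𝔸} {f : ℂ → 𝔸}
    (hf : ContinuousOn f (contourSet γ)) (h : ∀ ζ ∈ contourSet γ, Commute b (f ζ)) :
    Commute b (contourIntegral γ f) := by
  rw [Commute, SemiconjBy, ← contourIntegral_mul_left hγ b hf, ← contourIntegral_mul_right hγ b hf]
  exact contourIntegral_congr h

theorem commute_riesz (hγ : IsClosedContour γ) (hγa : contourSet γ ⊆ resolventSet ℂ a) {b : 𝔸}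
    (hab : Commute b a) : Commute b (riesz a γ) :=
  ((commute_contourIntegral hγ (continuousOn_res hγa)
    fun ζ _ => commute_res hab ζ).smul_right _).neg_right

theorem commute_rieszTransform (hγ : IsClosedContour γ) (hγa : contourSet γ ⊆ resolventSet ℂ a)
    {b : 𝔸} (hab : Commute b a) {w : ℂ} (hw : w ∉ contourSet γ) :
    Commute b (rieszTransform a γ w) :=
  ((commute_contourIntegral hγ ((continuousOn_inv_sub hw).smul (continuousOn_res hγa))
    fun ζ _ => (commute_res hab ζ).smul_right _).smul_right _).neg_right

/-- Integrate (ζ - w)⁻¹(a - w)(a - ζ)⁻¹ = (ζ - w)⁻¹ + (a - ζ)⁻¹. Up to sign the transform thus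
inverts a - w on the range of the projection if the winding number is 0, and on its kernel if it is
1. -/
theorem sub_mul_rieszTransform (hγ : IsClosedContour γ) (hγa : contourSet γ ⊆ resolventSet ℂ a)
    {w : ℂ} (hw : w ∉ contourSet γ) :
    (a - w • (1 : 𝔸)) * rieszTransform a γ w = riesz a γ - windingNumber γ w • (1 : 𝔸) := by
  have hr := continuousOn_res hγa
  have hi := continuousOn_inv_sub hw
  have e : Set.EqOn (fun ζ => (a - w • (1 : 𝔸)) * ((ζ - w)⁻¹ • res a ζ))
      (fun ζ => (ζ - w)⁻¹ • (1 : 𝔸) + res a ζ) (contourSet γ) := fun ζ hζ => by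
    have hne : ζ - w ≠ 0 := sub_ne_zero.2 fun h => hw (h ▸ hζ)
    have h1 : (a - w • (1 : 𝔸)) * res a ζ = 1 + (ζ - w) • res a ζ := by
      rw [sub_mul, mul_res (hγa hζ), smul_mul_assoc, one_mul, sub_smul, add_sub_assoc]
    simp only
    rw [mul_smul_comm, h1, smul_add, smul_smul, inv_mul_cancel₀ hne, one_smul]
  rw [rieszTransform, mul_neg, mul_smul_comm,
    ← contourIntegral_mul_left hγ _ (f := fun ζ => (ζ - w)⁻¹ • res a ζ) (hi.smul hr),
    contourIntegral_congr e,
    contourIntegral_add (f := fun ζ => (ζ - w)⁻¹ • (1 : 𝔸)) hγ (hi.smul continuousOn_const) hr,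
    contourIntegral_smul_const hγ hi, smul_add, smul_smul, riesz, windingNumber, neg_add,
    sub_eq_add_neg, add_comm]

theorem differentiableOn_rieszTransform (hγ : IsClosedContour γ)
    (hγa : contourSet γ ⊆ resolventSet ℂ a) :
    DifferentiableOn ℂ (rieszTransform a γ) (contourSet γ)ᶜ :=
  ((differentiableOn_contourIntegral_inv_smul hγ (continuousOn_res hγa)).const_smul
    (2 * Real.pi * Complex.I : ℂ)⁻¹).neg

theorem contourSet_subset_resolventSet {A : Type*} [Ring A] [Algebra ℂ A] {a : A} {γ : ℝ → ℂ}
    (h : spectrum ℂ a ⊆ inside γ ∪ outside γ) : contourSet γ ⊆ resolventSet ℂ a := fun ζ hζ => by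
  by_contra hs
  exact (h hs).elim (fun h' => h'.1 hζ) fun h' => h'.1 hζ

theorem rieszTransform_eq (hγ : IsClosedContour γ) (hγa : contourSet γ ⊆ resolventSet ℂ a)
    {w : ℂ} (hw : w ∉ contourSet γ) (hwa : w ∈ resolventSet ℂ a) :
    rieszTransform a γ w = res a w * (riesz a γ - windingNumber γ w • (1 : 𝔸)) := by
  rw [← sub_mul_rieszTransform hγ hγa hw, ← mul_assoc, res_mul_sub hwa, one_mul]

/-- The Riesz projection is idempotent. -/
theorem riesz_mul_riesz (hγ : IsClosedContour γ) (h : spectrum ℂ a ⊆ inside γ ∪ outside γ) :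
    riesz a γ * riesz a γ = riesz a γ := by
  classical
  have hγa := contourSet_subset_resolventSet h
  set P := riesz a γ
  have hPa : Commute P a := (commute_riesz hγ hγa (Commute.refl a)).symm
  -- The defect of idempotence. The function R(w)X continues across the spectrum as P G(w) inside
  -- and (P - 1)G(w) outside, with G the Cauchy transform. So it is entire and vanishes at infinity,
  -- hence is 0, and X = 0.
  set X := P * (P - 1) with hX
  set f : ℂ → 𝔸 := fun w => if w ∈ resolventSet ℂ a then res a w * X
    else if w ∈ inside γ then P * rieszTransform a γ w else (P - 1) * rieszTransform a γ w with hf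
  have hX' : X = (P - 1) * P := by rw [hX, mul_sub, sub_mul, mul_one, one_mul]
  have hin : ∀ w ∈ inside γ, f w = P * rieszTransform a γ w := by
    intro w hw
    by_cases hwa : w ∈ resolventSet ℂ a
    · simp only [hf, if_pos hwa]
      rw [rieszTransform_eq hγ hγa hw.1 hwa, hw.2, one_smul, hX, ← mul_assoc, ← mul_assoc,
        (commute_res hPa w).eq]
    · simp only [hf, if_neg hwa, if_pos hw]
  have hout : ∀ w ∈ outside γ, f w = (P - 1) * rieszTransform a γ w := by
    intro w hw
    by_cases hwa : w ∈ resolventSet ℂ a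
    · simp only [hf, if_pos hwa]
      rw [rieszTransform_eq hγ hγa hw.1 hwa, hw.2, zero_smul, sub_zero, hX', ← mul_assoc,
        ← mul_assoc, (commute_res (hPa.sub_left (Commute.one_left a)) w).eq]
    · simp only [hf, if_neg hwa,
        if_neg fun h' => Set.disjoint_left.1 (disjoint_inside_outside γ) h' hw]
  have hG := fun w hw => (differentiableOn_rieszTransform hγ hγa).differentiableAt (x := w)
    ((isCompact_contourSet hγ).isClosed.isOpen_compl.mem_nhds hw)
  have hdiff : Differentiable ℂ f := by
    intro w
    by_cases hwa : w ∈ resolventSet ℂ a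
    · refine ((hasDerivAt_res hwa).differentiableAt.mul_const X).congr_of_eventuallyEq ?_
      filter_upwards [(spectrum.isOpen_resolventSet a).mem_nhds hwa] with v hv using if_pos hv
    · rcases h hwa with hw | hw
      · refine ((hG w hw.1).const_mul P).congr_of_eventuallyEq ?_
        filter_upwards [(isOpen_inside hγ).mem_nhds hw] with v hv using hin v hv
      · refine ((hG w hw.1).const_mul (P - 1)).congr_of_eventuallyEq ?_
        filter_upwards [(isOpen_outside hγ).mem_nhds hw] with v hv using hout v hv
  have hlim : Tendsto f (cocompact ℂ) (𝓝 0) := by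
    have h1 := (tendsto_res a).mul_const X
    rw [zero_mul] at h1
    refine h1.congr' ?_
    filter_upwards [(spectrum.isCompact a).compl_mem_cocompact] with w hw
    exact (if_pos (Set.notMem_compl_iff.1 hw)).symm
  obtain ⟨ζ, hζ⟩ := contourSet_nonempty γ
  have h0 := hdiff.apply_eq_of_tendsto_cocompact ζ hlim
  simp only [hf, if_pos (hγa hζ)] at h0
  have hX0 : X = 0 := by
    rw [← one_mul X, ← sub_mul_res (hγa hζ), mul_assoc, h0, mul_zero]
  rw [hX, mul_sub, mul_one, sub_eq_zero] at hX0
  exact hX0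

end Resolvent

/-! ### The splitting of the spectrum by the Riesz projection -/

section SpectralProjection

variable {E : Type*} [NormedAddCommGroup E] [NormedSpace ℂ E]

theorem bijOn_sub_smul {A S : E →L[ℂ] E} {M : Submodule ℂ E} {ζ : ℂ}
    (hA : ∀ u ∈ M, A u ∈ M) (hS : ∀ u ∈ M, S u ∈ M)
    (h1 : ∀ u ∈ M, A (S u) - ζ • S u = u) (h2 : ∀ u ∈ M, S (A u - ζ • u) = u) :
    Set.BijOn (fun u => A u - ζ • u) M M :=
  Set.InvOn.bijOn (f' := S) ⟨h2, h1⟩ (fun u hu => M.sub_mem (hA u hu) (M.smul_mem _ hu)) hS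

theorem mem_range_of_idem {P : E →L[ℂ] E} (hP : P * P = P) {u : E} :
    u ∈ P.range ↔ P u = u := by
  refine ⟨?_, fun h => ⟨u, h⟩⟩
  rintro ⟨v, rfl⟩
  exact congrArg (fun Q : E →L[ℂ] E => Q v) hP

theorem apply_comm {A B : E →L[ℂ] E} (h : Commute A B) (u : E) : A (B u) = B (A u) :=
  congrArg (fun Q : E →L[ℂ] E => Q u) h.eq

variable [CompleteSpace E]

/-- For w outside the contour the Cauchy transform inverts A - w on the range of P, and for w inside
its negative inverts A - w on the kernel. At other points of the resolvent set the resolvent itself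
restricts to both subspaces, since it commutes with P. -/
theorem isSpectralProjection_riesz {A : E →L[ℂ] E} {γ : ℝ → ℂ} (hγ : IsClosedContour γ)
    (h : spectrum ℂ A ⊆ inside γ ∪ outside γ) :
    IsSpectralProjection A (riesz A γ) (spectrum ℂ A ∩ inside γ) := by
  have hγa := contourSet_subset_resolventSet h
  set P := riesz A γ with hPdef
  have hidem : P * P = P := riesz_mul_riesz hγ h
  have hAP : Commute A P := commute_riesz hγ hγa (Commute.refl A)
  have hmr : ∀ {B : E →L[ℂ] E}, Commute B P → ∀ u ∈ P.range, B u ∈ P.range := by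
    intro B hB u hu
    rw [mem_range_of_idem hidem] at hu ⊢
    rw [← apply_comm hB, hu]
  have hmk : ∀ {B : E →L[ℂ] E}, Commute B P → ∀ u ∈ P.ker, B u ∈ P.ker := by
    intro B hB u hu
    have hu' : P u = 0 := hu
    change P (B u) = 0
    rw [← apply_comm hB, hu', map_zero]
  have hres : ∀ ζ ∈ resolventSet ℂ A, ∀ u, A (res A ζ u) - ζ • res A ζ u = u := fun ζ hζ u =>
    congrArg (fun Q : E →L[ℂ] E => Q u) (sub_mul_res hζ)
  have hres' : ∀ ζ ∈ resolventSet ℂ A, ∀ u, res A ζ (A u - ζ • u) = u := fun ζ hζ u =>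
    congrArg (fun Q : E →L[ℂ] E => Q u) (res_mul_sub hζ)
  have hGA : ∀ w ∉ contourSet γ, Commute A (rieszTransform A γ w) := fun w hw =>
    commute_rieszTransform hγ hγa (Commute.refl A) hw
  have hGP : ∀ w ∉ contourSet γ, Commute (rieszTransform A γ w) P := fun w hw =>
    commute_riesz hγ hγa (hGA w hw).symm
  have hG : ∀ w ∉ contourSet γ, ∀ u, A (rieszTransform A γ w u) - w • rieszTransform A γ w u =
      P u - windingNumber γ w • u := fun w hw u =>
    congrArg (fun Q : E →L[ℂ] E => Q u) (sub_mul_rieszTransform hγ hγa hw)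
  have hG' : ∀ w ∉ contourSet γ, ∀ u, rieszTransform A γ w (A u - w • u) =
      P u - windingNumber γ w • u := fun w hw u => by
    rw [← hG w hw, map_sub, map_smul, apply_comm (hGA w hw)]
  have hr1 : ∀ ζ ∈ resolventSet ℂ A, ζ ∉ spectrumOn A P.range := fun ζ hζ hs =>
    hs (bijOn_sub_smul (hmr hAP) (hmr (commute_riesz hγ hγa
      (commute_res (Commute.refl A) ζ).symm)) (fun u _ => hres ζ hζ u) fun u _ => hres' ζ hζ u)
  have hr2 : ∀ ζ ∈ resolventSet ℂ A, ζ ∉ spectrumOn A P.ker := fun ζ hζ hs =>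
    hs (bijOn_sub_smul (hmk hAP) (hmk (commute_riesz hγ hγa
      (commute_res (Commute.refl A) ζ).symm)) (fun u _ => hres ζ hζ u) fun u _ => hres' ζ hζ u)
  have ho : ∀ ζ ∈ outside γ, ζ ∉ spectrumOn A P.range := fun ζ hζ hs => by
    refine hs (bijOn_sub_smul (hmr hAP) (hmr (hGP ζ hζ.1)) (fun u hu => ?_) fun u hu => ?_)
    · rw [hG ζ hζ.1, hζ.2, zero_smul, sub_zero, (mem_range_of_idem hidem).1 hu]
    · rw [hG' ζ hζ.1, hζ.2, zero_smul, sub_zero, (mem_range_of_idem hidem).1 hu]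
  have hi : ∀ ζ ∈ inside γ, ζ ∉ spectrumOn A P.ker := fun ζ hζ hs => by
    refine hs (bijOn_sub_smul (S := -rieszTransform A γ ζ) (hmk hAP) (hmk (hGP ζ hζ.1).neg_left)
      (fun u hu => ?_) fun u hu => ?_)
    · have hu' : P u = 0 := hu
      rw [neg_apply, map_neg, smul_neg, sub_neg_eq_add, neg_add_eq_sub, ← neg_sub, hG ζ hζ.1,
        hζ.2, hu']
      simp
    · have hu' : P u = 0 := hu
      rw [neg_apply, hG' ζ hζ.1, hζ.2, hu']
      simp
  -- Bijectivity on the two complementary invariant subspaces gives bijectivity on the whole space.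
  have hcov : ∀ ζ, ζ ∉ spectrumOn A P.range → ζ ∉ spectrumOn A P.ker → ζ ∈ resolventSet ℂ A := by
    intro ζ h1 h2
    replace h1 := not_not.1 h1
    replace h2 := not_not.1 h2
    refine mem_resolventSet_of_isUnit (ContinuousLinearMap.isUnit_iff_bijective.2 ⟨?_, ?_⟩)
    · refine (injective_iff_map_eq_zero _).2 fun x hx => ?_
      have hx' : A x - ζ • x = 0 := hx
      have e1 : P x = 0 := by
        refine h1.injOn ⟨x, rfl⟩ P.range.zero_mem ?_
        simp only [map_zero, smul_zero, sub_zero]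
        change A (P x) - ζ • P x = 0
        rw [apply_comm hAP, ← map_smul, ← map_sub, hx', map_zero]
      refine h2.injOn e1 P.ker.zero_mem ?_
      simpa using hx'
    · intro y
      obtain ⟨u, -, hu⟩ := h1.surjOn (⟨y, rfl⟩ : P y ∈ P.range)
      have hy : y - P y ∈ P.ker := by
        change P (y - P y) = 0
        rw [map_sub, sub_eq_zero]
        exact ((mem_range_of_idem hidem).1 ⟨y, rfl⟩).symm
      obtain ⟨v, -, hv⟩ := h2.surjOn hy
      refine ⟨u + v, ?_⟩
      change A (u + v) - ζ • (u + v) = y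
      simp only at hu hv
      rw [map_add, smul_add, add_sub_add_comm, hu, hv, add_sub_cancel]
  refine ⟨hidem, hAP.eq, Set.Subset.antisymm (fun ζ hζ => ?_) fun ζ hζ => ?_,
    Set.Subset.antisymm (fun ζ hζ => ?_) fun ζ hζ => ?_⟩
  · have hs : ζ ∈ spectrum ℂ A := fun hr => hr1 ζ hr hζ
    exact ⟨hs, (h hs).resolve_right fun h' => ho ζ h' hζ⟩
  · by_contra hn
    exact hζ.1 (hcov ζ hn (hi ζ hζ.2))
  · exact ⟨fun hr => hr2 ζ hr hζ, fun h' => hi ζ h'.2 hζ⟩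
  · by_contra hn
    exact hζ.1 (hcov ζ (ho ζ ((h hζ.1).resolve_left fun h' => hζ.2 ⟨hζ.1, h'⟩)) hn)

end SpectralProjection

/-! ### The trace of operators of finite rank -/

section Trace

variable {E : Type*} [NormedAddCommGroup E] [NormedSpace ℂ E]

/-- Operators of finite rank. -/
def IsFiniteRank (F : E →L[ℂ] E) : Prop := FiniteDimensional ℂ F.range

theorem IsFiniteRank.of_mem {F : E →L[ℂ] E} {W : Submodule ℂ E} [FiniteDimensional ℂ W]
    (h : ∀ x, F x ∈ W) : IsFiniteRank F :=
  Submodule.finiteDimensional_of_le (S₂ := W) (by rintro _ ⟨x, rfl⟩; exact h x)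

theorem isFiniteRank_zero : IsFiniteRank (0 : E →L[ℂ] E) :=
  IsFiniteRank.of_mem (W := ⊥) fun _ => rfl

theorem IsFiniteRank.add {F G : E →L[ℂ] E} (hF : IsFiniteRank F) (hG : IsFiniteRank G) :
    IsFiniteRank (F + G) := by
  have : FiniteDimensional ℂ F.range := hF
  have : FiniteDimensional ℂ G.range := hG
  exact IsFiniteRank.of_mem (W := F.range ⊔ G.range) fun x =>
    Submodule.add_mem_sup ⟨x, rfl⟩ ⟨x, rfl⟩

theorem IsFiniteRank.mul_right {F : E →L[ℂ] E} (hF : IsFiniteRank F) (G : E →L[ℂ] E) :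
    IsFiniteRank (F * G) := by
  have : FiniteDimensional ℂ F.range := hF
  exact IsFiniteRank.of_mem (W := F.range) fun x => ⟨G x, rfl⟩

theorem IsFiniteRank.mul_left {F : E →L[ℂ] E} (hF : IsFiniteRank F) (G : E →L[ℂ] E) :
    IsFiniteRank (G * F) := by
  have : FiniteDimensional ℂ F.range := hF
  exact IsFiniteRank.of_mem (W := F.range.map (G : E →ₗ[ℂ] E)) fun x => ⟨F x, ⟨x, rfl⟩, rfl⟩

theorem IsFiniteRank.smul {F : E →L[ℂ] E} (hF : IsFiniteRank F) (c : ℂ) :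
    IsFiniteRank (c • F) := by
  rw [← mul_one F, ← mul_smul_comm]
  exact hF.mul_right _

theorem IsFiniteRank.sum {ι : Type*} {s : Finset ι} {F : ι → E →L[ℂ] E}
    (hF : ∀ i ∈ s, IsFiniteRank (F i)) : IsFiniteRank (∑ i ∈ s, F i) :=
  Finset.sum_induction F IsFiniteRank (fun _ _ => IsFiniteRank.add) isFiniteRank_zero hF

/-- F factors through the inclusion of its range in `W`, and the trace of a composition does not
depend on the order. The freedom in `W` lets operators with different ranges be compared in a common
space. -/
theorem finiteRankTrace_eq {F : E →L[ℂ] E} {W : Submodule ℂ E} [FiniteDimensional ℂ W]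
    (h : ∀ x, F x ∈ W) : finiteRankTrace F =
      LinearMap.trace ℂ W ((F : E →ₗ[ℂ] E).restrict (p := W) (q := W) fun x _ => h x) := by
  have hle : F.range ≤ W := by rintro _ ⟨x, rfl⟩; exact h x
  have : FiniteDimensional ℂ F.range := IsFiniteRank.of_mem h
  exact (LinearMap.trace_comp_comm'
    ((F : E →ₗ[ℂ] E).restrict (p := W) (q := F.range) fun x _ => ⟨x, rfl⟩)
    (Submodule.inclusion hle)).symm

theorem finiteRankTrace_zero : finiteRankTrace (0 : E →L[ℂ] E) = 0 := by
  rw [finiteRankTrace_eq (W := ⊥) fun _ => rfl]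
  exact map_zero (LinearMap.trace ℂ (⊥ : Submodule ℂ E))

theorem finiteRankTrace_add {F G : E →L[ℂ] E} (hF : IsFiniteRank F) (hG : IsFiniteRank G) :
    finiteRankTrace (F + G) = finiteRankTrace F + finiteRankTrace G := by
  have : FiniteDimensional ℂ F.range := hF
  have : FiniteDimensional ℂ G.range := hG
  have h1 : ∀ x, F x ∈ F.range ⊔ G.range := fun x => Submodule.mem_sup_left ⟨x, rfl⟩
  have h2 : ∀ x, G x ∈ F.range ⊔ G.range := fun x => Submodule.mem_sup_right ⟨x, rfl⟩
  rw [finiteRankTrace_eq h1, finiteRankTrace_eq h2,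
    finiteRankTrace_eq (F := F + G) fun x => Submodule.add_mem _ (h1 x) (h2 x), ← map_add]
  rfl

theorem finiteRankTrace_smul {F : E →L[ℂ] E} (hF : IsFiniteRank F) (c : ℂ) :
    finiteRankTrace (c • F) = c * finiteRankTrace F := by
  have : FiniteDimensional ℂ F.range := hF
  have h1 : ∀ x, F x ∈ F.range := fun x => ⟨x, rfl⟩
  rw [finiteRankTrace_eq h1, finiteRankTrace_eq (F := c • F) fun x =>
    Submodule.smul_mem _ c (h1 x), ← smul_eq_mul, ← map_smul]
  rfl

theorem finiteRankTrace_sub {F G : E →L[ℂ] E} (hF : IsFiniteRank F) (hG : IsFiniteRank G) :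
    finiteRankTrace (F - G) = finiteRankTrace F - finiteRankTrace G := by
  rw [sub_eq_add_neg, ← neg_one_smul ℂ G, finiteRankTrace_add hF (hG.smul _),
    finiteRankTrace_smul hG]
  ring

theorem finiteRankTrace_sum {ι : Type*} (s : Finset ι) {F : ι → E →L[ℂ] E}
    (hF : ∀ i ∈ s, IsFiniteRank (F i)) :
    finiteRankTrace (∑ i ∈ s, F i) = ∑ i ∈ s, finiteRankTrace (F i) := by
  classical
  induction s using Finset.induction_on with
  | empty => simp [finiteRankTrace_zero]
  | insert a s ha ih =>
    have hs : ∀ i ∈ s, IsFiniteRank (F i) := fun i hi => hF i (Finset.mem_insert_of_mem hi)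
    rw [Finset.sum_insert ha, Finset.sum_insert ha,
      finiteRankTrace_add (hF a (Finset.mem_insert_self a s)) (IsFiniteRank.sum hs), ih hs]

/-- Both products are compositions of G : range F → G(range F) and F : G(range F) → range F, in the
two orders. -/
theorem finiteRankTrace_mul_comm {F : E →L[ℂ] E} (hF : IsFiniteRank F) (G : E →L[ℂ] E) :
    finiteRankTrace (F * G) = finiteRankTrace (G * F) := by
  have : FiniteDimensional ℂ F.range := hF
  rw [finiteRankTrace_eq (F := F * G) (W := F.range) fun x => ⟨G x, rfl⟩,
    finiteRankTrace_eq (F := G * F) (W := F.range.map (G : E →ₗ[ℂ] E))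
      fun x => ⟨F x, ⟨x, rfl⟩, rfl⟩]
  exact LinearMap.trace_comp_comm'
    ((G : E →ₗ[ℂ] E).restrict (p := F.range) (q := F.range.map (G : E →ₗ[ℂ] E))
      fun x hx => ⟨x, hx, rfl⟩)
    ((F : E →ₗ[ℂ] E).restrict (p := F.range.map (G : E →ₗ[ℂ] E)) (q := F.range)
      fun x _ => ⟨x, rfl⟩)

theorem finiteRankTrace_of_idem {P : E →L[ℂ] E} (hF : IsFiniteRank P) (hP : P * P = P) :
    finiteRankTrace P = Module.finrank ℂ P.range := by
  have : FiniteDimensional ℂ P.range := hF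
  rw [← LinearMap.trace_id]
  unfold finiteRankTrace
  congr 1
  ext ⟨x, hx⟩
  exact (mem_range_of_idem hP).1 hx

end Trace

theorem norm_finiteRankTrace_le {E : Type*} [NormedAddCommGroup E] [InnerProductSpace ℂ E]
    {F : E →L[ℂ] E} {W : Submodule ℂ E} [FiniteDimensional ℂ W] (h : ∀ x, F x ∈ W) :
    ‖finiteRankTrace F‖ ≤ Module.finrank ℂ W * ‖F‖ := by
  rw [finiteRankTrace_eq h, LinearMap.trace_eq_sum_inner _ (stdOrthonormalBasis ℂ W)]
  refine (norm_sum_le _ _).trans ?_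
  have hb : ∀ i ∈ (Finset.univ : Finset (Fin (Module.finrank ℂ W))),
      ‖inner ℂ (stdOrthonormalBasis ℂ W i)
        ((F : E →ₗ[ℂ] E).restrict (p := W) (q := W) (fun x _ => h x)
          (stdOrthonormalBasis ℂ W i))‖ ≤ ‖F‖ := fun i _ => by
    refine (norm_inner_le_norm _ _).trans ?_
    rw [(stdOrthonormalBasis ℂ W).orthonormal.norm_eq_one i, one_mul]
    have h1 := F.le_opNorm (stdOrthonormalBasis ℂ W i : E)
    have h2 : ‖(stdOrthonormalBasis ℂ W i : E)‖ = 1 :=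
      (stdOrthonormalBasis ℂ W).orthonormal.norm_eq_one i
    rw [h2, mul_one] at h1
    exact h1
  refine (Finset.sum_le_card_nsmul _ _ _ hb).trans ?_
  simp

/-! ### Operator functions with one pole and a principal part of finite rank -/

section FiniteMero

variable {E : Type*} [NormedAddCommGroup E] [NormedSpace ℂ E]

/-- Operator functions that are holomorphic in `U` but for a pole at `β`, where the principal part
has finite rank. -/
inductive FiniteMero (U : Set ℂ) (β : ℂ) : (ℂ → E →L[ℂ] E) → Prop
  | reg {f : ℂ → E →L[ℂ] E} (hf : DifferentiableOn ℂ f U) : FiniteMero U β f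
  | pole (k : ℕ) {a : E →L[ℂ] E} (ha : IsFiniteRank a) :
      FiniteMero U β fun ζ => ((ζ - β)⁻¹ ^ k) • a
  | add {f g : ℂ → E →L[ℂ] E} (hf : FiniteMero U β f) (hg : FiniteMero U β g) :
      FiniteMero U β fun ζ => f ζ + g ζ
  | congr {f g : ℂ → E →L[ℂ] E} (hf : FiniteMero U β f) (h : Set.EqOn f g (U \ {β})) :
      FiniteMero U β g

variable {U : Set ℂ} {β : ℂ} {f g : ℂ → E →L[ℂ] E}

theorem continuousOn_inv_sub_pow (k : ℕ) {S : Set ℂ} (hβ : β ∉ S) :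
    ContinuousOn (fun ζ : ℂ => (ζ - β)⁻¹ ^ k) S :=
  (continuousOn_inv_sub hβ).pow k

theorem FiniteMero.continuousOn (hf : FiniteMero U β f) : ContinuousOn f (U \ {β}) := by
  induction hf with
  | reg hf => exact hf.continuousOn.mono Set.sdiff_subset
  | pole k ha => exact (continuousOn_inv_sub_pow k fun h => h.2 rfl).smul continuousOn_const
  | add _ _ hf hg => exact hf.add hg
  | congr _ h hf => exact hf.congr h.symm

theorem FiniteMero.const (a : E →L[ℂ] E) : FiniteMero U β fun _ => a :=
  .reg (differentiableOn_const a)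

theorem FiniteMero.continuousOn_contourSet {γ : ℝ → ℂ} (hγU : contourSet γ ⊆ U) (hβγ : β ∉ contourSet γ)
    (hf : FiniteMero U β f) : ContinuousOn f (contourSet γ) :=
  hf.continuousOn.mono fun _ hζ => ⟨hγU hζ, fun h => hβγ (h ▸ hζ)⟩

variable [CompleteSpace E]

/-- Induction on the order of the pole: g = g(β) + (ζ - β)·`dslope g β` splits off the leading term
and lowers the order by one. `L` will be left or right multiplication by an operator of finite rank.
-/
theorem FiniteMero.pole_smul (hU : IsOpen U) (hβ : β ∈ U) (L : (E →L[ℂ] E) →L[ℂ] (E →L[ℂ] E))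
    (hL : ∀ x, IsFiniteRank (L x)) (k : ℕ) (hg : DifferentiableOn ℂ g U) :
    FiniteMero U β fun ζ => ((ζ - β)⁻¹ ^ k) • L (g ζ) := by
  induction k generalizing g with
  | zero =>
    simp only [pow_zero, one_smul]
    exact .reg (L.differentiable.comp_differentiableOn hg)
  | succ k ih =>
    refine .congr (.add (.pole (k + 1) (hL (g β)))
      (ih ((Complex.differentiableOn_dslope (hU.mem_nhds hβ)).2 hg))) fun ζ hζ => ?_
    have hne : ζ - β ≠ 0 := sub_ne_zero.2 hζ.2
    have h1 : g ζ = g β + (ζ - β) • dslope g β ζ := by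
      rw [sub_smul_dslope, add_sub_cancel]
    conv_rhs => rw [h1, map_add, map_smul, smul_add, smul_smul, pow_succ, mul_assoc,
      inv_mul_cancel₀ hne, mul_one]
    rw [pow_succ]

theorem FiniteMero.pole_mul (hU : IsOpen U) (hβ : β ∈ U) (k : ℕ) {a : E →L[ℂ] E}
    (ha : IsFiniteRank a) (hg : FiniteMero U β g) :
    FiniteMero U β fun ζ => ((ζ - β)⁻¹ ^ k • a) * g ζ := by
  induction hg with
  | @reg g hg =>
    have h := FiniteMero.pole_smul hU hβ (ContinuousLinearMap.mul ℂ (E →L[ℂ] E) a)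
      (fun x => ha.mul_right x) k hg
    exact h.congr fun ζ _ => (smul_mul_assoc _ a (g ζ)).symm
  | @pole j b hb =>
    have h : FiniteMero U β fun ζ => ((ζ - β)⁻¹ ^ (k + j)) • (a * b) := .pole _ (ha.mul_right b)
    refine h.congr fun ζ _ => ?_
    simp only
    rw [smul_mul_smul_comm, pow_add]
  | add _ _ h1 h2 => exact (h1.add h2).congr fun ζ _ => (mul_add _ _ _).symm
  | congr _ h h1 => exact h1.congr fun ζ hζ => by simp only [h hζ]

theorem FiniteMero.reg_mul (hU : IsOpen U) (hβ : β ∈ U) (hf : DifferentiableOn ℂ f U)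
    (hg : FiniteMero U β g) : FiniteMero U β fun ζ => f ζ * g ζ := by
  induction hg with
  | reg hg => exact .reg (hf.mul hg)
  | @pole k a ha =>
    have h := FiniteMero.pole_smul hU hβ ((ContinuousLinearMap.mul ℂ (E →L[ℂ] E)).flip a)
      (fun x => ha.mul_left x) k hf
    exact h.congr fun ζ _ => (mul_smul_comm _ (f ζ) a).symm
  | add _ _ h1 h2 => exact (h1.add h2).congr fun ζ _ => (mul_add _ _ _).symm
  | congr _ h h1 => exact h1.congr fun ζ hζ => by simp only [h hζ]

theorem FiniteMero.mul (hU : IsOpen U) (hβ : β ∈ U) (hf : FiniteMero U β f)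
    (hg : FiniteMero U β g) : FiniteMero U β fun ζ => f ζ * g ζ := by
  induction hf with
  | reg hf => exact hg.reg_mul hU hβ hf
  | pole k ha => exact hg.pole_mul hU hβ k ha
  | add _ _ h1 h2 => exact (h1.add h2).congr fun ζ _ => (add_mul _ _ _).symm
  | congr _ h h1 => exact h1.congr fun ζ hζ => by simp only [h hζ]

theorem FiniteMero.list_prod (hU : IsOpen U) (hβ : β ∈ U) {ι : Type*} {F : ι → ℂ → E →L[ℂ] E}
    (hF : ∀ i, FiniteMero U β (F i)) (l : List ι) :
    FiniteMero U β fun ζ => (l.map fun i => F i ζ).prod := by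
  induction l with
  | nil => simpa using FiniteMero.const (1 : E →L[ℂ] E)
  | cons i l ih => simpa using (hF i).mul hU hβ ih

variable {γ : ℝ → ℂ}

/-- Cauchy's theorem removes the holomorphic part, so only the principal part contributes. -/
theorem FiniteMero.isFiniteRank_contourIntegral (hγ : IsClosedContour γ) (hU : IsOpen U)
    (hγU : contourSet γ ⊆ U) (hw : Uᶜ ⊆ outside γ) (hβγ : β ∉ contourSet γ)
    (hf : FiniteMero U β f) : IsFiniteRank (contourIntegral γ f) := by
  induction hf with
  | reg hf =>
    rw [contourIntegral_eq_zero_of_windingNumber hγ hU hγU hw hf]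
    exact isFiniteRank_zero
  | pole k ha =>
    rw [contourIntegral_smul_const hγ (continuousOn_inv_sub_pow k hβγ)]
    exact ha.smul _
  | add hf hg h1 h2 =>
    rw [contourIntegral_add hγ (hf.continuousOn_contourSet hγU hβγ)
      (hg.continuousOn_contourSet hγU hβγ)]
    exact h1.add h2
  | congr _ h h1 =>
    rwa [← contourIntegral_congr fun ζ hζ => h ⟨hγU hζ, fun e => hβγ (e ▸ hζ)⟩]

theorem FiniteMero.trace_add (hγ : IsClosedContour γ) (hU : IsOpen U)
    (hγU : contourSet γ ⊆ U) (hw : Uᶜ ⊆ outside γ) (hβγ : β ∉ contourSet γ)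
    (hf : FiniteMero U β f) (hg : FiniteMero U β g) :
    finiteRankTrace (contourIntegral γ fun ζ => f ζ + g ζ) =
      finiteRankTrace (contourIntegral γ f) + finiteRankTrace (contourIntegral γ g) := by
  rw [contourIntegral_add hγ (hf.continuousOn_contourSet hγU hβγ)
    (hg.continuousOn_contourSet hγU hβγ), finiteRankTrace_add
    (hf.isFiniteRank_contourIntegral hγ hU hγU hw hβγ)
    (hg.isFiniteRank_contourIntegral hγ hU hγU hw hβγ)]

theorem FiniteMero.trace_sum (hγ : IsClosedContour γ) (hU : IsOpen U)
    (hγU : contourSet γ ⊆ U) (hw : Uᶜ ⊆ outside γ) (hβγ : β ∉ contourSet γ) {ι : Type*}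
    (s : Finset ι) {F : ι → ℂ → E →L[ℂ] E} (hF : ∀ i ∈ s, FiniteMero U β (F i)) :
    finiteRankTrace (contourIntegral γ fun ζ => ∑ i ∈ s, F i ζ) =
      ∑ i ∈ s, finiteRankTrace (contourIntegral γ (F i)) := by
  rw [contourIntegral_finsetSum hγ s fun i hi => (hF i hi).continuousOn_contourSet hγU hβγ,
    finiteRankTrace_sum s fun i hi => (hF i hi).isFiniteRank_contourIntegral hγ hU hγU hw hβγ]

theorem trace_pole_mul_comm (hγ : IsClosedContour γ) (hβγ : β ∉ contourSet γ)
    {a : E →L[ℂ] E} (ha : IsFiniteRank a) (k : ℕ) (hg : ContinuousOn g (contourSet γ)) :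
    finiteRankTrace (contourIntegral γ fun ζ => ((ζ - β)⁻¹ ^ k • a) * g ζ) =
      finiteRankTrace (contourIntegral γ fun ζ => g ζ * ((ζ - β)⁻¹ ^ k • a)) := by
  simp only [smul_mul_assoc, mul_smul_comm]
  simp only [← mul_smul_comm]
  have hc : ContinuousOn (fun ζ => (ζ - β)⁻¹ ^ k • g ζ) (contourSet γ) :=
    (continuousOn_inv_sub_pow k hβγ).smul hg
  have e : (fun ζ => g ζ * (ζ - β)⁻¹ ^ k • a) = fun ζ => ((ζ - β)⁻¹ ^ k • g ζ) * a := by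
    funext ζ
    rw [mul_smul_comm, smul_mul_assoc]
  rw [e, contourIntegral_mul_left hγ a hc, contourIntegral_mul_right hγ a hc,
    finiteRankTrace_mul_comm ha]

/-- The trace of the contour integral of a product does not depend on the order of the factors. -/
theorem FiniteMero.trace_mul_comm (hγ : IsClosedContour γ) (hU : IsOpen U) (hβ : β ∈ U)
    (hγU : contourSet γ ⊆ U) (hw : Uᶜ ⊆ outside γ) (hβγ : β ∉ contourSet γ)
    (hf : FiniteMero U β f) (hg : FiniteMero U β g) :
    finiteRankTrace (contourIntegral γ fun ζ => f ζ * g ζ) =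
      finiteRankTrace (contourIntegral γ fun ζ => g ζ * f ζ) := by
  have hsub : ∀ ζ ∈ contourSet γ, ζ ∈ U \ {β} := fun ζ hζ => ⟨hγU hζ, fun e => hβγ (e ▸ hζ)⟩
  induction hf with
  -- Two holomorphic factors integrate to 0 in either order. If one factor is a pole term, its
  -- constant operator comes out of the integral and the cyclicity for operators of finite rank
  -- applies.
  | @reg f hf =>
    induction hg with
    | reg hg =>
      exact congrArg _ ((contourIntegral_eq_zero_of_windingNumber hγ hU hγU hw (hf.mul hg)).trans
        (contourIntegral_eq_zero_of_windingNumber hγ hU hγU hw (hg.mul hf)).symm)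
    | pole k ha => exact (trace_pole_mul_comm hγ hβγ ha k (hf.continuousOn.mono hγU)).symm
    | add h1 h2 e1 e2 =>
      have hf' : FiniteMero U β f := .reg hf
      simp only [mul_add, add_mul]
      rw [FiniteMero.trace_add hγ hU hγU hw hβγ (hf'.mul hU hβ h1) (hf'.mul hU hβ h2),
        FiniteMero.trace_add hγ hU hγU hw hβγ (h1.mul hU hβ hf') (h2.mul hU hβ hf'), e1, e2]
    | @congr g g' _ h e =>
      rw [← contourIntegral_congr (f := fun ζ => f ζ * g ζ)
          fun ζ hζ => by simp only [h (hsub ζ hζ)], e]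
      exact congrArg _ (contourIntegral_congr fun ζ hζ => by simp only [h (hsub ζ hζ)])
  | pole k ha => exact trace_pole_mul_comm hγ hβγ ha k (hg.continuousOn_contourSet hγU hβγ)
  | add h1 h2 e1 e2 =>
    simp only [mul_add, add_mul]
    rw [FiniteMero.trace_add hγ hU hγU hw hβγ (h1.mul hU hβ hg) (h2.mul hU hβ hg),
      FiniteMero.trace_add hγ hU hγU hw hβγ (hg.mul hU hβ h1) (hg.mul hU hβ h2), e1, e2]
  | @congr f f' _ h e =>
    rw [← contourIntegral_congr (f := fun ζ => f ζ * g ζ)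
        fun ζ hζ => by simp only [h (hsub ζ hζ)], e]
    exact congrArg _ (contourIntegral_congr fun ζ hζ => by simp only [h (hsub ζ hζ)])

end FiniteMero

/-! ### The resolvent near a semisimple eigenvalue -/

section Eigenvalue

variable {E : Type*} [NormedAddCommGroup E] [NormedSpace ℂ E]

/-- The contour `γ` separates the point `β` of the spectrum of `A` from the rest of the spectrum,
and the part of `A` that belongs to `β` is `β` times a projection of finite rank. -/
structure IsolatesEigenvalue (A : E →L[ℂ] E) (γ : ℝ → ℂ) (β : ℂ) : Prop where
  contour : IsClosedContour γ
  mem_inside : β ∈ inside γ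
  diff_subset : spectrum ℂ A \ {β} ⊆ outside γ
  finiteRank : IsFiniteRank (riesz A γ)
  mul_riesz : A * riesz A γ = β • riesz A γ

/-- The domain in which the resolvent is holomorphic but for a pole inside `γ`. -/
def poleDomain (A : E →L[ℂ] E) (γ : ℝ → ℂ) : Set ℂ := resolventSet ℂ A ∪ inside γ

theorem spectrum_subset_of_diff {A : E →L[ℂ] E} {γ : ℝ → ℂ} {β : ℂ} (h : β ∈ inside γ)
    (h' : spectrum ℂ A \ {β} ⊆ outside γ) : spectrum ℂ A ⊆ inside γ ∪ outside γ := fun ζ hζ => by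
  by_cases e : ζ = β
  · exact Or.inl (e ▸ h)
  · exact Or.inr (h' ⟨hζ, e⟩)

variable {A : E →L[ℂ] E} {γ : ℝ → ℂ} {β : ℂ}

theorem IsolatesEigenvalue.spectrum_subset (h : IsolatesEigenvalue A γ β) :
    spectrum ℂ A ⊆ inside γ ∪ outside γ := spectrum_subset_of_diff h.mem_inside h.diff_subset

theorem IsolatesEigenvalue.contourSet_subset (h : IsolatesEigenvalue A γ β) :
    contourSet γ ⊆ resolventSet ℂ A := contourSet_subset_resolventSet h.spectrum_subset

theorem IsolatesEigenvalue.mem_resolventSet (h : IsolatesEigenvalue A γ β) {ζ : ℂ}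
    (hζ : ζ ∈ inside γ) (hne : ζ ≠ β) : ζ ∈ resolventSet ℂ A := by
  by_contra hs
  exact Set.disjoint_left.1 (disjoint_inside_outside γ) hζ (h.diff_subset ⟨hs, hne⟩)

theorem IsolatesEigenvalue.compl_poleDomain_subset (h : IsolatesEigenvalue A γ β) :
    (poleDomain A γ)ᶜ ⊆ outside γ := fun _ hζ =>
  (h.spectrum_subset fun hr => hζ (Or.inl hr)).resolve_left fun hi => hζ (Or.inr hi)

theorem IsolatesEigenvalue.mem_poleDomain (h : IsolatesEigenvalue A γ β) :
    β ∈ poleDomain A γ := Or.inr h.mem_inside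

/-- The product `B k₁ R(ζ) ⋯ B k_p R(ζ)` for the list `[k₁, …, k_p]`. -/
def resProd (B : ℕ → E →L[ℂ] E) (A : E →L[ℂ] E) (l : List ℕ) (ζ : ℂ) : E →L[ℂ] E :=
  (l.map fun k => B k * res A ζ).prod

variable {B : ℕ → E →L[ℂ] E}

theorem resProd_append (l l' : List ℕ) (ζ : ℂ) :
    resProd B A (l ++ l') ζ = resProd B A l ζ * resProd B A l' ζ := by
  simp [resProd]

theorem resProd_cons (k : ℕ) (l : List ℕ) (ζ : ℂ) :
    resProd B A (k :: l) ζ = B k * res A ζ * resProd B A l ζ := by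
  simp [resProd]

variable [CompleteSpace E]

theorem IsolatesEigenvalue.isOpen_poleDomain (h : IsolatesEigenvalue A γ β) :
    IsOpen (poleDomain A γ) :=
  (spectrum.isOpen_resolventSet A).union (isOpen_inside h.contour)

/-- Split R = RP + R(1 - P). The first term is -(ζ - β)⁻¹P because AP = βP. The second continues
holomorphically across β as minus the Cauchy transform. -/
theorem IsolatesEigenvalue.finiteMero_res (h : IsolatesEigenvalue A γ β) :
    FiniteMero (poleDomain A γ) β (res A) := by
  classical
  have hγ := h.contour
  have hγa := h.contourSet_subset
  set P := riesz A γ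
  set S : ℂ → E →L[ℂ] E := fun ζ => if ζ ∈ resolventSet ℂ A then res A ζ * (1 - P)
    else -rieszTransform A γ ζ with hS
  have hin : ∀ ζ ∈ inside γ, S ζ = -rieszTransform A γ ζ := fun ζ hζ => by
    by_cases hr : ζ ∈ resolventSet ℂ A
    · simp only [hS, if_pos hr]
      rw [rieszTransform_eq hγ hγa hζ.1 hr, hζ.2, one_smul, ← mul_neg, neg_sub]
    · exact if_neg hr
  have hdiff : DifferentiableOn ℂ S (poleDomain A γ) := by
    intro ζ hζ
    refine DifferentiableAt.differentiableWithinAt ?_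
    rcases hζ with hr | hi
    · refine ((hasDerivAt_res hr).differentiableAt.mul_const (1 - P)).congr_of_eventuallyEq ?_
      filter_upwards [(spectrum.isOpen_resolventSet A).mem_nhds hr] with v hv using if_pos hv
    · refine (((differentiableOn_rieszTransform hγ hγa).differentiableAt
        ((isCompact_contourSet hγ).isClosed.isOpen_compl.mem_nhds hi.1)).neg).congr_of_eventuallyEq
        ?_
      filter_upwards [(isOpen_inside hγ).mem_nhds hi] with v hv using hin v hv
  refine (FiniteMero.add (.pole 1 (h.finiteRank.smul (-1))) (.reg hdiff)).congr fun ζ hζ => ?_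
  have hne : ζ ≠ β := hζ.2
  have hr : ζ ∈ resolventSet ℂ A := hζ.1.elim id fun hi => h.mem_resolventSet hi hne
  have h1 : res A ζ * P = (ζ - β)⁻¹ • (-1 : ℂ) • P := by
    have h2 : (A - ζ • (1 : E →L[ℂ] E)) * P = (β - ζ) • P := by
      rw [sub_mul, h.mul_riesz, smul_mul_assoc, one_mul, sub_smul]
    have h3 : P = (β - ζ) • (res A ζ * P) := by
      rw [← mul_smul_comm, ← h2, ← mul_assoc, res_mul_sub hr, one_mul]
    have h4 : (ζ - β)⁻¹ * (-1) * (β - ζ) = 1 := by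
      have := sub_ne_zero.2 hne
      field_simp
      ring
    conv_rhs => rw [h3, smul_smul, smul_smul, h4, one_smul]
  simp only [pow_one, hS, if_pos hr]
  rw [← h1, mul_sub, mul_one, add_sub_cancel]

theorem IsolatesEigenvalue.finiteMero_resProd (h : IsolatesEigenvalue A γ β) (l : List ℕ) :
    FiniteMero (poleDomain A γ) β (resProd B A l) :=
  FiniteMero.list_prod h.isOpen_poleDomain h.mem_poleDomain
    (fun k => (FiniteMero.const (B k)).mul h.isOpen_poleDomain h.mem_poleDomain h.finiteMero_res) l

theorem IsolatesEigenvalue.finiteMero_smul_res (h : IsolatesEigenvalue A γ β) :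
    FiniteMero (poleDomain A γ) β fun ζ => (ζ - β) • res A ζ := by
  have h1 : FiniteMero (poleDomain A γ) β fun ζ => (ζ - β) • (1 : E →L[ℂ] E) :=
    .reg (DifferentiableOn.smul_const (by fun_prop) _)
  exact (h1.mul h.isOpen_poleDomain h.mem_poleDomain h.finiteMero_res).congr fun ζ _ => by
    simp only [smul_mul_assoc, one_mul]

/-- As R' = RR, differentiating one factor inserts a further resolvent behind it. -/
theorem hasDerivAt_resProd {ζ : ℂ} (hζ : ζ ∈ resolventSet ℂ A) (l : List ℕ) :
    HasDerivAt (resProd B A l) (∑ j ∈ Finset.range l.length,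
      resProd B A (l.take (j + 1)) ζ * (res A ζ * resProd B A (l.drop (j + 1)) ζ)) ζ := by
  induction l with
  | nil =>
    rw [List.length_nil, Finset.range_zero, Finset.sum_empty]
    exact hasDerivAt_const ζ (1 : E →L[ℂ] E)
  | cons k l ih =>
    have h1 := (((hasDerivAt_res hζ).const_mul (B k)).mul ih)
    have e : resProd B A (k :: l) = fun ζ => B k * res A ζ * resProd B A l ζ :=
      funext fun ζ => resProd_cons k l ζ
    rw [e]
    refine h1.congr_deriv ?_
    rw [List.length_cons, Finset.sum_range_succ', add_comm, Finset.mul_sum]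
    congr 1

/-- Integration by parts and cyclicity of the trace. -/
theorem IsolatesEigenvalue.trace_resProd (h : IsolatesEigenvalue A γ β) (l : List ℕ) :
    finiteRankTrace (contourIntegral γ (resProd B A l)) =
      -∑ j ∈ Finset.range l.length, finiteRankTrace (contourIntegral γ fun ζ =>
        ((ζ - β) • res A ζ) * resProd B A (l.rotate (j + 1)) ζ) := by
  have hγ := h.contour
  have hU := h.isOpen_poleDomain
  have hβ := h.mem_poleDomain
  have hγU : contourSet γ ⊆ poleDomain A γ := fun ζ hζ => Or.inl (h.contourSet_subset hζ)
  have hw := h.compl_poleDomain_subset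
  have hβγ := h.mem_inside.1
  have hM := fun l => h.finiteMero_resProd (B := B) l
  have hR := h.finiteMero_smul_res
  have hterm : ∀ j, FiniteMero (poleDomain A γ) β fun ζ =>
      resProd B A (l.take (j + 1)) ζ * (((ζ - β) • res A ζ) * resProd B A (l.drop (j + 1)) ζ) :=
    fun j => (hM _).mul hU hβ (hR.mul hU hβ (hM _))
  -- The first j + 1 factors move to the end, which rotates the list by j + 1.
  have hcyc : ∀ j ∈ Finset.range l.length, finiteRankTrace (contourIntegral γ fun ζ =>
      resProd B A (l.take (j + 1)) ζ * (((ζ - β) • res A ζ) * resProd B A (l.drop (j + 1)) ζ)) =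
      finiteRankTrace (contourIntegral γ fun ζ =>
        ((ζ - β) • res A ζ) * resProd B A (l.rotate (j + 1)) ζ) := by
    intro j hj
    rw [FiniteMero.trace_mul_comm hγ hU hβ hγU hw hβγ (hM _) (hR.mul hU hβ (hM _)),
      List.rotate_eq_drop_append_take (Finset.mem_range.1 hj)]
    simp only [resProd_append, mul_assoc]
  rw [← Finset.sum_congr rfl hcyc, ← FiniteMero.trace_sum hγ hU hγU hw hβγ _ fun j _ => hterm j]
  have hsum : ContinuousOn (fun ζ => ∑ j ∈ Finset.range l.length, resProd B A (l.take (j + 1)) ζ *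
      (((ζ - β) • res A ζ) * resProd B A (l.drop (j + 1)) ζ)) (contourSet γ) :=
    continuousOn_finsetSum _ fun j _ => (hterm j).continuousOn_contourSet hγU hβγ
  have hMc := (hM l).continuousOn_contourSet hγU hβγ
  -- The integral of the derivative of (ζ - β)M(ζ) is 0, where M is the product of the list. So ∮ M
  -- = -∮ (ζ - β)M'.
  have hparts := contourIntegral_deriv_eq_zero hγ (f := fun ζ => (ζ - β) • resProd B A l ζ)
    (f' := fun ζ => (∑ j ∈ Finset.range l.length, resProd B A (l.take (j + 1)) ζ *
      (((ζ - β) • res A ζ) * resProd B A (l.drop (j + 1)) ζ)) + resProd B A l ζ)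
    (fun ζ hζ => ?_) (hsum.add hMc)
  · rw [contourIntegral_add hγ hsum hMc, add_eq_zero_iff_neg_eq] at hparts
    rw [← hparts, ← neg_one_smul ℂ, finiteRankTrace_smul, neg_one_mul]
    rw [contourIntegral_finsetSum hγ _ fun j _ => (hterm j).continuousOn_contourSet hγU hβγ]
    exact IsFiniteRank.sum fun j _ => (hterm j).isFiniteRank_contourIntegral hγ hU hγU hw hβγ
  · have h1 : HasDerivAt (fun ζ : ℂ => ζ - β) 1 ζ := (hasDerivAt_id ζ).sub_const β
    refine (h1.smul (hasDerivAt_resProd (h.contourSet_subset hζ) l)).congr_deriv ?_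
    rw [one_smul, Finset.smul_sum]
    simp only [smul_mul_assoc, mul_smul_comm]

end Eigenvalue

/-! ### Sums over compositions -/

section Composition

/-- Cyclic rotation of the blocks of a composition. -/
def rotateComposition {n : ℕ} (j : ℕ) (c : Composition n) : Composition n where
  blocks := c.blocks.rotate j
  blocks_pos hi := c.blocks_pos (List.mem_rotate.1 hi)
  blocks_sum := by rw [(c.blocks.rotate_perm j).sum_eq, c.blocks_sum]

theorem rotateComposition_bijective {n : ℕ} (j : ℕ) :
    Function.Bijective (rotateComposition (n := n) j) :=
  Finite.injective_iff_bijective.1 fun _ _ h =>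
    Composition.ext (List.rotate_injective j (congrArg Composition.blocks h))

theorem length_rotateComposition {n : ℕ} (j : ℕ) (c : Composition n) :
    (rotateComposition j c).length = c.length := List.length_rotate _ _

/-- Rotation by a fixed amount permutes the compositions of n and preserves the length, so each
rotated term has the same total as the unrotated one. -/
theorem sum_composition_rotate {n : ℕ} (w : ℕ → ℂ) (g : List ℕ → ℂ) :
    ∑ c : Composition n, w c.length * ∑ j ∈ Finset.range c.length, g (c.blocks.rotate (j + 1)) =
      ∑ c : Composition n, w c.length * (c.length * g c.blocks) := by
  -- The inner range depends on the composition; it is extended to `range n`, with zeros, so that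
  -- the sums can be interchanged.
  have ext_range : ∀ (c : Composition n) (f : ℕ → ℂ), ∑ j ∈ Finset.range c.length, f j =
      ∑ j ∈ Finset.range n, if j < c.length then f j else 0 := by
    intro c f
    rw [← Finset.sum_filter]
    refine Finset.sum_congr ?_ fun _ _ => rfl
    ext j
    simp only [Finset.mem_range, Finset.mem_filter]
    exact ⟨fun h => ⟨h.trans_le c.length_le, h⟩, fun h => h.2⟩
  have hlen : ∀ c : Composition n, (c.length : ℂ) * g c.blocks =
      ∑ j ∈ Finset.range c.length, g c.blocks := by simp
  simp only [hlen, ext_range, Finset.mul_sum]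
  rw [Finset.sum_comm, Finset.sum_comm (s := Finset.univ)]
  refine Finset.sum_congr rfl fun j _ => ?_
  rw [← (rotateComposition_bijective (n := n) (j + 1)).sum_comp
    (fun c => w c.length * if j < c.length then g c.blocks else 0)]
  simp only [length_rotateComposition]
  rfl

/-- Splitting off the first block is what makes the resolvent coefficients recursive. -/
theorem sum_composition_cons {M : Type*} [AddCommMonoid M] {n : ℕ} (hn : n ≠ 0)
    (g : List ℕ → M) : ∑ c : Composition n, g c.blocks =
      ∑ k ∈ Finset.Icc 1 n, ∑ c : Composition (n - k), g (k :: c.blocks) := by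
  rw [Finset.sum_sigma']
  symm
  refine Finset.sum_bij (fun x hx => (⟨x.1 :: x.2.blocks, ?_, ?_⟩ : Composition n)) ?_ ?_ ?_ ?_
  · simp only [Finset.mem_sigma, Finset.mem_Icc] at hx
    intro i hi
    rcases List.mem_cons.1 hi with rfl | hi
    · exact hx.1.1
    · exact x.2.blocks_pos hi
  · simp only [Finset.mem_sigma, Finset.mem_Icc] at hx
    rw [List.sum_cons, x.2.blocks_sum]
    omega
  · intro _ _
    exact Finset.mem_univ _
  · rintro ⟨k, c⟩ _ ⟨k', c'⟩ _ h
    have h' := congrArg Composition.blocks h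
    simp only [List.cons.injEq] at h'
    obtain ⟨rfl, h'⟩ := h'
    rw [Composition.ext h']
  · rintro ⟨l, hpos, hsum⟩ _
    cases l with
    | nil => exact absurd hsum.symm hn
    | cons k l =>
      rw [List.sum_cons] at hsum
      refine ⟨⟨k, ⟨l, fun hi => hpos (List.mem_cons_of_mem k hi), by omega⟩⟩, ?_, rfl⟩
      have := hpos (List.mem_cons_self (a := k) (l := l))
      simp only [Finset.mem_sigma, Finset.mem_Icc, Finset.mem_univ, and_true]
      omega
  · intro _ _
    rfl

end Composition

/-! ### The trace formula without the weights 1/p -/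

section Eigenvalue

variable {E : Type*} [NormedAddCommGroup E] [NormedSpace ℂ E] [CompleteSpace E]
  {A : E →L[ℂ] E} {γ : ℝ → ℂ} {β : ℂ} {B : ℕ → E →L[ℂ] E}

theorem IsolatesEigenvalue.isFiniteRank_smul_res_mul (h : IsolatesEigenvalue A γ β) (l : List ℕ) :
    IsFiniteRank (contourIntegral γ fun ζ => ((ζ - β) • res A ζ) * resProd B A l ζ) :=
  (h.finiteMero_smul_res.mul h.isOpen_poleDomain h.mem_poleDomain
    (h.finiteMero_resProd l)).isFiniteRank_contourIntegral h.contour h.isOpen_poleDomain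
    (fun _ hζ => Or.inl (h.contourSet_subset hζ)) h.compl_poleDomain_subset h.mem_inside.1

/-- `trace_resProd` replaces each product of length p by p rotated terms. After summation over all
compositions these coincide, and the factor p cancels 1/p. The assumption n ≠ 0 ensures p > 0. -/
theorem IsolatesEigenvalue.trace_sum_composition (h : IsolatesEigenvalue A γ β) {n : ℕ}
    (hn : n ≠ 0) : finiteRankTrace (∑ c : Composition n, ((-1 : ℂ) ^ c.length / c.length) •
        contourIntegral γ (resProd B A c.blocks)) =
      -finiteRankTrace (∑ c : Composition n, (-1 : ℂ) ^ c.length •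
        contourIntegral γ fun ζ => ((ζ - β) • res A ζ) * resProd B A c.blocks ζ) := by
  have hfr : ∀ l, IsFiniteRank (contourIntegral γ (resProd B A l)) := fun l =>
    (h.finiteMero_resProd l).isFiniteRank_contourIntegral h.contour h.isOpen_poleDomain
      (fun _ hζ => Or.inl (h.contourSet_subset hζ)) h.compl_poleDomain_subset h.mem_inside.1
  rw [finiteRankTrace_sum _ fun c _ => (hfr _).smul _,
    finiteRankTrace_sum _ fun c _ => (h.isFiniteRank_smul_res_mul _).smul _]
  simp only [finiteRankTrace_smul (hfr _), finiteRankTrace_smul (h.isFiniteRank_smul_res_mul _)]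
  simp only [h.trace_resProd, mul_neg, Finset.sum_neg_distrib]
  rw [sum_composition_rotate (fun p => (-1 : ℂ) ^ p / p) fun l => finiteRankTrace
    (contourIntegral γ fun ζ => ((ζ - β) • res A ζ) * resProd B A l ζ)]
  congr 1
  refine Finset.sum_congr rfl fun c _ => ?_
  have hc : (c.length : ℂ) ≠ 0 :=
    Nat.cast_ne_zero.2 (c.length_pos_of_pos (Nat.pos_of_ne_zero hn)).ne'
  rw [← mul_assoc, div_mul_cancel₀ _ hc]

end Eigenvalue

/-! ### Taylor expansions -/

section Taylor

variable {F : Type*} [NormedAddCommGroup F] [NormedSpace ℂ F]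

theorem partialSum_eq_taylor [CompleteSpace F] {f : ℂ → F}
    {p : FormalMultilinearSeries ℂ ℂ F} {r : ENNReal} (h : HasFPowerSeriesOnBall f p 0 r)
    (n : ℕ) (z : ℂ) : p.partialSum n z =
      ∑ k ∈ Finset.range n, z ^ k • (k.factorial : ℂ)⁻¹ • iteratedDeriv k f 0 := by
  refine Finset.sum_congr rfl fun k _ => ?_
  have h1 := h.factorial_smul z k
  rw [iteratedFDeriv_apply_eq_iteratedDeriv_mul_prod] at h1
  simp only [Finset.prod_const, Finset.card_univ, Fintype.card_fin] at h1
  rw [smul_comm, ← h1, ← Nat.cast_smul_eq_nsmul ℂ, smul_smul,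
    inv_mul_cancel₀ (Nat.cast_ne_zero.2 k.factorial_ne_zero), one_smul]

/-- The limit z → 0 gives c 0 = 0; then divide by z and repeat. The punctured neighbourhood permits
the division. -/
theorem coeff_eq_zero_of_isBigO {N : ℕ} {c : ℕ → F}
    (h : (fun z : ℂ => ∑ n ∈ Finset.range (N + 1), z ^ n • c n) =O[𝓝[≠] 0]
      fun z => z ^ (N + 1)) : ∀ n ≤ N, c n = 0 := by
  have hc0 : ∀ {N : ℕ} {c : ℕ → F}, ((fun z : ℂ => ∑ n ∈ Finset.range (N + 1), z ^ n • c n)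
      =O[𝓝[≠] 0] fun z => z ^ (N + 1)) → c 0 = 0 := by
    intro N c h
    have h1 : Tendsto (fun z : ℂ => z ^ (N + 1)) (𝓝[≠] 0) (𝓝 0) := by
      have : Tendsto (fun z : ℂ => z ^ (N + 1)) (𝓝 0) (𝓝 (0 ^ (N + 1))) :=
        (continuous_pow (N + 1)).tendsto 0
      rw [zero_pow N.succ_ne_zero] at this
      exact this.mono_left nhdsWithin_le_nhds
    have h2 : Tendsto (fun z : ℂ => ∑ n ∈ Finset.range (N + 1), z ^ n • c n) (𝓝[≠] 0)
        (𝓝 (∑ n ∈ Finset.range (N + 1), (0 : ℂ) ^ n • c n)) :=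
      ((continuous_finsetSum _ fun n _ => by fun_prop).tendsto 0).mono_left nhdsWithin_le_nhds
    have h3 := tendsto_nhds_unique h2 (h.trans_tendsto h1)
    rw [Finset.sum_range_succ'] at h3
    simpa using h3
  induction N generalizing c with
  | zero =>
    intro n hn
    rw [Nat.le_zero.1 hn]
    exact hc0 h
  | succ N ih =>
    have h0 := hc0 h
    have h1 : (fun z : ℂ => ∑ n ∈ Finset.range (N + 1), z ^ n • c (n + 1)) =O[𝓝[≠] 0]
        fun z => z ^ (N + 1) := by
      have hb := (Asymptotics.isBigO_refl (fun z : ℂ => z⁻¹) (𝓝[≠] 0)).smul h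
      refine hb.congr' ?_ ?_
      · filter_upwards [self_mem_nhdsWithin] with z hz
        rw [Finset.sum_range_succ', h0, smul_zero, add_zero, Finset.smul_sum]
        refine Finset.sum_congr rfl fun n _ => ?_
        rw [smul_smul, pow_succ', inv_mul_cancel_left₀ hz]
      · filter_upwards [self_mem_nhdsWithin] with z hz
        rw [smul_eq_mul, pow_succ', inv_mul_cancel_left₀ hz]
    intro n hn
    cases n with
    | zero => exact h0
    | succ n => exact ih h1 n (Nat.le_of_succ_le_succ hn)

variable [CompleteSpace F] {f : ℂ → F} {r : ℝ}

theorem exists_hasFPowerSeriesOnBall (hf : DifferentiableOn ℂ f (Metric.ball 0 r)) {R : NNReal}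
    (hR : 0 < R) (hRr : R < r) : 
    ∃ p : FormalMultilinearSeries ℂ ℂ F, HasFPowerSeriesOnBall f p 0 R :=
  ⟨_, (hf.mono (Metric.closedBall_subset_ball hRr)).hasFPowerSeriesOnBall hR⟩

theorem isBigO_sub_taylor (hf : DifferentiableOn ℂ f (Metric.ball 0 r)) (hr : 0 < r) (n : ℕ) :
    (fun z => f z - ∑ k ∈ Finset.range n, z ^ k • (k.factorial : ℂ)⁻¹ • iteratedDeriv k f 0)
      =O[𝓝 0] fun z => z ^ n := by
  have hR : (0 : ℝ) < r / 2 := half_pos hr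
  obtain ⟨p, hp⟩ := exists_hasFPowerSeriesOnBall hf (R := ⟨r / 2, hR.le⟩) hR (half_lt_self hr)
  have h := hp.hasFPowerSeriesAt.isBigO_sub_partialSum_pow n
  simp only [zero_add, partialSum_eq_taylor hp] at h
  exact h.trans (Asymptotics.IsBigO.of_bound 1 (Eventually.of_forall fun z => by simp))

theorem tendstoUniformlyOn_taylor (hf : DifferentiableOn ℂ f (Metric.ball 0 r)) {ρ : ℝ}
    (hρ : ρ < r) : TendstoUniformlyOn (fun (n : ℕ) z => ∑ k ∈ Finset.range n,
      z ^ k • (k.factorial : ℂ)⁻¹ • iteratedDeriv k f 0) f atTop (Metric.closedBall 0 ρ) := by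
  rcases lt_or_ge ρ 0 with hneg | hpos
  · rw [Metric.closedBall_eq_empty.2 hneg]
    exact tendstoUniformlyOn_empty
  -- A power series on the ball of radius `R` converges uniformly on the ball of radius `R₁` < `R`,
  -- which contains the closed ball of radius `ρ`.
  obtain ⟨R₁, h1, h1'⟩ := exists_between hρ
  obtain ⟨R, h2, h2'⟩ := exists_between h1'
  obtain ⟨p, hp⟩ := exists_hasFPowerSeriesOnBall hf (R := ⟨R, by linarith⟩)
    (show (0 : ℝ) < R by linarith) h2'
  have h := hp.tendstoUniformlyOn (r' := ⟨R₁, by linarith⟩) (ENNReal.coe_lt_coe.2 h2)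
  simp only [zero_add, partialSum_eq_taylor hp] at h
  exact h.mono (Metric.closedBall_subset_ball h1)

/-- Asymptotic expansions of holomorphic functions are Taylor expansions. -/
theorem taylorCoeff_eq_of_isBigO (hf : DifferentiableOn ℂ f (Metric.ball 0 r)) (hr : 0 < r)
    {b : ℕ → F} (hb : ∀ N, (fun z => f z - ∑ k ∈ Finset.range (N + 1), z ^ k • b k)
      =O[𝓝 0] fun z => z ^ (N + 1)) (n : ℕ) :
    (n.factorial : ℂ)⁻¹ • iteratedDeriv n f 0 = b n := by
  have h := ((hb n).sub (isBigO_sub_taylor hf hr (n + 1))).mono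
    (nhdsWithin_le_nhds (s := {0}ᶜ))
  rw [← sub_eq_zero]
  refine coeff_eq_zero_of_isBigO (N := n)
    (c := fun k => (k.factorial : ℂ)⁻¹ • iteratedDeriv k f 0 - b k) ?_ n le_rfl
  refine h.congr_left fun z => ?_
  simp only [smul_sub, Finset.sum_sub_distrib]
  abel

end Taylor

/-! ### Expansion of the resolvent -/

section Family

variable {E : Type*} [NormedAddCommGroup E] [NormedSpace ℂ E]

/-- The coefficient of `zⁿ` in the expansion of `(A(z) - ζ)⁻¹`, if `A(z) = A + ∑ zᵏ B k`. -/
def resCoeff (B : ℕ → E →L[ℂ] E) (A : E →L[ℂ] E) (n : ℕ) (ζ : ℂ) : E →L[ℂ] E :=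
  ∑ c : Composition n, (-1 : ℂ) ^ c.length • (res A ζ * resProd B A c.blocks ζ)

theorem resCoeff_zero (B : ℕ → E →L[ℂ] E) (A : E →L[ℂ] E) (ζ : ℂ) :
    resCoeff B A 0 ζ = res A ζ := by
  have hb : ∀ c : Composition 0, c.blocks = [] := fun c =>
    List.eq_nil_of_length_eq_zero (Nat.le_zero.1 c.length_le)
  let _ : Unique (Composition 0) :=
    { default := default
      uniq := fun c => Composition.ext ((hb c).trans (hb _).symm) }
  rw [resCoeff, Fintype.sum_unique, Composition.length, hb]
  simp [resProd]

/-- Splitting off the first block of each composition gives what comparison of the coefficients of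
zⁿ in R(z) = R - R(A(z) - A)R(z) gives formally. -/
theorem resCoeff_succ (B : ℕ → E →L[ℂ] E) (A : E →L[ℂ] E) {n : ℕ} (hn : n ≠ 0) (ζ : ℂ) :
    resCoeff B A n ζ =
      -∑ k ∈ Finset.Icc 1 n, res A ζ * (B k * resCoeff B A (n - k) ζ) := by
  unfold resCoeff Composition.length
  rw [sum_composition_cons hn fun l => (-1 : ℂ) ^ l.length • (res A ζ * resProd B A l ζ),
    ← Finset.sum_neg_distrib]
  refine Finset.sum_congr rfl fun k _ => ?_
  rw [Finset.mul_sum, Finset.mul_sum, ← Finset.sum_neg_distrib]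
  refine Finset.sum_congr rfl fun c _ => ?_
  rw [List.length_cons, resProd_cons, pow_succ, mul_neg_one, neg_smul, mul_smul_comm,
    mul_smul_comm, mul_assoc (B k)]

/-- The partial sums satisfy a truncated second resolvent identity, in which the k-th term carries a
partial sum of order N - k. -/
theorem sum_resCoeff (B : ℕ → E →L[ℂ] E) (A : E →L[ℂ] E) (N : ℕ) (z ζ : ℂ) :
    ∑ n ∈ Finset.range (N + 1), z ^ n • resCoeff B A n ζ = res A ζ -
      res A ζ * ∑ k ∈ Finset.Icc 1 N, z ^ k •
        (B k * ∑ j ∈ Finset.range (N - k + 1), z ^ j • resCoeff B A j ζ) := by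
  have h1 : ∑ n ∈ Finset.range (N + 1), z ^ n • resCoeff B A n ζ =
      res A ζ + ∑ n ∈ Finset.Icc 1 N, z ^ n • resCoeff B A n ζ := by
    rw [Finset.range_eq_Ico, Finset.sum_eq_sum_Ico_succ_bot N.succ_pos, pow_zero, one_smul,
      resCoeff_zero]
    rfl
  have h2 : ∑ n ∈ Finset.Icc 1 N, z ^ n • resCoeff B A n ζ =
      -∑ n ∈ Finset.Icc 1 N, ∑ k ∈ Finset.Icc 1 n,
        z ^ n • (res A ζ * (B k * resCoeff B A (n - k) ζ)) := by
    rw [← Finset.sum_neg_distrib]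
    refine Finset.sum_congr rfl fun n hn => ?_
    have := (Finset.mem_Icc.1 hn).1
    rw [resCoeff_succ B A (by omega), smul_neg, Finset.smul_sum]
  have h3 : ∑ n ∈ Finset.Icc 1 N, ∑ k ∈ Finset.Icc 1 n,
        z ^ n • (res A ζ * (B k * resCoeff B A (n - k) ζ)) =
      ∑ k ∈ Finset.Icc 1 N, ∑ j ∈ Finset.range (N - k + 1),
        z ^ (k + j) • (res A ζ * (B k * resCoeff B A j ζ)) := by
    rw [Finset.sum_sigma', Finset.sum_sigma']
    refine Finset.sum_bij' (fun x _ => ⟨x.2, x.1 - x.2⟩) (fun x _ => ⟨x.1 + x.2, x.1⟩) ?_ ?_ ?_ ?_ ?_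
    · rintro ⟨n, k⟩ h
      simp only [Finset.mem_sigma, Finset.mem_Icc, Finset.mem_range] at h ⊢
      omega
    · rintro ⟨n, k⟩ h
      simp only [Finset.mem_sigma, Finset.mem_Icc, Finset.mem_range] at h ⊢
      omega
    · rintro ⟨n, k⟩ h
      simp only [Finset.mem_sigma, Finset.mem_Icc] at h
      simp only [Sigma.mk.injEq, heq_eq_eq, and_true]
      omega
    · rintro ⟨n, k⟩ h
      simp
    · rintro ⟨n, k⟩ h
      simp only [Finset.mem_sigma, Finset.mem_Icc] at h
      simp only
      rw [Nat.add_sub_cancel' h.2.2]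
  rw [h1, h2, h3, ← sub_eq_add_neg, Finset.mul_sum]
  congr 1
  refine Finset.sum_congr rfl fun k _ => ?_
  simp only [Finset.mul_sum, Finset.smul_sum, mul_smul_comm, smul_smul, pow_add]

end Family

/-! ### Holomorphic families with an isolated group of eigenvalues -/

section Family

variable {E : Type*} [NormedAddCommGroup E] [NormedSpace ℂ E]

/-- A holomorphic family of operators in the disk of radius `r`, the spectra of which do not meet
the contour `γ`, and where `γ` isolates the eigenvalue `β` at `0`. -/
structure IsIsolatingFamily (A : ℂ → E →L[ℂ] E) (γ : ℝ → ℂ) (β : ℂ) (r : ℝ) : Prop where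
  pos : 0 < r
  diff : DifferentiableOn ℂ A (Metric.ball 0 r)
  isolates : IsolatesEigenvalue (A 0) γ β
  subset : ∀ z ∈ Metric.ball (0 : ℂ) r, spectrum ℂ (A z) ⊆ inside γ ∪ outside γ

variable {A : ℂ → E →L[ℂ] E} {γ : ℝ → ℂ} {β : ℂ} {r : ℝ}

theorem IsIsolatingFamily.zero_mem (h : IsIsolatingFamily A γ β r) :
    (0 : ℂ) ∈ Metric.ball (0 : ℂ) r := Metric.mem_ball_self h.pos

theorem IsIsolatingFamily.contourSet_subset (h : IsIsolatingFamily A γ β r) {z : ℂ}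
    (hz : z ∈ Metric.ball (0 : ℂ) r) : contourSet γ ⊆ resolventSet ℂ (A z) :=
  contourSet_subset_resolventSet (h.subset z hz)

theorem res_sub_eq (h : IsIsolatingFamily A γ β r) {z ζ : ℂ} (hz : z ∈ Metric.ball (0 : ℂ) r)
    (hζ : ζ ∈ contourSet γ) : res (A z) ζ =
      res (A 0) ζ - res (A 0) ζ * ((A z - A 0) * res (A z) ζ) := by
  have h1 := sub_mul_res (h.contourSet_subset hz hζ)
  have h2 := res_mul_sub (h.isolates.contourSet_subset hζ)
  have e : A z - A 0 = (A z - ζ • (1 : E →L[ℂ] E)) - (A 0 - ζ • (1 : E →L[ℂ] E)) := by abel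
  rw [e, sub_mul, h1, mul_sub, mul_one, ← mul_assoc, h2, one_mul, sub_sub_cancel]

/-- P is injective on the range of Q: if Qx = x and Px = 0, then ‖x‖ ≤ ‖Q - P‖‖x‖, so x = 0. -/
theorem finrank_range_le_of_norm_sub_lt {P Q : E →L[ℂ] E} (hQ : Q * Q = Q)
    (h : ‖Q - P‖ < 1) (hf : IsFiniteRank P) :
    IsFiniteRank Q ∧ Module.finrank ℂ Q.range ≤ Module.finrank ℂ P.range := by
  have : FiniteDimensional ℂ P.range := hf
  let T : Q.range →ₗ[ℂ] P.range :=
    (P : E →ₗ[ℂ] E).restrict (p := Q.range) (q := P.range) fun x _ => ⟨x, rfl⟩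
  have hT : Function.Injective T := by
    refine (injective_iff_map_eq_zero T).2 fun x hx => ?_
    have hPx : P (x : E) = 0 := congrArg Subtype.val hx
    have hQx : Q (x : E) = x := (mem_range_of_idem hQ).1 x.2
    by_contra hne
    have h1 : ‖(x : E)‖ ≤ ‖Q - P‖ * ‖(x : E)‖ := by
      refine le_trans (le_of_eq ?_) ((Q - P).le_opNorm x)
      rw [sub_apply, hPx, hQx, sub_zero]
    have h2 : 0 < ‖(x : E)‖ := norm_pos_iff.2 fun e => hne (Subtype.ext e)
    nlinarith
  exact ⟨FiniteDimensional.of_injective T hT, LinearMap.finrank_le_finrank_of_injective hT⟩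

variable [CompleteSpace E]

theorem continuousOn_res_prod (h : IsIsolatingFamily A γ β r) :
    ContinuousOn (fun p : ℂ × ℂ => res (A p.2) p.1) (contourSet γ ×ˢ Metric.ball 0 r) := by
  rintro ⟨ζ, z⟩ ⟨hζ, hz⟩
  have hu : IsUnit (A z - ζ • (1 : E →L[ℂ] E)) := isUnit_sub_smul_one (h.contourSet_subset hz hζ)
  have h1 : ContinuousAt (fun p : ℂ × ℂ => A p.2 - p.1 • (1 : E →L[ℂ] E)) (ζ, z) := by
    refine ContinuousAt.sub ?_ (continuousAt_fst.smul continuousAt_const)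
    exact (h.diff.continuousOn.continuousAt (Metric.isOpen_ball.mem_nhds hz)).comp
      (x := (ζ, z)) continuousAt_snd
  exact (ContinuousAt.comp (f := fun p : ℂ × ℂ => A p.2 - p.1 • (1 : E →L[ℂ] E)) (x := (ζ, z))
    (differentiableAt_inverse (𝕜 := ℂ) hu).continuousAt h1).continuousWithinAt

theorem differentiableOn_res_param (h : IsIsolatingFamily A γ β r) {ζ : ℂ}
    (hζ : ζ ∈ contourSet γ) : DifferentiableOn ℂ (fun z => res (A z) ζ) (Metric.ball 0 r) := by
  intro z hz
  have hu : IsUnit (A z - ζ • (1 : E →L[ℂ] E)) := isUnit_sub_smul_one (h.contourSet_subset hz hζ)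
  exact (differentiableAt_inverse (𝕜 := ℂ) hu).comp_differentiableWithinAt z
    ((h.diff z hz).sub_const _)

theorem differentiableOn_riesz (h : IsIsolatingFamily A γ β r) :
    DifferentiableOn ℂ (fun z => riesz (A z) γ) (Metric.ball 0 r) :=
  ((differentiableOn_contourIntegral h.isolates.contour Metric.isOpen_ball
    (f := fun ζ z => res (A z) ζ) (continuousOn_res_prod h)
    fun _ hζ => differentiableOn_res_param h hζ).const_smul (2 * Real.pi * Complex.I : ℂ)⁻¹).neg

theorem isBigO_res (h : IsIsolatingFamily A γ β r) :
    (fun p : ℂ × ℂ => res (A p.1) p.2) =O[𝓝 0 ×ˢ 𝓟 (contourSet γ)] fun _ => (1 : ℂ) := by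
  obtain ⟨C, hC⟩ := ((isCompact_contourSet h.isolates.contour).prod
    (isCompact_closedBall (0 : ℂ) (r / 2))).exists_bound_of_continuousOn
    ((continuousOn_res_prod h).mono
      (Set.prod_mono_right (Metric.closedBall_subset_ball (half_lt_self h.pos))))
  refine Asymptotics.IsBigO.of_bound C (eventually_prod_principal_iff.2 ?_)
  filter_upwards [Metric.closedBall_mem_nhds (0 : ℂ) (half_pos h.pos)] with z hz ζ hζ
  simpa using hC (ζ, z) ⟨hζ, hz⟩

/-- Subtract `sum_resCoeff` from the second resolvent identity. The k-th term gains zᵏ and meets the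
remainder of order N - k, which is known by induction. The filter makes the estimate uniform in ζ on
the contour, as integration requires. -/
theorem isBigO_resolvent_expansion (h : IsIsolatingFamily A γ β r) (N : ℕ) :
    (fun p : ℂ × ℂ => res (A p.1) p.2 - ∑ n ∈ Finset.range (N + 1),
      p.1 ^ n • resCoeff (powerCoeff A) (A 0) n p.2)
      =O[𝓝 0 ×ˢ 𝓟 (contourSet γ)] fun p => p.1 ^ (N + 1) := by
  induction N using Nat.strong_induction_on with
  | _ N ih =>
    set l := 𝓝 (0 : ℂ) ×ˢ 𝓟 (contourSet γ)
    have hV : (fun p : ℂ × ℂ => A p.1 - A 0 - ∑ k ∈ Finset.Icc 1 N, p.1 ^ k • powerCoeff A k)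
        =O[l] fun p => p.1 ^ (N + 1) := by
      refine ((isBigO_sub_taylor h.diff h.pos (N + 1)).comp_tendsto
        (tendsto_fst (g := 𝓟 (contourSet γ)))).congr_left fun p => ?_
      simp only [Function.comp]
      rw [Finset.range_eq_Ico, Finset.sum_eq_sum_Ico_succ_bot N.succ_pos, sub_sub]
      simp [powerCoeff]
      rfl
    have hR := isBigO_res h
    have hR0 : (fun p : ℂ × ℂ => res (A 0) p.2) =O[l] fun _ => (1 : ℂ) := by
      obtain ⟨C, hC⟩ := (isCompact_contourSet h.isolates.contour).exists_bound_of_continuousOn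
        (continuousOn_res h.isolates.contourSet_subset)
      refine Asymptotics.IsBigO.of_bound C (eventually_prod_principal_iff.2
        (Eventually.of_forall fun z ζ hζ => ?_))
      simpa using hC ζ hζ
    have h1 := hV.mul hR
    have h2 : ∀ k ∈ Finset.Icc 1 N, (fun p : ℂ × ℂ => p.1 ^ k • (powerCoeff A k *
        (res (A p.1) p.2 - ∑ n ∈ Finset.range (N - k + 1),
          p.1 ^ n • resCoeff (powerCoeff A) (A 0) n p.2))) =O[l] fun p => p.1 ^ (N + 1) := by
      intro k hk
      rw [Finset.mem_Icc] at hk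
      have h3 := (ih (N - k) (by omega)).const_mul_left (powerCoeff A k)
      refine ((Asymptotics.isBigO_refl (fun p : ℂ × ℂ => p.1 ^ k) l).smul h3).congr_right
        fun p => ?_
      rw [smul_eq_mul, ← pow_add]
      congr 1
      omega
    have h4 := (hR0.mul ((h1.congr_right fun p => mul_one _).add
      (Asymptotics.IsBigO.sum h2))).neg_left
    refine h4.congr' ?_ (Eventually.of_forall fun p => one_mul _)
    refine eventually_prod_principal_iff.2 ?_
    filter_upwards [Metric.isOpen_ball.mem_nhds h.zero_mem] with z hz ζ hζ
    rw [sum_resCoeff, Finset.sum_apply]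
    conv_rhs => rw [res_sub_eq h hz hζ]
    set R := res (A z) ζ
    set S := res (A 0) ζ
    simp only [mul_sub, smul_sub, Finset.sum_sub_distrib, sub_mul, mul_add, Finset.sum_mul,
      smul_mul_assoc]
    abel

/-- The coefficients of the expansion of `(A(z) - β) P(z)`. -/
def projCoeff (A : ℂ → E →L[ℂ] E) (γ : ℝ → ℂ) (β : ℂ) (n : ℕ) : E →L[ℂ] E :=
  -((2 * Real.pi * Complex.I : ℂ)⁻¹ • ∑ c : Composition n, (-1 : ℂ) ^ c.length •
    contourIntegral γ fun ζ => ((ζ - β) • res (A 0) ζ) * resProd (powerCoeff A) (A 0) c.blocks ζ)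

/-- (a - β)(a - ζ)⁻¹ = 1 + (ζ - β)(a - ζ)⁻¹, and the constant integrates to 0 over a closed contour.
-/
theorem sub_mul_riesz {a : E →L[ℂ] E} (hγ : IsClosedContour γ)
    (ha : contourSet γ ⊆ resolventSet ℂ a) (β : ℂ) : a * riesz a γ - β • riesz a γ =
      -((2 * Real.pi * Complex.I : ℂ)⁻¹ • contourIntegral γ fun ζ => (ζ - β) • res a ζ) := by
  have hr := continuousOn_res ha
  have e : Set.EqOn (fun ζ => (ζ - β) • res a ζ)
      (fun ζ => (a - β • (1 : E →L[ℂ] E)) * res a ζ - 1) (contourSet γ) := fun ζ hζ => by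
    simp only
    rw [sub_mul, mul_res (ha hζ), smul_mul_assoc, one_mul, sub_smul]
    abel
  rw [contourIntegral_congr e, contourIntegral_sub hγ
    (f := fun ζ => (a - β • (1 : E →L[ℂ] E)) * res a ζ) (g := fun _ => 1)
    (continuousOn_const.mul hr) continuousOn_const, contourIntegral_mul_left hγ _ hr, contourIntegral_const hγ, sub_zero,
    ← mul_smul_comm, ← mul_neg, ← riesz, sub_mul, smul_mul_assoc, one_mul]

/-- Multiply the resolvent expansion by ζ - β and integrate. The remainder is bounded by the length
of the contour times its uniform bound. -/
theorem isBigO_projCoeff (h : IsIsolatingFamily A γ β r) (N : ℕ) :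
    (fun z => A z * riesz (A z) γ - β • riesz (A z) γ -
      ∑ n ∈ Finset.range (N + 1), z ^ n • projCoeff A γ β n) =O[𝓝 0] fun z => z ^ (N + 1) := by
  have hγ := h.isolates.contour
  have hfm := h.isolates.finiteMero_smul_res
  have hc : ∀ c : List ℕ, ContinuousOn (fun ζ => ((ζ - β) • res (A 0) ζ) *
      resProd (powerCoeff A) (A 0) c ζ) (contourSet γ) := fun c =>
    (hfm.mul h.isolates.isOpen_poleDomain h.isolates.mem_poleDomain
      (h.isolates.finiteMero_resProd c)).continuousOn_contourSet
      (fun _ hζ => Or.inl (h.isolates.contourSet_subset hζ)) h.isolates.mem_inside.1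
  have hcoef : ∀ n, ContinuousOn (fun ζ => (ζ - β) • resCoeff (powerCoeff A) (A 0) n ζ)
      (contourSet γ) := fun n => by
    simp only [resCoeff, Finset.smul_sum, smul_comm (_ - β), ← smul_mul_assoc (_ - β)]
    exact continuousOn_finsetSum _ fun c _ => (hc c.blocks).const_smul ((-1 : ℂ) ^ c.length)
  have hproj : ∀ n, projCoeff A γ β n = -((2 * Real.pi * Complex.I : ℂ)⁻¹ •
      contourIntegral γ fun ζ => (ζ - β) • resCoeff (powerCoeff A) (A 0) n ζ) := fun n => by
    simp only [resCoeff, Finset.smul_sum, smul_comm (_ - β), ← smul_mul_assoc (_ - β)]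
    rw [contourIntegral_finsetSum hγ _ fun c _ => (hc c.blocks).const_smul ((-1 : ℂ) ^ c.length)]
    simp only [contourIntegral_smul, projCoeff]
  obtain ⟨C, hC⟩ := (isBigO_resolvent_expansion h N).bound
  obtain ⟨M, hM⟩ := (isCompact_contourSet hγ).exists_bound_of_continuousOn
    (f := fun ζ : ℂ => ζ - β) (by fun_prop)
  set L := ∫ t in (0 : ℝ)..1, ‖deriv γ t‖
  refine Asymptotics.IsBigO.of_bound
    (‖(2 * Real.pi * Complex.I : ℂ)⁻¹‖ * (L * (M * C))) ?_
  filter_upwards [eventually_prod_principal_iff.1 hC,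
    Metric.isOpen_ball.mem_nhds h.zero_mem] with z hz hzr
  have hcz : ContinuousOn (fun ζ => (ζ - β) • res (A z) ζ) (contourSet γ) :=
    (by fun_prop : ContinuousOn (fun ζ : ℂ => ζ - β) (contourSet γ)).smul
      (continuousOn_res (h.contourSet_subset hzr))
  have hcs : ContinuousOn (fun ζ => ∑ n ∈ Finset.range (N + 1),
      z ^ n • (ζ - β) • resCoeff (powerCoeff A) (A 0) n ζ) (contourSet γ) :=
    continuousOn_finsetSum _ fun n _ => (hcoef n).const_smul (z ^ n)
  have e : A z * riesz (A z) γ - β • riesz (A z) γ -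
      ∑ n ∈ Finset.range (N + 1), z ^ n • projCoeff A γ β n =
      -((2 * Real.pi * Complex.I : ℂ)⁻¹ • contourIntegral γ fun ζ => (ζ - β) • (res (A z) ζ -
        ∑ n ∈ Finset.range (N + 1), z ^ n • resCoeff (powerCoeff A) (A 0) n ζ)) := by
    simp only [smul_sub (_ - β), Finset.smul_sum, smul_comm (_ - β) (z ^ _)]
    rw [sub_mul_riesz hγ (h.contourSet_subset hzr), contourIntegral_sub hγ hcz hcs,
      contourIntegral_finsetSum hγ
        (f := fun n ζ => z ^ n • (ζ - β) • resCoeff (powerCoeff A) (A 0) n ζ) _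
        fun n _ => (hcoef n).const_smul (z ^ n)]
    simp only [contourIntegral_smul (z ^ _)]
    simp only [hproj, smul_neg, smul_sub, Finset.smul_sum,
      smul_comm (z ^ _) (2 * Real.pi * Complex.I : ℂ)⁻¹, Finset.sum_neg_distrib]
    abel
  rw [e, norm_neg, norm_smul]
  refine (mul_le_mul_of_nonneg_left ?_ (norm_nonneg _)).trans_eq (mul_assoc _ _ _).symm
  rw [mul_assoc L]
  refine norm_contourIntegral_le hγ fun ζ hζ => ?_
  rw [norm_smul, mul_assoc]
  have h1 := hM ζ hζ
  exact mul_le_mul h1 (hz ζ hζ) (norm_nonneg _) ((norm_nonneg _).trans h1)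

theorem isFiniteRank_projCoeff (h : IsIsolatingFamily A γ β r) (n : ℕ) :
    IsFiniteRank (projCoeff A γ β n) := by
  rw [projCoeff, ← neg_one_smul ℂ]
  exact ((IsFiniteRank.sum fun c _ =>
    (h.isolates.isFiniteRank_smul_res_mul c.blocks).smul _).smul _).smul _

theorem groupCoeff_eq (h : IsIsolatingFamily A γ β r) {n : ℕ} (hn : n ≠ 0) :
    groupCoeff A γ n = (groupMult A γ : ℂ)⁻¹ * finiteRankTrace (projCoeff A γ β n) := by
  have hfr : IsFiniteRank (∑ c : Composition n, (-1 : ℂ) ^ c.length • contourIntegral γ fun ζ =>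
      ((ζ - β) • res (A 0) ζ) * resProd (powerCoeff A) (A 0) c.blocks ζ) :=
    IsFiniteRank.sum fun c _ => (h.isolates.isFiniteRank_smul_res_mul c.blocks).smul _
  have e : groupCoeff A γ n = (2 * Real.pi * Complex.I * groupMult A γ)⁻¹ *
      finiteRankTrace (∑ c : Composition n, ((-1 : ℂ) ^ c.length / c.length) •
        contourIntegral γ (resProd (powerCoeff A) (A 0) c.blocks)) := rfl
  rw [e, h.isolates.trace_sum_composition hn, projCoeff, ← neg_smul,
    finiteRankTrace_smul hfr, mul_inv]
  ring

/-- The projections depend continuously on z, so the rank is locally constant, and the disk is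
connected. Finiteness of the rank is carried along from z = 0. -/
theorem riesz_rank_eq (h : IsIsolatingFamily A γ β r) {z : ℂ} (hz : z ∈ Metric.ball (0 : ℂ) r) :
    IsFiniteRank (riesz (A z) γ) ∧
      Module.finrank ℂ (riesz (A z) γ).range = Module.finrank ℂ (riesz (A 0) γ).range := by
  have hid : ∀ w ∈ Metric.ball (0 : ℂ) r, riesz (A w) γ * riesz (A w) γ = riesz (A w) γ :=
    fun w hw => riesz_mul_riesz h.isolates.contour (h.subset w hw)
  have key : ∀ {x y : ℂ}, x ∈ Metric.ball (0 : ℂ) r → y ∈ Metric.ball (0 : ℂ) r →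
      (IsFiniteRank (riesz (A x) γ) → IsFiniteRank (riesz (A y) γ) ∧
        Module.finrank ℂ (riesz (A y) γ).range ≤ Module.finrank ℂ (riesz (A x) γ).range) := by
    intro x y hx hy
    refine (convex_ball (0 : ℂ) r).isPreconnected.induction₂' (fun x y =>
      IsFiniteRank (riesz (A x) γ) → IsFiniteRank (riesz (A y) γ) ∧
        Module.finrank ℂ (riesz (A y) γ).range ≤ Module.finrank ℂ (riesz (A x) γ).range)
      (fun x hx => ?_) (fun x y z _ _ _ hxy hyz hf => ?_) hx hy
    · have hc := (differentiableOn_riesz h).continuousOn x hx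
      have h1 := hc.eventually (Metric.ball_mem_nhds (riesz (A x) γ) one_pos)
      filter_upwards [h1, self_mem_nhdsWithin] with y hy hyr
      have h2 : ‖riesz (A y) γ - riesz (A x) γ‖ < 1 := by
        rw [← dist_eq_norm]; exact hy
      exact ⟨finrank_range_le_of_norm_sub_lt (hid y hyr) h2,
        finrank_range_le_of_norm_sub_lt (hid x hx) (by rwa [norm_sub_rev])⟩
    · have h1 := hxy hf
      have h2 := hyz h1.1
      exact ⟨h2.1, h2.2.trans h1.2⟩
  have h1 := key h.zero_mem hz h.isolates.finiteRank
  exact ⟨h1.1, le_antisymm h1.2 (key hz h.zero_mem h1.1).2⟩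

end Family

/-! ### The weighted mean of an eigenvalue group -/

section Mean

variable {E : Type*} [NormedAddCommGroup E] [InnerProductSpace ℂ E] [CompleteSpace E]
  {A : ℂ → E →L[ℂ] E} {γ : ℝ → ℂ} {β : ℂ} {r : ℝ}

/-- The functional `X ↦ tr (Q X)` for an operator `Q` of finite rank. -/
def traceMul {Q : E →L[ℂ] E} (hQ : IsFiniteRank Q) : (E →L[ℂ] E) →L[ℂ] ℂ :=
  LinearMap.mkContinuous
    { toFun := fun X => finiteRankTrace (Q * X)
      map_add' := fun X Y => by
        rw [mul_add, finiteRankTrace_add (hQ.mul_right X) (hQ.mul_right Y)]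
      map_smul' := fun c X => by
        rw [mul_smul_comm, finiteRankTrace_smul (hQ.mul_right X)]; rfl }
    (Module.finrank ℂ Q.range * ‖Q‖) fun X => by
      have : FiniteDimensional ℂ Q.range := hQ
      refine (norm_finiteRankTrace_le (F := Q * X) (W := Q.range) fun x => ⟨X x, rfl⟩).trans ?_
      rw [mul_assoc]
      exact mul_le_mul_of_nonneg_left (norm_mul_le _ _) (Nat.cast_nonneg _)

/-- Near w the operator U(z) = P(z)Q + (1 - P(z))(1 - Q), with Q = P(w), is invertible and P(z)U(z)
= U(z)Q. By cyclicity tr(A(z)P(z)) = tr(Q U(z)⁻¹A(z)U(z)), a fixed continuous functional of a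
holomorphic function. -/
theorem differentiableOn_trace (h : IsIsolatingFamily A γ β r) :
    DifferentiableOn ℂ (fun z => finiteRankTrace (A z * riesz (A z) γ)) (Metric.ball 0 r) := by
  intro w hw
  refine DifferentiableAt.differentiableWithinAt ?_
  have hid : ∀ z ∈ Metric.ball (0 : ℂ) r, riesz (A z) γ * riesz (A z) γ = riesz (A z) γ :=
    fun z hz => riesz_mul_riesz h.isolates.contour (h.subset z hz)
  set Q := riesz (A w) γ with hQ
  have hQf : IsFiniteRank Q := (riesz_rank_eq h hw).1
  have hnhds := Metric.isOpen_ball.mem_nhds hw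
  have hP : DifferentiableAt ℂ (fun z => riesz (A z) γ) w :=
    (differentiableOn_riesz h).differentiableAt hnhds
  have hA : DifferentiableAt ℂ A w := h.diff.differentiableAt hnhds
  set U : ℂ → E →L[ℂ] E := fun z => riesz (A z) γ * Q + (1 - riesz (A z) γ) * (1 - Q) with hU
  have hUd : DifferentiableAt ℂ U w :=
    (hP.mul_const Q).add ((hP.const_sub 1).mul_const (1 - Q))
  have hU1 : U w = 1 := by
    have hQ2 := hid w hw
    rw [← hQ] at hQ2
    simp only [hU, ← hQ, mul_sub, sub_mul, mul_one, one_mul, hQ2]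
    abel
  have hUu : IsUnit (U w) := hU1 ▸ isUnit_one
  have hinv : DifferentiableAt ℂ (fun z => Ring.inverse (U z)) w :=
    (differentiableAt_inverse (𝕜 := ℂ) hUu).comp w hUd
  have hmain : DifferentiableAt ℂ
      (fun z => traceMul hQf (Ring.inverse (U z) * (A z * U z))) w :=
    (traceMul hQf).differentiableAt.comp w (hinv.mul (hA.mul hUd))
  refine hmain.congr_of_eventuallyEq ?_
  have hev : ∀ᶠ z in 𝓝 w, IsUnit (U z) :=
    hUd.continuousAt.eventually (Units.isOpen.mem_nhds hUu)
  filter_upwards [hev, hnhds] with z hz hzr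
  have h1 : riesz (A z) γ * U z = U z * Q := by
    have hQ2 := hid w hw
    rw [← hQ] at hQ2
    simp only [hU, mul_add, add_mul, mul_sub, sub_mul, mul_one, one_mul, mul_assoc, hQ2]
    simp only [← mul_assoc, hid z hzr]
    abel
  have h2 : riesz (A z) γ = U z * (Q * Ring.inverse (U z)) := by
    rw [← mul_assoc, ← h1, mul_assoc, Ring.mul_inverse_cancel _ hz, mul_one]
  change finiteRankTrace (A z * riesz (A z) γ) =
    finiteRankTrace (Q * (Ring.inverse (U z) * (A z * U z)))
  rw [h2, ← mul_assoc, ← mul_assoc Q, finiteRankTrace_mul_comm (hQf.mul_right _)]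

theorem isBigO_trace (h : IsIsolatingFamily A γ β r) (N : ℕ) :
    (fun z => finiteRankTrace (A z * riesz (A z) γ) - β * groupMult A γ -
      ∑ n ∈ Finset.range (N + 1), z ^ n • finiteRankTrace (projCoeff A γ β n))
      =O[𝓝 0] fun z => z ^ (N + 1) := by
  have hfr := isFiniteRank_projCoeff h
  set S : ℂ → E →L[ℂ] E := fun z => ∑ n ∈ Finset.range (N + 1), z ^ n • projCoeff A γ β n with hS
  -- The trace is bounded by dimension times norm, so the remainder must act in spaces of bounded
  -- dimension. `W` contains the ranges of all terms of the sum, and the rank of P(z) is the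
  -- constant m.
  set W : Submodule ℂ E := (Finset.range (N + 1)).sup fun n => (projCoeff A γ β n).range with hW
  have hWf : FiniteDimensional ℂ W := by
    have : ∀ n, FiniteDimensional ℂ (projCoeff A γ β n).range := hfr
    exact Submodule.finiteDimensional_finset_sup _ _
  have hSW : ∀ z x, S z x ∈ W := fun z x => by
    simp only [hS, sum_apply, smul_apply]
    refine W.sum_mem fun n hn => W.smul_mem _ ?_
    exact Finset.le_sup (f := fun n => (projCoeff A γ β n).range) hn ⟨x, rfl⟩
  obtain ⟨C, hC⟩ := (isBigO_projCoeff h N).bound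
  set m := groupMult A γ
  refine Asymptotics.IsBigO.of_bound ((m + Module.finrank ℂ W : ℕ) * C) ?_
  filter_upwards [hC, Metric.isOpen_ball.mem_nhds h.zero_mem] with z hz hzr
  obtain ⟨hPf, hrank⟩ := riesz_rank_eq h hzr
  set P := riesz (A z) γ
  have hcomm : Commute (A z) P :=
    commute_riesz h.isolates.contour (h.contourSet_subset hzr) (Commute.refl _)
  have hidem : P * P = P := riesz_mul_riesz h.isolates.contour (h.subset z hzr)
  have hAPf : IsFiniteRank (A z * P) := hPf.mul_left _
  have hSf : IsFiniteRank (S z) := IsFiniteRank.of_mem (hSW z)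
  have htr : finiteRankTrace (A z * P) - β * m -
      ∑ n ∈ Finset.range (N + 1), z ^ n • finiteRankTrace (projCoeff A γ β n) =
      finiteRankTrace (A z * P - β • P - S z) := by
    rw [finiteRankTrace_sub (by
        rw [sub_eq_add_neg, ← neg_one_smul ℂ]; exact hAPf.add ((hPf.smul β).smul _)) hSf,
      finiteRankTrace_sub hAPf (hPf.smul β), finiteRankTrace_smul hPf,
      finiteRankTrace_of_idem hPf hidem, hrank, hS,
      finiteRankTrace_sum _ fun n _ => (hfr n).smul _]
    simp only [finiteRankTrace_smul (hfr _), smul_eq_mul]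
    rfl
  have : FiniteDimensional ℂ P.range := hPf
  have hmem : ∀ x, (A z * P - β • P - S z) x ∈ P.range ⊔ W := fun x => by
    refine Submodule.sub_mem _ (Submodule.mem_sup_left ?_) (Submodule.mem_sup_right (hSW z x))
    refine Submodule.sub_mem _ ?_ (Submodule.smul_mem _ _ ⟨x, rfl⟩)
    rw [hcomm.eq]
    exact ⟨A z x, rfl⟩
  rw [htr]
  refine (norm_finiteRankTrace_le hmem).trans ?_
  rw [mul_assoc]
  refine mul_le_mul ?_ hz (norm_nonneg _) (Nat.cast_nonneg _)
  refine Nat.cast_le.2 ((Submodule.finrank_add_le_finrank_add_finrank _ _).trans ?_)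
  rw [hrank]
  rfl

/-- The weighted mean of the eigenvalue group is the sum of its perturbation series. -/
theorem tendstoUniformlyOn_weightedMean (h : IsIsolatingFamily A γ β r)
    (hm : groupMult A γ ≠ 0) {ρ : ℝ} (hρ : ρ < r) :
    TendstoUniformlyOn (fun (N : ℕ) (z : ℂ) => β + ∑ n ∈ Finset.Icc 1 N, z ^ n * groupCoeff A γ n)
      (weightedMean A γ) atTop (Metric.closedBall 0 ρ) := by
  set m : ℂ := (groupMult A γ : ℂ) with hmdef
  have hm' : m ≠ 0 := Nat.cast_ne_zero.2 hm
  set f : ℂ → ℂ := fun z => finiteRankTrace (A z * riesz (A z) γ) - β * m with hf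
  have hfd : DifferentiableOn ℂ f (Metric.ball 0 r) := (differentiableOn_trace h).sub_const _
  have hcoef := taylorCoeff_eq_of_isBigO hfd h.pos
    (b := fun n => finiteRankTrace (projCoeff A γ β n)) (isBigO_trace h)
  -- Since A(0)P(0) = βP(0), the trace at 0 is βm and the constant term vanishes.
  have hf0 : f 0 = 0 := by
    have hP := h.isolates.finiteRank
    simp only [hf]
    rw [h.isolates.mul_riesz, finiteRankTrace_smul hP, finiteRankTrace_of_idem hP
      (riesz_mul_riesz h.isolates.contour h.isolates.spectrum_subset)]
    exact sub_self _
  have hu := tendstoUniformlyOn_taylor hfd hρ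
  have hu1 : TendstoUniformlyOn (fun (N : ℕ) z => ∑ k ∈ Finset.range (N + 1),
      z ^ k • (k.factorial : ℂ)⁻¹ • iteratedDeriv k f 0) f atTop (Metric.closedBall 0 ρ) :=
    fun u hu' => (tendsto_add_atTop_nat 1).eventually (hu u hu')
  have hl := ((uniformContinuous_const_smul m⁻¹).comp_tendstoUniformlyOn hu1)
  have hl2 := (uniformContinuous_id.const_add β).comp_tendstoUniformlyOn hl
  refine (hl2.congr (Eventually.of_forall fun N z _ => ?_)).congr_right fun z _ => ?_
  · simp only [Function.comp, id]
    rw [Finset.range_eq_Ico, Finset.sum_eq_sum_Ico_succ_bot N.succ_pos]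
    simp only [iteratedDeriv_zero, hf0, smul_zero, zero_add, Finset.smul_sum]
    congr 1
    refine Finset.sum_congr rfl fun n hn => ?_
    rw [hcoef, groupCoeff_eq h (by have := (Finset.mem_Ico.1 hn).1; omega)]
    simp only [smul_eq_mul]
    ring
  · simp only [Function.comp, id, hf, smul_eq_mul]
    rw [mul_sub, mul_left_comm, inv_mul_cancel₀ hm', mul_one, add_sub_cancel]
    rfl

end Mean

/-! ### Perturbations of self-adjoint operators -/

section SelfAdjoint

section CStar

variable {𝔸 : Type*} [CStarAlgebra 𝔸] {a : 𝔸}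

/-- By the continuous functional calculus the resolvent is x ↦ (x - ζ)⁻¹ applied to a. -/
theorem norm_res_le_of_isSelfAdjoint (ha : IsSelfAdjoint a) {ζ : ℂ} (hζ : ζ ∈ resolventSet ℂ a)
    {δ : ℝ} (hδ : 0 < δ) (hd : ∀ x ∈ spectrum ℂ a, δ ≤ ‖x - ζ‖) : ‖res a ζ‖ ≤ δ⁻¹ := by
  have hne : ∀ x ∈ spectrum ℂ a, x - ζ ≠ 0 := fun x hx h => hx (sub_eq_zero.1 h ▸ hζ)
  have hn : IsStarNormal a := ha.isStarNormal
  have hc : cfc (fun x : ℂ => x - ζ) a = a - ζ • (1 : 𝔸) := by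
    rw [cfc_sub (fun x : ℂ => x) (fun _ => ζ) a, cfc_id' ℂ a, cfc_const ζ a,
      Algebra.algebraMap_eq_smul_one]
  have e : res a ζ = cfc (fun x : ℂ => (x - ζ)⁻¹) a := by
    rw [cfc_inv (fun x : ℂ => x - ζ) a hne, hc, res]
  rw [e]
  refine norm_cfc_le (inv_nonneg.2 hδ.le) fun x hx => ?_
  rw [norm_inv]
  exact inv_anti₀ hδ (hd x hx)

/-- The spectrum of `b` lies in the `‖b - a‖`-neighbourhood of the spectrum of `a`. -/
theorem exists_mem_spectrum_norm_sub_le (ha : IsSelfAdjoint a) {b : 𝔸} {ζ : ℂ}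
    (hζ : ζ ∈ spectrum ℂ b) : ∃ x ∈ spectrum ℂ a, ‖ζ - x‖ ≤ ‖b - a‖ := by
  by_contra! h
  have hζa : ζ ∈ resolventSet ℂ a := by
    by_contra hs
    have := h ζ hs
    rw [sub_self, norm_zero] at this
    exact (norm_nonneg _).not_gt this
  -- The spectrum of a must be nonempty for a nearest point to exist; in the trivial algebra ζ could
  -- not be in the spectrum of b.
  have hnt : Nontrivial 𝔸 := by
    by_contra hn
    rw [not_nontrivial_iff_subsingleton] at hn
    exact hζ (isUnit_of_subsingleton _)
  obtain ⟨x, hx, hmin⟩ := (spectrum.isCompact (𝕜 := ℂ) a).exists_isMinOn (spectrum.nonempty a)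
    (f := fun x => ‖ζ - x‖) (by fun_prop)
  have hpos : 0 < ‖ζ - x‖ := (norm_nonneg _).trans_lt (h x hx)
  have hr := norm_res_le_of_isSelfAdjoint ha hζa hpos fun y hy => by
    rw [norm_sub_rev y]
    exact hmin hy
  have hu := isUnit_sub_smul_one hζa
  have hinv : ((hu.unit⁻¹ : 𝔸ˣ) : 𝔸) = res a ζ := by
    rw [res, ← Ring.inverse_unit hu.unit, IsUnit.unit_spec]
  -- The resolvent norm of a is at most the inverse distance of ζ from its spectrum, so b - ζ = (a -
  -- ζ) + (b - a) is a small perturbation of a unit.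
  have hlt : ‖b - a‖ < ‖((hu.unit⁻¹ : 𝔸ˣ) : 𝔸)‖⁻¹ := by
    refine (h x hx).trans_le ?_
    rw [le_inv_comm₀ hpos (Units.norm_pos _), hinv]
    exact hr
  refine hζ (mem_resolventSet_of_isUnit ?_)
  have := (hu.unit.add (b - a) hlt).isUnit
  rwa [Units.val_add, IsUnit.unit_spec, show a - ζ • (1 : 𝔸) + (b - a) = b - ζ • (1 : 𝔸) by abel] at this

end CStar

theorem distTo_le_norm_sub {γ : ℝ → ℂ} {S : Set ℂ} {ζ x : ℂ} (hζ : ζ ∈ contourSet γ) (hx : x ∈ S) :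
    distTo γ S ≤ ‖ζ - x‖ := by
  rw [← dist_eq_norm]
  refine (csInf_le ⟨0, ?_⟩ (Set.mem_image_of_mem _ hζ)).trans (Metric.infDist_le_dist_of_mem hx)
  rintro _ ⟨η, -, rfl⟩
  exact Metric.infDist_nonneg

variable {E : Type*} [NormedAddCommGroup E] [InnerProductSpace ℂ E] [CompleteSpace E]

/-- The contour still splits the spectrum of an operator that is closer to `A` than the distance
of the contour from the spectrum of `A`. -/
theorem spectrum_subset_of_norm_sub_lt {γ : ℝ → ℂ} (hγ : IsClosedContour γ) {A B : E →L[ℂ] E}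
    (hA : IsSelfAdjoint A) (h : spectrum ℂ A ⊆ inside γ ∪ outside γ)
    (hB : ‖B - A‖ < distTo γ (spectrum ℂ A)) : spectrum ℂ B ⊆ inside γ ∪ outside γ := by
  intro ζ hζ
  obtain ⟨x, hx, hle⟩ := exists_mem_spectrum_norm_sub_le hA hζ
  -- ζ is closer to the spectral point x of A than any point of the contour is, so it inherits the
  -- winding number of x.
  have hlt : ∀ η ∈ contourSet γ, ‖ζ - x‖ < ‖η - x‖ := fun η hη =>
    (hle.trans_lt hB).trans_le (distTo_le_norm_sub hη hx)
  have hn : ζ ∉ contourSet γ := fun hm => (hlt ζ hm).false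
  have hw := windingNumber_eq_of_norm_lt hγ hlt
  exact (h hx).imp (fun h' => ⟨hn, hw.trans h'.2⟩) fun h' => ⟨hn, hw.trans h'.2⟩

/-- The part of a self-adjoint operator in a finite dimensional spectral subspace of a single
eigenvalue is a multiple of the identity. -/
theorem mul_riesz_of_isSelfAdjoint {γ : ℝ → ℂ} (hγ : IsClosedContour γ) {A : E →L[ℂ] E} {β : ℂ}
    (hA : IsSelfAdjoint A) (hβ : β ∈ inside γ) (h : spectrum ℂ A \ {β} ⊆ outside γ)
    (hfin : IsFiniteRank (riesz A γ)) : A * riesz A γ = β • riesz A γ := by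
  have hsp := isSpectralProjection_riesz hγ (spectrum_subset_of_diff hβ h)
  set P := riesz A γ
  have hinv : ∀ u ∈ P.range, (A : E →ₗ[ℂ] E) u ∈ P.range := by
    rintro _ ⟨u, rfl⟩
    exact ⟨A u, (DFunLike.congr_fun hsp.comm u).symm⟩
  have : FiniteDimensional ℂ P.range := hfin
  have hsym := (ContinuousLinearMap.isSelfAdjoint_iff_isSymmetric.1 hA).restrict_invariant hinv
  set T := (A : E →ₗ[ℂ] E).restrict hinv
  -- An eigenvalue of the restriction is a spectral point of A inside the contour, hence β. As
  -- symmetric operators in finite dimension are diagonalizable, the restriction is β.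
  have hle : ⨆ μ, Module.End.eigenspace T μ ≤ Module.End.eigenspace T β := by
    refine iSup_le fun μ u hu => ?_
    rw [Module.End.mem_eigenspace_iff] at hu ⊢
    by_cases hu0 : u = 0
    · simp [hu0]
    have hu' : A u = μ • (u : E) := congrArg Subtype.val hu
    have hμ : μ ∈ spectrumOn A P.range := fun hb => hu0 (Subtype.ext
      (hb.injOn u.2 P.range.zero_mem (by simp [hu'])))
    rw [hsp.spectrum_range] at hμ
    have : μ = β := by
      by_contra hne
      exact Set.disjoint_left.1 (disjoint_inside_outside γ) hμ.2 (h ⟨hμ.1, hne⟩)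
    rw [hu, this]
  have htop : Module.End.eigenspace T β = ⊤ := by
    rw [eq_top_iff]
    refine le_trans ?_ hle
    rw [top_le_iff, ← Submodule.orthogonal_eq_bot_iff]
    exact hsym.orthogonalComplement_iSup_eigenspaces_eq_bot
  ext u
  have hm : (⟨P u, u, rfl⟩ : P.range) ∈ Module.End.eigenspace T β := htop ▸ Submodule.mem_top
  exact congrArg Subtype.val (Module.End.mem_eigenspace_iff.1 hm)

/-- The rank of the Riesz projection is positive if the contour encloses a spectral point. -/
theorem finrank_riesz_ne_zero {γ : ℝ → ℂ} (hγ : IsClosedContour γ) {A : E →L[ℂ] E} {β : ℂ}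
    (hβ : β ∈ spectrum ℂ A) (hβ' : β ∈ inside γ) (h : spectrum ℂ A ⊆ inside γ ∪ outside γ)
    (hfin : IsFiniteRank (riesz A γ)) : Module.finrank ℂ (riesz A γ).range ≠ 0 := by
  have hsp := isSpectralProjection_riesz hγ h
  have : FiniteDimensional ℂ (riesz A γ).range := hfin
  intro h0
  rw [Submodule.finrank_eq_zero] at h0
  have hm : β ∈ spectrumOn A (riesz A γ).range := by
    rw [hsp.spectrum_range]
    exact ⟨hβ, hβ'⟩
  -- On the zero subspace every map is bijective, so nothing lies in `spectrumOn`.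
  refine hm ?_
  rw [h0]
  simp

end SelfAdjoint

/-! ### Numerical range on an invariant subspace -/

section Range

variable {E : Type*} [NormedAddCommGroup E] [InnerProductSpace ℂ E]

variable {Q : E →L[ℂ] E} {W₂ : Submodule ℂ E} [CompleteSpace W₂]

theorem mul_starProjection_of_eqOn (h₂ : ∀ u ∈ W₂, Q u = u) :
    Q * W₂.starProjection = W₂.starProjection := by
  ext u
  exact h₂ _ (Submodule.starProjection_apply_mem _ _)

theorem re_inner_algebraMap (x : ℝ) (u : E) :
    (inner ℂ u (algebraMap ℝ (E →L[ℂ] E) x u)).re = x * ‖u‖ ^ 2 := by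
  have e : algebraMap ℝ (E →L[ℂ] E) x u = (x : ℂ) • u := by
    rw [Algebra.algebraMap_eq_smul_one, Complex.coe_smul]
    rfl
  rw [e, inner_smul_right, inner_self_eq_norm_sq_to_K, Complex.re_ofReal_mul]
  refine congrArg (x * ·) ?_
  rw [← inner_self_eq_norm_sq (𝕜 := ℂ) u, inner_self_eq_norm_sq_to_K]
  rfl

/-- `spectrumOn` asks for bijectivity only, which is invertibility by the bounded inverse theorem;
the isometry carries bijectivity over. -/
theorem spectrum_eq_spectrumOn {F : Type*} [NormedAddCommGroup F] [InnerProductSpace ℂ F]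
    [CompleteSpace F] {T : E →L[ℂ] E} {S : F →L[ℂ] F} {M : Submodule ℂ E} (ι : F →ₗᵢ[ℂ] E)
    (hι : ∀ u, u ∈ M ↔ ∃ v, ι v = u) (h : ∀ v, ι (S v) = T (ι v)) :
    spectrum ℂ S = spectrumOn T M := by
  ext ζ
  have e : ∀ v, ι ((S - ζ • (1 : F →L[ℂ] F)) v) = T (ι v) - ζ • ι v := fun v => by
    rw [← h, ← map_smul, ← map_sub]
    rfl
  have hr : ζ ∈ resolventSet ℂ S ↔ Function.Bijective (S - ζ • (1 : F →L[ℂ] F)) := by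
    rw [← ContinuousLinearMap.isUnit_iff_bijective]
    exact ⟨isUnit_sub_smul_one, mem_resolventSet_of_isUnit⟩
  refine not_congr (hr.trans ⟨fun hb => ⟨fun u hu => ?_, fun u hu w hw h' => ?_, fun w hw => ?_⟩,
    fun hb => ⟨fun v w h' => ι.injective (hb.injOn ((hι _).2 ⟨v, rfl⟩) ((hι _).2 ⟨w, rfl⟩) ?_),
      fun w => ?_⟩⟩)
  · obtain ⟨v, rfl⟩ := (hι u).1 hu
    exact (hι _).2 ⟨_, e v⟩
  · obtain ⟨v, rfl⟩ := (hι u).1 hu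
    obtain ⟨x, rfl⟩ := (hι w).1 hw
    exact congrArg ι (hb.injective (ι.injective ((e v).trans (h'.trans (e x).symm))))
  · obtain ⟨x, rfl⟩ := (hι w).1 hw
    obtain ⟨v, rfl⟩ := hb.surjective x
    exact ⟨ι v, (hι _).2 ⟨v, rfl⟩, (e v).symm⟩
  · exact (e v).symm.trans ((congrArg ι h').trans (e w))
  · obtain ⟨u, hu, h'⟩ := hb.surjOn ((hι (ι w)).2 ⟨w, rfl⟩)
    obtain ⟨v, rfl⟩ := (hι u).1 hu
    exact ⟨v, ι.injective ((e v).trans h')⟩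

variable [CompleteSpace E] {W₁ : Submodule ℂ E} [CompleteSpace W₁]

theorem mul_norm_sq_le_of_le_spectrum {T : E →L[ℂ] E} (hT : IsSelfAdjoint T) {μ : ℝ}
    (hμ : ∀ x : ℝ, (x : ℂ) ∈ spectrum ℂ T → μ ≤ x) (u : E) :
    μ * ‖u‖ ^ 2 ≤ (inner ℂ u (T u)).re := by
  have hle : algebraMap ℝ (E →L[ℂ] E) μ ≤ T :=
    (algebraMap_le_iff_le_spectrum (a := T) (r := μ) hT).2 fun x hx =>
      hμ x ((spectrum.algebraMap_mem_iff ℂ).2 hx)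
  rw [ContinuousLinearMap.le_def, ContinuousLinearMap.isPositive_def] at hle
  have h := hle.2 u
  rw [ContinuousLinearMap.reApplyInnerSelf_apply, inner_re_symm, sub_apply, inner_sub_right,
    map_sub, sub_nonneg] at h
  exact (re_inner_algebraMap μ u).symm.trans_le h

theorem sInf_spectrum_mul_le {T : E →L[ℂ] E} (hT : IsSelfAdjoint T) (u : E) :
    sInf {x : ℝ | (x : ℂ) ∈ spectrum ℂ T} * ‖u‖ ^ 2 ≤ (inner ℂ u (T u)).re := by
  refine mul_norm_sq_le_of_le_spectrum hT (fun x hx =>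
    csInf_le ⟨-(‖T‖ * ‖(1 : E →L[ℂ] E)‖), fun y hy => ?_⟩ hx) u
  have := spectrum.norm_le_norm_mul_of_mem (show (y : ℂ) ∈ spectrum ℂ T from hy)
  rw [Complex.norm_real] at this
  exact neg_le_of_abs_le this

/-- A self-adjoint operator is bounded below on a closed invariant subspace by the lower end of
its spectrum there. -/
theorem sInf_spectrumOn_mul_le {T : E →L[ℂ] E} (hT : IsSelfAdjoint T) {M : Submodule ℂ E}
    [CompleteSpace M] (hM : ∀ u ∈ M, T u ∈ M) {u : E} (hu : u ∈ M) :
    sInf {x : ℝ | (x : ℂ) ∈ spectrumOn T M} * ‖u‖ ^ 2 ≤ (inner ℂ u (T u)).re := by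
  have hS : IsSelfAdjoint (T.restrict hM) :=
    ContinuousLinearMap.isSelfAdjoint_iff_isSymmetric.2 fun x y =>
      ContinuousLinearMap.isSelfAdjoint_iff_isSymmetric.1 hT x y
  have h := sInf_spectrum_mul_le hS ⟨u, hu⟩
  rw [spectrum_eq_spectrumOn (T := T) (M := M) M.subtypeₗᵢ
    (fun u => ⟨fun hu => ⟨⟨u, hu⟩, rfl⟩, fun ⟨v, hv⟩ => hv ▸ v.2⟩) fun v => rfl] at h
  exact h

theorem starProjection_mul_of_eqOn (hQ : IsSelfAdjoint Q) (h₂ : ∀ u ∈ W₂, Q u = u) :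
    W₂.starProjection * Q = W₂.starProjection := by
  have h := congrArg star (mul_starProjection_of_eqOn h₂)
  rwa [star_mul, hQ.star_eq, (isSelfAdjoint_starProjection W₂).star_eq] at h

/-- The form of Q - P at u is the form of Q at the component w of u orthogonal to both subspaces, so
0 ≤ Q - P ≤ q. -/
theorem norm_sub_starProjection_le (hQ : IsSelfAdjoint Q)
    (hpos : ∀ u, 0 ≤ (inner ℂ u (Q u)).re) (h₁ : ∀ u ∈ W₁, Q u = 0) (h₂ : ∀ u ∈ W₂, Q u = u)
    {q : ℝ} (hq : 0 ≤ q) (h₃ : ∀ u ∈ (W₁ ⊔ W₂)ᗮ, (inner ℂ u (Q u)).re ≤ q * ‖u‖ ^ 2) :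
    ‖Q - W₂.starProjection‖ ≤ q := by
  have hsym : ∀ u v, inner ℂ (Q u) v = inner ℂ u (Q v) :=
    ContinuousLinearMap.isSelfAdjoint_iff_isSymmetric.1 hQ
  set P := W₂.starProjection
  have hS : IsSelfAdjoint (Q - P) := hQ.sub (isSelfAdjoint_starProjection W₂)
  -- Eigenspaces of the symmetric operator Q for the distinct values 0 and 1 are orthogonal.
  have horth : W₁ ≤ W₂ᗮ := fun u hu v hv => by
    rw [← h₂ v hv, hsym, h₁ u hu, inner_zero_right]
  have key : ∀ u, ∃ w ∈ (W₁ ⊔ W₂)ᗮ, ‖w‖ ≤ ‖u‖ ∧ inner ℂ u ((Q - P) u) = inner ℂ w (Q w) := by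
    intro u
    set v := u - P u with hv
    set w := v - W₁.starProjection v with hw
    have hv2 : v ∈ W₂ᗮ := Submodule.sub_starProjection_mem_orthogonal u
    have hP1 : W₁.starProjection v ∈ W₁ := Submodule.starProjection_apply_mem _ _
    have hP2 : P u ∈ W₂ := Submodule.starProjection_apply_mem _ _
    have hw1 : w ∈ W₁ᗮ := Submodule.sub_starProjection_mem_orthogonal v
    have hQv : (Q - P) u = Q v := by
      rw [hv, map_sub, h₂ _ hP2]
      rfl
    have hQw : Q v = Q w := by
      rw [hw, map_sub Q v, h₁ _ hP1, sub_zero]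
    have hu : u = P u + W₁.starProjection v + w := by rw [hw, hv]; abel
    have i1 : inner ℂ (P u) (Q v) = 0 := by rw [← hsym, h₂ _ hP2]; exact hv2 _ hP2
    have i2 : inner ℂ (W₁.starProjection v) (Q v) = 0 := by
      rw [← hsym, h₁ _ hP1, inner_zero_left]
    refine ⟨w, ?_, ?_, ?_⟩
    · rw [← Submodule.inf_orthogonal]
      exact ⟨hw1, Submodule.sub_mem _ hv2 (horth hP1)⟩
    · have a : ‖v‖ ≤ ‖u‖ := by
        have := Submodule.starProjection_orthogonal_val (K := W₂) u
        rw [hv, ← this]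
        exact (W₂ᗮ.starProjection.le_of_opNorm_le (Submodule.starProjection_norm_le _) u).trans_eq
          (one_mul _)
      have b : ‖w‖ ≤ ‖v‖ := by
        have := Submodule.starProjection_orthogonal_val (K := W₁) v
        rw [hw, ← this]
        exact (W₁ᗮ.starProjection.le_of_opNorm_le (Submodule.starProjection_norm_le _) v).trans_eq
          (one_mul _)
      exact b.trans a
    · rw [hQv]
      nth_rw 1 [hu]
      rw [inner_add_left, inner_add_left, i1, i2, zero_add, zero_add, hQw]
  have hsymS := ContinuousLinearMap.isSelfAdjoint_iff_isSymmetric.1 hS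
  have h0 : 0 ≤ Q - P := by
    rw [ContinuousLinearMap.nonneg_iff_isPositive, ContinuousLinearMap.isPositive_def]
    refine ⟨hsymS, fun u => ?_⟩
    obtain ⟨w, -, -, hw⟩ := key u
    rw [ContinuousLinearMap.reApplyInnerSelf_apply, inner_re_symm, hw]
    exact hpos w
  rw [CStarAlgebra.norm_le_iff_le_algebraMap _ hq h0, ContinuousLinearMap.le_def,
    ContinuousLinearMap.isPositive_def]
  refine ⟨?_, fun u => ?_⟩
  · exact ContinuousLinearMap.isSelfAdjoint_iff_isSymmetric.1
      ((IsSelfAdjoint.algebraMap _ (IsSelfAdjoint.all q)).sub hS)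
  · obtain ⟨w, hw3, hle, hw⟩ := key u
    rw [ContinuousLinearMap.reApplyInnerSelf_apply, inner_re_symm, sub_apply, inner_sub_right, hw,
      map_sub, sub_nonneg]
    exact ((h₃ w hw3).trans (mul_le_mul_of_nonneg_left
      (pow_le_pow_left₀ (norm_nonneg _) hle 2) hq)).trans_eq (re_inner_algebraMap q u).symm

end Range

/-! ### The energy operators -/

theorem cut_add_cut_compl {S : Set Cell} (hS : MeasurableSet S) (u : L2Field) :
    cut hS u + cut hS.compl u = u := by
  ext1 i
  refine Lp.ext ?_
  filter_upwards [Lp.coeFn_add (cutScalar hS (u i)) (cutScalar hS.compl (u i)),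
    cutScalar_ae hS (u i), cutScalar_ae hS.compl (u i)] with y h1 h2 h3
  refine h1.trans ?_
  rw [Pi.add_apply, h2, h3]
  exact Set.indicator_self_add_compl_apply S (u i) y

theorem cut_cut {S : Set Cell} (hS : MeasurableSet S) (u : L2Field) :
    cut hS (cut hS u) = cut hS u := by
  ext1 i
  refine Lp.ext ?_
  filter_upwards [cutScalar_ae hS (cutScalar hS (u i)), cutScalar_ae hS (u i)] with y h1 h2
  refine h1.trans ?_
  by_cases hy : y ∈ S
  · rw [Set.indicator_of_mem hy]
    rfl
  · rw [Set.indicator_of_notMem hy]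
    exact (h2.trans (Set.indicator_of_notMem hy _)).symm

theorem isSelfAdjoint_cut {S : Set Cell} (hS : MeasurableSet S) : IsSelfAdjoint (cut hS) := by
  refine ContinuousLinearMap.isSelfAdjoint_iff_isSymmetric.2 fun u v => ?_
  change inner ℂ (cut hS u) v = inner ℂ u (cut hS v)
  rw [← inner_conj_symm, inner_cut, inner_cut, ← integral_conj]
  refine integral_congr_ae (ae_of_all _ fun y => ?_)
  simp only [map_sum, map_mul, Complex.conj_conj]
  exact Finset.sum_congr rfl fun i _ => mul_comm _ _

theorem adjoint_curl_comp_curl : ContinuousLinearMap.adjoint curl ∘L curl = 1 :=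
  (ContinuousLinearMap.norm_map_iff_adjoint_comp_self curl).1 fun u => (norm_J u).symm

section Crystal

variable {D : Set Cell} (hD : MeasurableSet D)

theorem energyH_eq : energyH hD = 1 - energyD hD := by
  rw [eq_sub_iff_add_eq', ← adjoint_curl_comp_curl]
  ext1 u
  simp only [energyD, energyH, add_apply, ContinuousLinearMap.comp_apply, ← map_add,
    cut_add_cut_compl]

theorem isSelfAdjoint_energyD : IsSelfAdjoint (energyD hD) :=
  (isSelfAdjoint_cut hD).adjoint_conj curl

theorem inner_energyD (u : J) :
    inner ℂ u (energyD hD u) = inner ℂ (cut hD (curl u)) (cut hD (curl u)) := by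
  have h := ContinuousLinearMap.isSelfAdjoint_iff_isSymmetric.1 (isSelfAdjoint_cut hD)
  change inner ℂ u (ContinuousLinearMap.adjoint curl (cut hD (curl u))) = _
  rw [ContinuousLinearMap.adjoint_inner_right]
  refine Eq.trans ?_ (h (curl u) (cut hD (curl u))).symm
  exact congrArg _ (cut_cut hD _).symm

theorem energyD_of_mem_W1 {u : J} (hu : u ∈ W1 hD) : energyD hD u = 0 := by
  have h : cut hD (curl u) = 0 := hu
  change ContinuousLinearMap.adjoint curl (cut hD (curl u)) = 0
  rw [h, map_zero]

theorem energyD_of_mem_W2 {u : J} (hu : u ∈ W2 hD) : energyD hD u = u := by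
  have h : cut hD.compl (curl u) = 0 := hu
  have h' : energyH hD u = 0 := by
    change ContinuousLinearMap.adjoint curl (cut hD.compl (curl u)) = 0
    rw [h, map_zero]
  rw [energyH_eq] at h'
  exact (sub_eq_zero.1 h').symm

instance : CompleteSpace (W1 hD) :=
  inferInstanceAs (CompleteSpace (cut hD ∘L curl).ker)

instance : CompleteSpace (W3 hD) :=
  inferInstanceAs (CompleteSpace ((W1 hD ⊔ W2 hD)ᗮ : Submodule ℂ J))

theorem energyD_mem_W3 {u : J} (hu : u ∈ W3 hD) : energyD hD u ∈ W3 hD := by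
  have hsym : ∀ u v, inner ℂ (energyD hD u) v = inner ℂ u (energyD hD v) :=
    ContinuousLinearMap.isSelfAdjoint_iff_isSymmetric.1 (isSelfAdjoint_energyD hD)
  intro w hw
  rw [← hsym]
  refine hu _ ?_
  obtain ⟨w₁, h₁, w₂, h₂, rfl⟩ := Submodule.mem_sup.1 hw
  rw [map_add, energyD_of_mem_W1 hD h₁, energyD_of_mem_W2 hD h₂, zero_add]
  exact Submodule.mem_sup_right h₂

theorem resonanceOp_eq : resonanceOp hD = (1 / 2 : ℂ) • 1 - energyD hD := by
  ext1 u
  rw [resonanceOp, energyH_eq]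
  change (1 / 2 : ℂ) • (u - energyD hD u - energyD hD u) = (1 / 2 : ℂ) • u - energyD hD u
  module

/-- T = 1/2 - `energyD` is bounded below on the invariant subspace `W3` by the lower end of its
spectrum there. -/
theorem re_inner_energyD_le {u : J} (hu : u ∈ W3 hD) :
    (inner ℂ u (energyD hD u)).re ≤ (1 / 2 - muMinus hD) * ‖u‖ ^ 2 := by
  have hT : IsSelfAdjoint (resonanceOp hD) := by
    rw [resonanceOp_eq]
    refine IsSelfAdjoint.sub (IsSelfAdjoint.smul ?_ (IsSelfAdjoint.one _))
      (isSelfAdjoint_energyD hD)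
    simp [isSelfAdjoint_iff]
  have hinv : ∀ v ∈ W3 hD, resonanceOp hD v ∈ W3 hD := fun v hv => by
    rw [resonanceOp_eq]
    exact Submodule.sub_mem _ (Submodule.smul_mem _ _ hv) (energyD_mem_W3 hD hv)
  have h := sInf_spectrumOn_mul_le hT hinv hu
  change muMinus hD * ‖u‖ ^ 2 ≤ _ at h
  rw [resonanceOp_eq] at h
  change _ ≤ (inner ℂ u ((1 / 2 : ℂ) • u - energyD hD u)).re at h
  rw [inner_sub_right, inner_smul_right, inner_self_eq_norm_sq_to_K, Complex.sub_re] at h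
  have e : ((1 / 2 : ℂ) * ((‖u‖ : ℝ) : ℂ) ^ 2).re = 1 / 2 * ‖u‖ ^ 2 := by
    rw [show (1 / 2 : ℂ) = ((1 / 2 : ℝ) : ℂ) by push_cast; rfl, Complex.re_ofReal_mul,
      ← Complex.ofReal_pow, Complex.ofReal_re]
  have h' : muMinus hD * ‖u‖ ^ 2 ≤ 1 / 2 * ‖u‖ ^ 2 - (inner ℂ u (energyD hD u)).re :=
    h.trans_eq (congrArg (· - _) e)
  linarith

/-- The part of `energyD` off its eigenspace `W2`. -/
def energyDOff : J →L[ℂ] J := energyD hD - (W2 hD).starProjection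

theorem norm_energyDOff_le (hμ : muMinus hD < 0) : ‖energyDOff hD‖ ≤ 1 / 2 - muMinus hD :=
  norm_sub_starProjection_le (W₁ := W1 hD) (W₂ := W2 hD) (isSelfAdjoint_energyD hD)
    (fun u => by
      rw [inner_energyD, inner_self_eq_norm_sq_to_K]
      change 0 ≤ (((‖cut hD (curl u)‖ : ℝ) : ℂ) ^ 2).re
      rw [← Complex.ofReal_pow, Complex.ofReal_re]
      positivity)
    (fun _ hu => energyD_of_mem_W1 hD hu) (fun _ hu => energyD_of_mem_W2 hD hu) (by linarith)
    fun _ hu => re_inner_energyD_le hD hu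

theorem energyDOff_mul_starProjection : energyDOff hD * (W2 hD).starProjection = 0 := by
  rw [energyDOff, sub_mul, mul_starProjection_of_eqOn fun _ hu => energyD_of_mem_W2 hD hu,
    (Submodule.isIdempotentElem_starProjection (W2 hD)).eq, sub_self]

theorem starProjection_mul_energyDOff : (W2 hD).starProjection * energyDOff hD = 0 := by
  rw [energyDOff, mul_sub, starProjection_mul_of_eqOn (isSelfAdjoint_energyD hD)
    fun _ hu => energyD_of_mem_W2 hD hu,
    (Submodule.isIdempotentElem_starProjection (W2 hD)).eq, sub_self]

end Crystal

/-! ### The pencil `P + z⁻¹ (1 - P) (1 - (1 - z) S)` -/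

section Pencil

variable {𝔸 : Type*} [NormedRing 𝔸] [NormedAlgebra ℂ 𝔸] {P S : 𝔸}

/-- The inverse of the pencil, extended to `z = 0`. -/
def pencilInv (P S : 𝔸) (z : ℂ) : 𝔸 :=
  P + z • ((1 - P) * Ring.inverse (1 - (1 - z) • S))

theorem pencilInv_zero : pencilInv P S 0 = P := by
  rw [pencilInv, zero_smul, add_zero]

/-- Put L = 1 - (1 - z)S. The pencil is P + z⁻¹(L - P), where L acts as the identity on the range of
P and commutes with P. So P and L - P = (1 - P)L act on complementary subspaces and are inverted
separately. -/
theorem inverse_pencil (hP : P * P = P) (hPS : P * S = 0) (hSP : S * P = 0) {z : ℂ} (hz : z ≠ 0)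
    (hu : IsUnit (1 - (1 - z) • S)) :
    Ring.inverse (z⁻¹ • (1 - (P + S)) + (P + S)) = pencilInv P S z := by
  set L := 1 - (1 - z) • S with hL
  set K := Ring.inverse L
  have hLK : L * K = 1 := Ring.mul_inverse_cancel _ hu
  have hKL : K * L = 1 := Ring.inverse_mul_cancel _ hu
  have hPL : P * L = P := by rw [hL, mul_sub, mul_smul_comm, hPS, smul_zero, mul_one, sub_zero]
  have hLP : L * P = P := by rw [hL, sub_mul, smul_mul_assoc, hSP, smul_zero, one_mul, sub_zero]
  have hPK : P * K = P := by
    conv_lhs => rw [← hPL, mul_assoc, hLK, mul_one]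
  have hKP : K * P = P := by
    conv_lhs => rw [← hLP, ← mul_assoc, hKL, one_mul]
  have e : z⁻¹ • (1 - (P + S)) + (P + S) = P + z⁻¹ • (L - P) := by
    rw [hL, sub_smul, one_smul]
    simp only [smul_sub, smul_add, smul_smul, inv_mul_cancel₀ hz, one_smul]
    abel
  have e2 : pencilInv P S z = P + z • (K - P) := by rw [pencilInv, sub_mul, one_mul, hPK]
  have h1 : P * (K - P) = 0 := by rw [mul_sub, hPK, hP, sub_self]
  have h2 : P * (L - P) = 0 := by rw [mul_sub, hPL, hP, sub_self]
  have h3 : (K - P) * P = 0 := by rw [sub_mul, hKP, hP, sub_self]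
  have h4 : (L - P) * P = 0 := by rw [sub_mul, hLP, hP, sub_self]
  have a1 : (P + z⁻¹ • (L - P)) * (P + z • (K - P)) = 1 := by
    have h5 : (L - P) * (K - P) = 1 - P := by rw [mul_sub, h4, sub_zero, sub_mul, hLK, hPK]
    rw [add_mul, mul_add, mul_add, hP, mul_smul_comm, h1, smul_mul_assoc, h4, smul_mul_smul_comm,
      h5, inv_mul_cancel₀ hz, one_smul, smul_zero, smul_zero, add_zero, zero_add, add_sub_cancel]
  have a2 : (P + z • (K - P)) * (P + z⁻¹ • (L - P)) = 1 := by
    have h5 : (K - P) * (L - P) = 1 - P := by rw [mul_sub, h3, sub_zero, sub_mul, hKL, hPL]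
    rw [add_mul, mul_add, mul_add, hP, mul_smul_comm, h2, smul_mul_assoc, h3, smul_mul_smul_comm,
      h5, mul_inv_cancel₀ hz, one_smul, smul_zero, smul_zero, add_zero, zero_add, add_sub_cancel]
  rw [e, e2]
  exact Ring.inverse_unit ⟨_, _, a1, a2⟩

variable [CompleteSpace 𝔸]

theorem isUnit_one_sub_smul {t : ℂ} (h : ‖t‖ * ‖S‖ < 1) : IsUnit (1 - t • S) :=
  isUnit_one_sub_of_norm_lt_one ((norm_smul_le _ _).trans_lt h)

theorem norm_inverse_one_sub_smul_le (h1 : ‖(1 : 𝔸)‖ ≤ 1) {t : ℂ} (h : ‖t‖ * ‖S‖ < 1) :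
    ‖Ring.inverse (1 - t • S)‖ ≤ (1 - ‖t‖ * ‖S‖)⁻¹ := by
  set K := Ring.inverse (1 - t • S)
  have hK : K = 1 + t • (S * K) := by
    have := Ring.mul_inverse_cancel _ (isUnit_one_sub_smul h)
    rw [sub_mul, one_mul, smul_mul_assoc, sub_eq_iff_eq_add] at this
    exact this
  have hle : ‖K‖ ≤ 1 + ‖t‖ * ‖S‖ * ‖K‖ := by
    conv_lhs => rw [hK]
    refine (norm_add_le _ _).trans (add_le_add h1 ?_)
    rw [norm_smul, mul_assoc]
    gcongr
    exact norm_mul_le _ _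
  rw [← one_div, le_div_iff₀ (sub_pos.2 h)]
  linarith

theorem differentiableAt_pencilInv {z : ℂ} (h : ‖1 - z‖ * ‖S‖ < 1) :
    DifferentiableAt ℂ (pencilInv P S) z := by
  obtain ⟨u, hu⟩ := isUnit_one_sub_smul h
  have h1 : DifferentiableAt ℂ (fun z : ℂ => 1 - (1 - z) • S) z :=
    (((differentiableAt_const _).sub differentiableAt_id).smul_const S).const_sub 1
  have h2 : DifferentiableAt ℂ (Ring.inverse : 𝔸 → 𝔸) (1 - (1 - z) • S) :=
    hu ▸ differentiableAt_inverse u.isUnit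
  exact (differentiableAt_id.smul ((h2.comp z h1).const_mul (1 - P))).const_add P

/-- A Neumann series bound with |1 - z|‖S‖ ≤ q(1 + |z|). -/
theorem norm_pencilInv_sub_le (h1 : ‖(1 : 𝔸)‖ ≤ 1) (hP : ‖1 - P‖ ≤ 1) {q : ℝ} (hS : ‖S‖ ≤ q)
    {z : ℂ} (hz : q * (1 + ‖z‖) < 1) :
    ‖pencilInv P S z - P‖ ≤ ‖z‖ * (1 - q * (1 + ‖z‖))⁻¹ := by
  have h2 : ‖1 - z‖ * ‖S‖ ≤ q * (1 + ‖z‖) := by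
    rw [mul_comm]
    have := norm_sub_le (1 : ℂ) z
    rw [norm_one] at this
    exact mul_le_mul hS this (norm_nonneg _) ((norm_nonneg _).trans hS)
  rw [pencilInv, add_sub_cancel_left, norm_smul]
  refine mul_le_mul_of_nonneg_left ?_ (norm_nonneg _)
  refine (norm_mul_le _ _).trans ((mul_le_of_le_one_left (norm_nonneg _) hP).trans ?_)
  refine (norm_inverse_one_sub_smul_le h1 (h2.trans_lt hz)).trans ?_
  exact inv_anti₀ (sub_pos.2 hz) (sub_le_sub_left h2 1)

end Pencil

/-- The operator a has a right inverse modulo the projection: a⁻¹P if 0 is in the resolvent set, and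
otherwise the Cauchy transform at 0, where the winding number vanishes. -/
theorem exists_mul_eq_riesz {𝔸 : Type*} [NormedRing 𝔸] [NormedAlgebra ℂ 𝔸] [CompleteSpace 𝔸]
    {a : 𝔸} {γ : ℝ → ℂ} (hγ : IsClosedContour γ) (hγa : contourSet γ ⊆ resolventSet ℂ a)
    (h : 0 ∈ spectrum ℂ a → 0 ∈ outside γ) : ∃ s, a * s = riesz a γ := by
  by_cases h0 : (0 : ℂ) ∈ resolventSet ℂ a
  · refine ⟨res a 0 * riesz a γ, ?_⟩
    rw [← mul_assoc, mul_res h0, zero_smul, add_zero, one_mul]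
  · have h0' := h h0
    refine ⟨rieszTransform a γ 0, ?_⟩
    have := sub_mul_rieszTransform hγ hγa h0'.1
    rwa [h0'.2, zero_smul, sub_zero, sub_zero] at this

/-! ### The inclusion of the energy space -/

/-- Poincaré inequality by Parseval: for divergence free fields |curl u|² has Fourier weights
(2π|n|)², and only modes with |n| ≥ R occur. -/
theorem mul_norm_incl_le {v : J} {R : ℝ}
    (h : ∀ n i, coeff (incl v i) n ≠ 0 → R ^ 2 ≤ (n 0 : ℝ) ^ 2 + (n 1 : ℝ) ^ 2 + (n 2 : ℝ) ^ 2) :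
    2 * Real.pi * R * ‖incl v‖ ≤ ‖v‖ := by
  refine le_of_sq_le_sq ?_ (norm_nonneg _)
  have hc := coeff_curl (toFieldLin_mem v)
  change ∀ n, ∑ k, ‖coeff (curlLin v k) n‖ ^ 2 = (2 * Real.pi) ^ 2 * _ * (‖coeff (incl v 0) n‖ ^ 2 +
    ‖coeff (incl v 1) n‖ ^ 2 + ‖coeff (incl v 2) n‖ ^ 2) at hc
  rw [norm_J, mul_pow, PiLp.norm_sq_eq_of_L2, PiLp.norm_sq_eq_of_L2]
  refine hasSum_le (fun n => ?_)
    ((hasSum_sum fun k _ => hasSum_coeff (incl v k)).mul_left ((2 * Real.pi * R) ^ 2))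
    (hasSum_sum fun k _ => hasSum_coeff (curlLin v k))
  rw [hc, Fin.sum_univ_three, mul_pow]
  by_cases h0 : ∀ i, coeff (incl v i) n = 0
  · simp [h0]
  · push Not at h0
    obtain ⟨i, hi⟩ := h0
    have := h n i hi
    gcongr

/-- Mean zero excludes the mode n = 0, so R = 1 is admissible. Used for `incl` and its adjoint, the
bound accounts for the 4π² in r*. -/
theorem norm_incl_le : ‖incl‖ ≤ (2 * Real.pi)⁻¹ := by
  refine ContinuousLinearMap.opNorm_le_bound _ (by positivity) fun v => ?_
  have h := mul_norm_incl_le (v := v) (R := 1) fun n i hne => by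
    have hn : n ≠ 0 := fun hn => hne (by
      rw [hn, ← integral_eq_coeff_zero]
      exact (toFieldLin_mem v).2.2 i)
    obtain ⟨j, hj⟩ := Function.ne_iff.1 hn
    have e1 : (1 : ℝ) ≤ (n j : ℝ) ^ 2 := by
      have h0 : (1 : ℤ) ≤ (n j) ^ 2 := by
        have := sq_pos_of_ne_zero (a := n j) hj
        omega
      exact_mod_cast h0
    rw [one_pow, ← Fin.sum_univ_three fun j => (n j : ℝ) ^ 2]
    exact e1.trans (Finset.single_le_sum (f := fun j => (n j : ℝ) ^ 2)
      (fun _ _ => sq_nonneg _) (Finset.mem_univ j))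
  rw [mul_one] at h
  rwa [inv_mul_eq_div, le_div_iff₀' (by positivity)]

/-- A space of square integrable fields on which the energy is bounded by the `L²` norm is finite
dimensional. -/
theorem finiteDimensional_of_incl_apply_eq {M : Submodule ℂ L2Field} {T : L2Field →L[ℂ] J}
    (h : ∀ u ∈ M, incl (T u) = u) : FiniteDimensional ℂ M := by
  -- If all Fourier modes of u in the cube of half-width N vanish, then 2πN‖u‖ ≤ ‖Tu‖ ≤ ‖T‖‖u‖ with
  -- N > ‖T‖, so u = 0. The finitely many coefficients in the cube therefore determine u.
  obtain ⟨N, hN⟩ := exists_nat_gt ‖T‖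
  set F : Finset (Fin 3 → ℤ) := Finset.Icc (fun _ => -(N : ℤ)) (fun _ => (N : ℤ))
  set Φ : M →ₗ[ℂ] (F × Fin 3 → ℂ) :=
    { toFun := fun u p => coeff ((u : L2Field) p.2) p.1
      map_add' := fun u v => funext fun p => coeff_add _ _ _
      map_smul' := fun c u => funext fun p => coeff_smul _ _ _ }
  refine FiniteDimensional.of_injective Φ ((injective_iff_map_eq_zero Φ).2 fun u hu => ?_)
  have hbig := mul_norm_incl_le (v := T u) (R := N) fun n i hne => by
    rw [h u u.2] at hne
    have hn : n ∉ F := fun hn => hne (congrFun hu (⟨n, hn⟩, i))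
    have : ∃ j, (N : ℤ) ^ 2 ≤ n j ^ 2 := by
      by_contra! hc
      refine hn (Finset.mem_Icc.2 ⟨fun j => ?_, fun j => ?_⟩)
      · exact (abs_lt.1 (abs_lt_of_sq_lt_sq (hc j) (by positivity))).1.le
      · exact (abs_lt.1 (abs_lt_of_sq_lt_sq (hc j) (by positivity))).2.le
    obtain ⟨j, hj⟩ := this
    rw [← Fin.sum_univ_three fun j => (n j : ℝ) ^ 2]
    refine le_trans ?_ (Finset.single_le_sum (f := fun j => (n j : ℝ) ^ 2)
      (fun _ _ => sq_nonneg _) (Finset.mem_univ j))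
    exact_mod_cast hj
  rw [h u u.2] at hbig
  have h1 := hbig.trans (T.le_opNorm u)
  by_contra hne
  have hpos : 0 < ‖(u : L2Field)‖ := norm_pos_iff.2 fun h0 => hne (Subtype.ext h0)
  have h2 := le_of_mul_le_mul_right h1 hpos
  nlinarith [Real.pi_gt_three, norm_nonneg T]

/-! ### The solution operators -/

section Crystal

variable {D : Set Cell} (hD : MeasurableSet D)

theorem isSelfAdjoint_solutionOp_zero : IsSelfAdjoint (solutionOp hD 0) := by
  rw [solutionOp, if_pos rfl, invLaplacian]
  exact (isSelfAdjoint_starProjection (W2 hD)).conj_adjoint incl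

theorem isFiniteRank_riesz_solutionOp {γ : ℝ → ℂ} (hγ : IsClosedContour γ) {β : ℂ} (hβ : β ≠ 0)
    (hin : β ∈ inside γ) (hout : spectrum ℂ (solutionOp hD 0) \ {β} ⊆ outside γ) :
    IsFiniteRank (riesz (solutionOp hD 0) γ) := by
  have hsub := spectrum_subset_of_diff hin hout
  have hres := contourSet_subset_resolventSet hsub
  have hidem := riesz_mul_riesz hγ hsub
  set A := solutionOp hD 0 with hA
  set P := riesz A γ
  -- On the range of P one has u = A(0)Su, so u is the inclusion of a field whose energy is bounded
  -- by the L² norm of u.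
  obtain ⟨S, hS⟩ := exists_mul_eq_riesz hγ hres fun h0 => hout ⟨h0, hβ.symm⟩
  refine finiteDimensional_of_incl_apply_eq
    (T := (W2 hD).starProjection ∘L invLaplacian ∘L S) fun u hu => ?_
  have e : A (S u) = P u := DFunLike.congr_fun hS u
  rw [(mem_range_of_idem hidem).1 hu, hA, solutionOp, if_pos rfl] at e
  exact e

theorem isolatesEigenvalue_solutionOp {γ : ℝ → ℂ} (hγ : IsClosedContour γ) {β : ℂ} (hβ : β ≠ 0)
    (hin : β ∈ inside γ) (hout : spectrum ℂ (solutionOp hD 0) \ {β} ⊆ outside γ) :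
    IsolatesEigenvalue (solutionOp hD 0) γ β where
  contour := hγ
  mem_inside := hin
  diff_subset := hout
  finiteRank := isFiniteRank_riesz_solutionOp hD hγ hβ hin hout
  mul_riesz := mul_riesz_of_isSelfAdjoint hγ (isSelfAdjoint_solutionOp_zero hD) hin hout
    (isFiniteRank_riesz_solutionOp hD hγ hβ hin hout)

theorem solutionOp_eq (hμ : muMinus hD < 0) {z : ℂ} (hz : (1 / 2 - muMinus hD) * (1 + ‖z‖) < 1) :
    solutionOp hD z =
      incl ∘L pencilInv (W2 hD).starProjection (energyDOff hD) z ∘L invLaplacian := by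
  rw [solutionOp]
  split_ifs with h0
  · rw [h0, pencilInv_zero]
  · have hlt : ‖1 - z‖ * ‖energyDOff hD‖ < 1 := by
      rw [mul_comm]
      have := norm_sub_le (1 : ℂ) z
      rw [norm_one] at this
      exact (mul_le_mul (norm_energyDOff_le hD hμ) this (norm_nonneg _) (by linarith)).trans_lt hz
    rw [← inverse_pencil (Submodule.isIdempotentElem_starProjection (W2 hD)).eq
      (starProjection_mul_energyDOff hD) (energyDOff_mul_starProjection hD) h0
      (isUnit_one_sub_smul hlt), contrastOp, energyH_eq, energyDOff, add_sub_cancel]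

/-- The pencil estimate, multiplied by the norms (2π)⁻¹ of the inclusion and of its adjoint. -/
theorem norm_solutionOp_sub_le (hμ : muMinus hD < 0) {z : ℂ}
    (hz : (1 / 2 - muMinus hD) * (1 + ‖z‖) < 1) :
    ‖solutionOp hD z - solutionOp hD 0‖ ≤
      (4 * Real.pi ^ 2)⁻¹ * (‖z‖ * (1 - (1 / 2 - muMinus hD) * (1 + ‖z‖))⁻¹) := by
  set B := pencilInv (W2 hD).starProjection (energyDOff hD) z - (W2 hD).starProjection with hB
  have hP : ‖1 - (W2 hD).starProjection‖ ≤ 1 := by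
    have : 1 - (W2 hD).starProjection = (W2 hD)ᗮ.starProjection :=
      (Submodule.starProjection_orthogonal' (W2 hD)).symm
    rw [this]
    exact Submodule.starProjection_norm_le _
  have hBn := norm_pencilInv_sub_le ContinuousLinearMap.norm_id_le hP (norm_energyDOff_le hD hμ) hz
  have e : solutionOp hD z - solutionOp hD 0 = incl ∘L B ∘L invLaplacian := by
    rw [solutionOp_eq hD hμ hz, solutionOp, if_pos rfl, hB, ContinuousLinearMap.sub_comp,
      ContinuousLinearMap.comp_sub]
  have hadj : ‖invLaplacian‖ ≤ (2 * Real.pi)⁻¹ := by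
    rw [invLaplacian, LinearIsometryEquiv.norm_map]
    exact norm_incl_le
  rw [e, show (4 * Real.pi ^ 2)⁻¹ * (‖z‖ * (1 - (1 / 2 - muMinus hD) * (1 + ‖z‖))⁻¹) =
    (2 * Real.pi)⁻¹ * (‖z‖ * (1 - (1 / 2 - muMinus hD) * (1 + ‖z‖))⁻¹ * (2 * Real.pi)⁻¹) by
      rw [show 4 * Real.pi ^ 2 = 2 * Real.pi * (2 * Real.pi) by ring, mul_inv]; ring]
  refine (ContinuousLinearMap.opNorm_comp_le _ _).trans ?_
  refine mul_le_mul norm_incl_le ?_ (norm_nonneg _) (by positivity)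
  exact (ContinuousLinearMap.opNorm_comp_le _ _).trans
    (mul_le_mul hBn hadj (norm_nonneg _) ((norm_nonneg _).trans hBn))

theorem distTo_nonneg (γ : ℝ → ℂ) (S : Set ℂ) : 0 ≤ distTo γ S := by
  refine Real.sInf_nonneg ?_
  rintro _ ⟨η, -, rfl⟩
  exact Metric.infDist_nonneg

/-- The smallness condition on `z` that is expressed by the radius `r*`. -/
theorem mul_lt_of_lt_rStar (hμ : -1 / 2 < muMinus hD) (hμ' : muMinus hD < 0) {γ : ℝ → ℂ} {x : ℝ}
    (hx : x < rStar hD γ) :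
    x < 4 * Real.pi ^ 2 * distTo γ (spectrum ℂ (solutionOp hD 0)) *
      (1 - (1 / 2 - muMinus hD) * (1 + x)) := by
  have hd := distTo_nonneg γ (spectrum ℂ (solutionOp hD 0))
  rw [rStar] at hx
  set a := 4 * Real.pi ^ 2 * distTo γ (spectrum ℂ (solutionOp hD 0))
  have ha : 0 ≤ a := mul_nonneg (by positivity) hd
  obtain ⟨q, hq⟩ : ∃ q, q = 1 / 2 - muMinus hD := ⟨_, rfl⟩
  have hq0 : 0 < q := by linarith
  -- With q = 1/2 - μ⁻ and a = 4π²d, the radius is r* = a(1 - q)/(1 + aq), so x < r* is equivalent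
  -- to x < a(1 - q(1 + x)).
  have hzs : |zStar hD| = (1 - q) / q := by
    rw [zStar, show muMinus hD - 1 / 2 = -q by linarith, show muMinus hD + 1 / 2 = 1 - q by linarith,
      div_neg, abs_neg, abs_of_pos (div_pos (by linarith) hq0)]
  rw [← hq] at hx ⊢
  rw [hzs, lt_div_iff₀ (by positivity)] at hx
  have := mul_lt_mul_of_pos_right hx hq0
  have e1 : x * (1 / q + a) * q = x + x * a * q := by field_simp
  have e2 : a * ((1 - q) / q) * q = a * (1 - q) := by field_simp
  rw [e1, e2] at this
  linarith

theorem isIsolatingFamily_solutionOp (hμ : -1 / 2 < muMinus hD) (hμ' : muMinus hD < 0) {β : ℂ}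
    (hβ : β ≠ 0) {γ : ℝ → ℂ} (hγ : IsClosedContour γ) (hin : β ∈ inside γ)
    (hout : spectrum ℂ (solutionOp hD 0) \ {β} ⊆ outside γ) (hr : 0 < rStar hD γ) :
    IsIsolatingFamily (solutionOp hD) γ β (rStar hD γ) := by
  have hd := distTo_nonneg γ (spectrum ℂ (solutionOp hD 0))
  have hlt : ∀ z ∈ Metric.ball (0 : ℂ) (rStar hD γ), (1 / 2 - muMinus hD) * (1 + ‖z‖) < 1 := by
    intro z hz
    have h := mul_lt_of_lt_rStar hD hμ hμ' (mem_ball_zero_iff.1 hz)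
    -- The strict inequality with nonnegative left side also forces 1 - q(1 + |z|) > 0, so the
    -- pencil is invertible.
    have := pos_of_mul_pos_right ((norm_nonneg z).trans_lt h) (by positivity)
    linarith
  refine ⟨hr, fun z hz => ?_, isolatesEigenvalue_solutionOp hD hγ hβ hin hout, fun z hz => ?_⟩
  · have h1 : ‖1 - z‖ * ‖energyDOff hD‖ < 1 := by
      rw [mul_comm]
      have := norm_sub_le (1 : ℂ) z
      rw [norm_one] at this
      exact (mul_le_mul (norm_energyDOff_le hD hμ') this (norm_nonneg _) (by linarith)).trans_lt
        (hlt z hz)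
    have h2 := differentiableAt_pencilInv (P := (W2 hD).starProjection) h1
    have h3 : DifferentiableAt ℂ (fun z => incl ∘L
        pencilInv (W2 hD).starProjection (energyDOff hD) z ∘L invLaplacian) z :=
      (differentiableAt_const _).clm_comp (h2.clm_comp (differentiableAt_const _))
    refine (h3.congr_of_eventuallyEq ?_).differentiableWithinAt
    filter_upwards [Metric.isOpen_ball.mem_nhds hz] with w hw
    exact solutionOp_eq hD hμ' (hlt w hw)
  · refine spectrum_subset_of_norm_sub_lt hγ (isSelfAdjoint_solutionOp_zero hD)
      (spectrum_subset_of_diff hin hout) ?_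
    refine (norm_solutionOp_sub_le hD hμ' (hlt z hz)).trans_lt ?_
    have h := mul_lt_of_lt_rStar hD hμ hμ' (mem_ball_zero_iff.1 hz)
    rw [inv_mul_lt_iff₀ (by positivity), ← div_eq_mul_inv, div_lt_iff₀ (sub_pos.2 (hlt z hz))]
    exact h

end Crystal

end Photonic

end

/-! ### The main theorem -/

theorem mainTheorem3
    {D : Set Photonic.Cell} (hD : MeasurableSet D)
    (hμ : -1 / 2 < Photonic.muMinus hD) (hμ' : Photonic.muMinus hD < 0)
    (β : ℝ) (hβ : 0 < β) (hβ' : (β : ℂ) ∈ spectrum ℂ (Photonic.solutionOp hD 0))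
    (γ : ℝ → ℂ) (hγ : Photonic.IsClosedContour γ)
    (hin : (β : ℂ) ∈ Photonic.inside γ)
    (hout : spectrum ℂ (Photonic.solutionOp hD 0) \ {(β : ℂ)} ⊆ Photonic.outside γ) :
    (∀ z : ℂ, ‖z‖ < Photonic.rStar hD γ →
      Photonic.contourSet γ ⊆ resolventSet ℂ (Photonic.solutionOp hD 0) ∧
      Photonic.contourSet γ ⊆ resolventSet ℂ (Photonic.solutionOp hD z) ∧
      spectrum ℂ (Photonic.solutionOp hD z) ⊆ Photonic.inside γ ∪ Photonic.outside γ ∧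
      Photonic.IsSpectralProjection (Photonic.solutionOp hD z)
        (Photonic.contourProj (Photonic.solutionOp hD) γ z)
        (spectrum ℂ (Photonic.solutionOp hD z) ∩ Photonic.inside γ)) ∧
    DifferentiableOn ℂ (Photonic.contourProj (Photonic.solutionOp hD) γ)
      (Metric.ball 0 (Photonic.rStar hD γ)) ∧
    FiniteDimensional ℂ (Photonic.contourProj (Photonic.solutionOp hD) γ 0).range ∧
    (∀ z : ℂ, ‖z‖ < Photonic.rStar hD γ →
      Nonempty ((Photonic.contourProj (Photonic.solutionOp hD) γ z).range ≃L[ℂ]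
        (Photonic.contourProj (Photonic.solutionOp hD) γ 0).range)) ∧
    ∀ ρ : ℝ, ρ < Photonic.rStar hD γ →
      TendstoUniformlyOn
        (fun (N : ℕ) (z : ℂ) => (β : ℂ) + ∑ n ∈ Finset.Icc 1 N,
          z ^ n * Photonic.groupCoeff (Photonic.solutionOp hD) γ n)
        (Photonic.weightedMean (Photonic.solutionOp hD) γ)
        Filter.atTop (Metric.closedBall 0 ρ) := by
  have hβ0 : (β : ℂ) ≠ 0 := Complex.ofReal_ne_zero.2 hβ.ne'
  have hiso := Photonic.isolatesEigenvalue_solutionOp hD hγ hβ0 hin hout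
  have hfam : 0 < Photonic.rStar hD γ → Photonic.IsIsolatingFamily (Photonic.solutionOp hD) γ β
      (Photonic.rStar hD γ) := Photonic.isIsolatingFamily_solutionOp hD hμ hμ' hβ0 hγ hin hout
  have hmem : ∀ {z : ℂ}, ‖z‖ < Photonic.rStar hD γ →
      0 < Photonic.rStar hD γ ∧ z ∈ Metric.ball (0 : ℂ) (Photonic.rStar hD γ) := fun hz =>
    ⟨(norm_nonneg _).trans_lt hz, mem_ball_zero_iff.2 hz⟩
  refine ⟨fun z hz => ?_, fun z hz => ?_, hiso.finiteRank, fun z hz => ?_, fun ρ hρ => ?_⟩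
  -- `contourProj` at z is by definition the Riesz projection of A(z), so the results on `riesz`
  -- apply verbatim.
  · obtain ⟨hr, hz'⟩ := hmem hz
    have hs := (hfam hr).subset z hz'
    exact ⟨hiso.contourSet_subset, Photonic.contourSet_subset_resolventSet hs, hs,
      Photonic.isSpectralProjection_riesz hγ hs⟩
  · exact Photonic.differentiableOn_riesz (hfam (hmem (mem_ball_zero_iff.1 hz)).1) z hz
  · obtain ⟨hr, hz'⟩ := hmem hz
    obtain ⟨hf, hrank⟩ := Photonic.riesz_rank_eq (hfam hr) hz'
    have h1 : FiniteDimensional ℂ (Photonic.contourProj (Photonic.solutionOp hD) γ z).range := hf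
    have h2 : FiniteDimensional ℂ (Photonic.contourProj (Photonic.solutionOp hD) γ 0).range :=
      hiso.finiteRank
    exact ⟨ContinuousLinearEquiv.ofFinrankEq hrank⟩
  -- If r* were not positive, ρ would be negative and the closed ball empty.
  · by_cases hr : 0 < Photonic.rStar hD γ
    · exact Photonic.tendstoUniformlyOn_weightedMean (hfam hr)
        (Photonic.finrank_riesz_ne_zero hγ hβ' hin hiso.spectrum_subset hiso.finiteRank) hρ
    · rw [Metric.closedBall_eq_empty.2 (hρ.trans_le (not_lt.1 hr))]
      exact tendstoUniformlyOn_empty
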